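/- Let $\mathcal I_I$ be the set of all $\gamma\in H^2([0,1];\mathbb R^3)$ with $\gamma(t)\in\mathbb S^2$ and $\gamma'(t)\neq 0$ for all $t$, $\gamma(0)=\gamma(1)=e_1$ and $\gamma'(0)=\gamma'(1)=e_2$, and let $\mathcal L_I\subset\mathcal I_I$ be the subset of locally convex curves, i.e. those with $\det(\gamma(t),\gamma'(t),\gamma''(t))>0$ for almost every $t$. Both carry the topology of the $H^2$ norm. For an integer $n>0$ let $$\nu_n(t)=\left(\tfrac{1+\cos 2\pi nt}{2},\ \tfrac{\sqrt2}{2}\sin 2\pi nt,\ \tfrac{1-\cos 2\pi nt}{2}\right),\qquad t\in[0,1],$$ which runs $n$ times around the circle $\mathcal C_0$ with diameter $e_1e_3$, and for $\gamma\in\mathcal L_I$ let $(\nu_n*\gamma)(t)=\nu_n(2t)$ for $0\le t\le\frac12$ and $(\nu_n*\gamma)(t)=\gamma(2t-1)$ for $\frac12\le t\le1$. For a compact space $K$ and a continuous map $f:K\to\mathcal L_I$, we write $\nu_n*f$ for any continuous map $g:K\to\mathcal L_I$ such that for every $p\in K$ the curve $g(p)$ is an orientation-preserving reparametrization of $\nu_n*f(p)$,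 that is, $g(p)=(\nu_n*f(p))\circ\sigma_p$ for an increasing bijection $\sigma_p:[0,1]\to[0,1]$. **Proposition.** Let $K$ be a compact space and $f:K\to\mathcal L_I\subset\mathcal I_I$ a continuous map. If $f$ is homotopic to a constant map in $\mathcal I_I$, then for every integer $n>0$ such a map $\nu_n*f:K\to\mathcal L_I$ exists, and every such map is homotopic to a constant map in $\mathcal L_I$. -/

import Mathlib

open MeasureTheory Set
open scoped unitInterval

noncomputable section

namespace LocallyConvex

/-- Euclidean three-space. -/
abbrev E3 : Type := EuclideanSpace ℝ (Fin 3)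

/-- The first vector of the canonical basis. -/
def e₁ : E3 := !₂[1, 0, 0]

/-- The second vector of the canonical basis. -/
def e₂ : E3 := !₂[0, 1, 0]

/-- The Sobolev space `H²([0,1]; ℝ³)`: a curve `pos`, its continuous derivative `vel`, and the
derivative `acc` of `vel`, which is an `L²` function. Both derivatives are determined by `pos`;
`vel_eq` says that `vel` is absolutely continuous with derivative `acc` almost everywhere. -/
structure H2Curve where
  pos : C(I, E3)
  vel : C(I, E3)
  acc : Lp E3 2 (volume : Measure I)
  pos_eq : ∀ t : I, pos t = pos 0 + ∫ s in Iic t, vel s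
  vel_eq : ∀ t : I, vel t = vel 0 + ∫ s in Iic t, acc s

/-- A curve viewed as the triple of the `L²` classes of `γ`, `γ'`, `γ''`. -/
def H2Curve.toL2 (c : H2Curve) :
    Lp E3 2 (volume : Measure I) × Lp E3 2 (volume : Measure I) × Lp E3 2 (volume : Measure I) :=
  (ContinuousMap.toLp 2 volume ℝ c.pos, ContinuousMap.toLp 2 volume ℝ c.vel, c.acc)

/-- The topology of the `H²` norm, the `L²` norms of `γ`, `γ'` and `γ''` taken together. -/
instance : TopologicalSpace H2Curve := TopologicalSpace.induced H2Curve.toL2 inferInstance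

/-- The space `𝓘_I` of `H²` immersions `γ : [0,1] → 𝕊²` with `γ(0) = γ(1) = e₁` and
`γ'(0) = γ'(1) = e₂`. -/
def immersions : Set H2Curve :=
  {c | (∀ t, ‖c.pos t‖ = 1) ∧ (∀ t, c.vel t ≠ 0) ∧
    c.pos 0 = e₁ ∧ c.pos 1 = e₁ ∧ c.vel 0 = e₂ ∧ c.vel 1 = e₂}

/-- The determinant of the matrix with columns `u`, `v`, `w`. -/
def det3 (u v w : E3) : ℝ := Matrix.det (Matrix.of fun i j : Fin 3 => (![u, v, w] j) i)

/-- The space `𝓛_I` of locally convex curves: the curves in `𝓘_I` with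
`det (γ(t), γ'(t), γ''(t)) > 0` for almost every `t` (the second derivative of an `H²` curve
is defined almost everywhere only). -/
def locallyConvex : Set H2Curve :=
  {c | c ∈ immersions ∧ ∀ᵐ t : I, 0 < det3 (c.pos t) (c.vel t) (c.acc t)}

/-- The inclusion of `𝓛_I` into `𝓘_I`. -/
def inclusion : C(locallyConvex, immersions) :=
  ⟨Set.inclusion fun _ h => h.1, continuous_inclusion fun _ h => h.1⟩

/-- A curve in `𝓛_I` as a continuous loop at `e₁`. -/
def toPath (c : locallyConvex) : Path e₁ e₁ where
  toFun t := c.1.pos t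
  source' := c.2.1.2.2.1
  target' := c.2.1.2.2.2.1

/-- `ν_n`: the circle with diameter `e₁e₃` drawn `n` times,
`ν_n(t) = ((1 + cos 2πnt) / 2, (√2 / 2) sin 2πnt, (1 - cos 2πnt) / 2)`. -/
def nu (n : ℕ) : Path e₁ e₁ where
  toFun t := !₂[(1 + Real.cos (2 * Real.pi * (n * (t : ℝ)))) / 2,
    √2 / 2 * Real.sin (2 * Real.pi * (n * (t : ℝ))),
    (1 - Real.cos (2 * Real.pi * (n * (t : ℝ)))) / 2]
  continuous_toFun := by fun_prop
  source' := by simp [e₁]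
  target' := by
    have hc : Real.cos (2 * Real.pi * n) = 1 := by
      rw [mul_comm]; exact Real.cos_nat_mul_two_pi n
    have hs : Real.sin (2 * Real.pi * n) = 0 := by
      have := Real.sin_nat_mul_pi (2 * n)
      push_cast at this
      rw [← this]; ring_nf
    simp [e₁, hc, hs]

/-- `g` is the family `ν_n ∗ f`, where `(ν_n ∗ f)(p)` runs through `ν_n` on `[0, 1/2]` and through
`f(p)` on `[1/2, 1]`, each curve taken up to an orientation-preserving reparametrization:
`ν_n ∗ f(p)` itself has speed different from `1` at `t = 0` and in general a jump of the speed at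
`t = 1/2`, so that it has to be reparametrized in order to be a point of `𝓛_I`. -/
def IsNuConcat {K : Type*} [TopologicalSpace K] (n : ℕ) (f g : C(K, locallyConvex)) : Prop :=
  ∀ p : K, ∃ φ : I ≃o I, ∀ t : I, (g p).1.pos t = ((nu n).trans (toPath (f p))) (φ t)

end LocallyConvex

end

/-! Two facts carry the proof. (A) If `f` is contractible among immersions, then `ν_M * f` is
contractible in `𝓛_I` for all large `M` (`nullhomotopic_of_large`). (B) For every `f` and every `n >
0`, the families `ν_n * f` and `ν_{n+2} * f` are homotopic in `𝓛_I` (`homotopic_one_three`,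
`homotopic_add_two`). Given `n`, add an even number of circles by (B) until (A) applies.

For (A), an immersion is replaced by a chain of small deformations of circles. Subdivide the time
interval and let the `i`-th link be the circle `ν₁`, moved by a matrix that passes from the frame of
the immersion at one division point to the frame at the next one. If the frames are close, this link
is nearly a linear image of a circle, hence locally convex, whether or not the immersion is.
Compactness makes one subdivision fine enough for the whole homotopy of immersions, which thereby
becomes a homotopy of chains ending in a constant map. To connect `ν_M * f` with the chains of `f`,
follow the chain of `f(p)` up to the time `s` and then `f(p)` itself: for `s = 0` this is `ν_M *
f(p)`, for `s = 1` the whole chain.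

For (B), a circle is cut into four arcs, whose axes and angles are then varied until three circles
appear. Along a degenerate path (arcs of length zero, great circles) the final frame would be the
identity throughout. A parameter `η > 0` makes all arcs locally convex and the final frame only
close to the identity. The discrepancy is absorbed by a linear map applied to a short initial piece
of `f(p)`, which keeps the flag at the end of this piece. Such a map of positive determinant exists
because a locally convex arc enters an open cell of flags immediately (`positive_arc`).

Positive reparametrizations and linear maps of positive determinant followed by radial projection
preserve the sign of the determinant, so only oriented flags have to match at junctions; speeds are
adjusted afterwards. All families are built in the coordinates `H2` (initial position, initial
velocity, `L²` acceleration), where continuity comes from `continuous_lp2_opFun`, and the choice of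
parametrization is irrelevant up to homotopy by `homotopic_of_rep`. -/

noncomputable section
namespace LocallyConvex
open Filter Topology

/-! ### Absolutely continuous functions -/

section AC

variable {X Y Z : Type*} [PseudoMetricSpace X] [PseudoMetricSpace Y] [PseudoMetricSpace Z]

/-- The defining sums of `f` are dominated by those of `g` and `h`. Integrals, inner products,
norms, inverses and coordinates are all reduced to this estimate. -/
theorem ac_of_dist_le {f : ℝ → X} {g : ℝ → Y} {h : ℝ → Z} {a b C D : ℝ}
    (hg : AbsolutelyContinuousOnInterval g a b) (hh : AbsolutelyContinuousOnInterval h a b)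
    (H : ∀ s ∈ uIcc a b, ∀ t ∈ uIcc a b,
      dist (f s) (f t) ≤ C * dist (g s) (g t) + D * dist (h s) (h t)) :
    AbsolutelyContinuousOnInterval f a b := by
  have key : Tendsto (fun E : ℕ × (ℕ → ℝ × ℝ) =>
      C * ∑ i ∈ Finset.range E.1, dist (g (E.2 i).1) (g (E.2 i).2)
        + D * ∑ i ∈ Finset.range E.1, dist (h (E.2 i).1) (h (E.2 i).2))
      (AbsolutelyContinuousOnInterval.totalLengthFilter ⊓
        𝓟 (AbsolutelyContinuousOnInterval.disjWithin a b)) (𝓝 0) := by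
    simpa using (Tendsto.const_mul C hg).add (Tendsto.const_mul D hh)
  refine squeeze_zero' (Eventually.of_forall fun E => Finset.sum_nonneg fun i _ => dist_nonneg)
    ?_ key
  filter_upwards [mem_inf_of_right (mem_principal_self _)] with E hE
  rw [Finset.mul_sum, Finset.mul_sum, ← Finset.sum_add_distrib]
  exact Finset.sum_le_sum fun i hi => H _ (hE.1 i hi).1 _ (hE.1 i hi).2

theorem ac_of_dist_le' {f : ℝ → X} {g : ℝ → Y} {a b C : ℝ}
    (hg : AbsolutelyContinuousOnInterval g a b)
    (H : ∀ s ∈ uIcc a b, ∀ t ∈ uIcc a b, dist (f s) (f t) ≤ C * dist (g s) (g t)) :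
    AbsolutelyContinuousOnInterval f a b :=
  ac_of_dist_le (C := C) (D := 0) hg hg fun s hs t ht => by simpa using H s hs t ht

/-- Composites of absolutely continuous functions need not be absolutely continuous. Here strict
monotonicity of `ψ` makes the images of disjoint intervals disjoint, so `ψ` carries the filter that
tests `f ∘ ψ` into the one that tests `f`. -/
theorem ac_comp {f : ℝ → X} {ψ : ℝ → ℝ} {a b : ℝ}
    (hf : AbsolutelyContinuousOnInterval f (ψ a) (ψ b)) (hab : a ≤ b)
    (hψ : AbsolutelyContinuousOnInterval ψ a b) (hm : StrictMonoOn ψ (Icc a b)) :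
    AbsolutelyContinuousOnInterval (f ∘ ψ) a b := by
  have hψ' : ψ a ≤ ψ b := hm.monotoneOn (left_mem_Icc.2 hab) (right_mem_Icc.2 hab) hab
  have hc : ContinuousOn ψ (Icc a b) := by simpa [uIcc_of_le hab] using hψ.continuousOn
  rw [AbsolutelyContinuousOnInterval] at hf
  have : Tendsto (fun E : ℕ × (ℕ → ℝ × ℝ) => ((E.1, fun i => (ψ (E.2 i).1, ψ (E.2 i).2)) :
      ℕ × (ℕ → ℝ × ℝ))) (AbsolutelyContinuousOnInterval.totalLengthFilter ⊓
        𝓟 (AbsolutelyContinuousOnInterval.disjWithin a b))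
      (AbsolutelyContinuousOnInterval.totalLengthFilter ⊓
        𝓟 (AbsolutelyContinuousOnInterval.disjWithin (ψ a) (ψ b))) := by
    refine tendsto_inf.2 ⟨?_, ?_⟩
    · rw [AbsolutelyContinuousOnInterval.totalLengthFilter, tendsto_comap_iff]
      exact hψ
    · rw [tendsto_principal]
      filter_upwards [mem_inf_of_right (mem_principal_self _)] with E hE
      simp only [AbsolutelyContinuousOnInterval.disjWithin, mem_ofPred_eq, uIcc_of_le hab] at hE
      obtain ⟨h1, h2⟩ := hE
      -- By the intermediate value theorem each point of an image interval has a preimage in the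
      -- original interval. Injectivity then transports disjointness.
      have hmem : ∀ i ∈ Finset.range E.1, ∀ z ∈ uIoc (ψ (E.2 i).1) (ψ (E.2 i).2),
          ∃ w ∈ uIoc (E.2 i).1 (E.2 i).2, w ∈ Icc a b ∧ ψ w = z := by
        intro i hi z hz
        obtain ⟨hx, hy⟩ := h1 i hi
        generalize (E.2 i).1 = x at *
        generalize (E.2 i).2 = y at *
        rcases le_total x y with hxy | hxy
        · rw [uIoc_of_le (hm.monotoneOn hx hy hxy)] at hz
          obtain ⟨w, hw, rfl⟩ := intermediate_value_Ioc hxy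
            (hc.mono (Icc_subset_Icc hx.1 hy.2)) hz
          exact ⟨w, by rwa [uIoc_of_le hxy], ⟨hx.1.trans hw.1.le, hw.2.trans hy.2⟩, rfl⟩
        · rw [uIoc_of_ge (hm.monotoneOn hy hx hxy)] at hz
          obtain ⟨w, hw, rfl⟩ := intermediate_value_Ioc hxy
            (hc.mono (Icc_subset_Icc hy.1 hx.2)) hz
          exact ⟨w, by rwa [uIoc_of_ge hxy], ⟨hy.1.trans hw.1.le, hw.2.trans hx.2⟩, rfl⟩
      refine ⟨fun i hi => ?_, ?_⟩
      · rw [uIcc_of_le hψ']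
        have L : ∀ x ∈ Icc a b, ψ x ∈ Icc (ψ a) (ψ b) := fun x hx =>
          ⟨hm.monotoneOn (left_mem_Icc.2 hab) hx hx.1, hm.monotoneOn hx (right_mem_Icc.2 hab) hx.2⟩
        exact ⟨L _ (h1 i hi).1, L _ (h1 i hi).2⟩
      · intro i hi j hj hij
        refine Set.disjoint_left.2 fun z hz hz' => ?_
        obtain ⟨w, hw, hwI, rfl⟩ := hmem i hi z hz
        obtain ⟨w', hw', hwI', he⟩ := hmem j hj _ hz'
        rw [hm.injOn hwI' hwI he] at hw'
        exact Set.disjoint_left.1 (h2 hi hj hij) hw hw'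
  exact hf.comp this

end AC

section ACVec

variable {F : Type*} [NormedAddCommGroup F] [NormedSpace ℝ F]

theorem ac_integral {h : ℝ → F} {a b : ℝ} (hi : IntervalIntegrable h volume a b) :
    AbsolutelyContinuousOnInterval (fun t => ∫ s in a..t, h s) a b := by
  refine ac_of_dist_le' (C := 1)
    (hi.norm.absolutelyContinuousOnInterval_intervalIntegral (c := a) left_mem_uIcc) ?_
  intro s hs t ht
  have h1 : IntervalIntegrable h volume a s := hi.mono_set (uIcc_subset_uIcc_left hs)
  have h2 : IntervalIntegrable h volume a t := hi.mono_set (uIcc_subset_uIcc_left ht)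
  rw [one_mul, dist_eq_norm, Real.dist_eq, intervalIntegral.integral_interval_sub_left h1 h2,
    intervalIntegral.integral_interval_sub_left h1.norm h2.norm]
  exact intervalIntegral.norm_integral_le_abs_integral_norm

/-- The difference of `u` and the primitive of `u1` is absolutely continuous with derivative zero
almost everywhere, hence constant. -/
theorem eq_add_integral_of_ac [CompleteSpace F] {u u1 : ℝ → F} {a b : ℝ} (hu : AbsolutelyContinuousOnInterval u a b)
    (hi : IntervalIntegrable u1 volume a b)
    (hd : ∀ᵐ t, t ∈ uIcc a b → HasDerivAt u (u1 t) t) :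
    ∀ t ∈ uIcc a b, u t = u a + ∫ s in a..t, u1 s := by
  have hA := hu.sub (ac_integral hi)
  obtain ⟨c, hc⟩ := hA.const_of_ae_hasDerivAt_zero (by
    filter_upwards [hd, hi.ae_hasDerivAt_integral] with t h1 h2 ht
    have := (h1 ht).sub (h2 ht a left_mem_uIcc)
    simpa using this)
  intro t ht
  have h1 := hc t ht
  have h2 := hc a left_mem_uIcc
  simp only [Pi.sub_apply, intervalIntegral.integral_same, sub_zero] at h1 h2
  rw [h2, ← h1]; abel

theorem ac_inner {E : Type*} [NormedAddCommGroup E] [InnerProductSpace ℝ E] {u w : ℝ → E} {a b : ℝ}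
    (hu : AbsolutelyContinuousOnInterval u a b) (hw : AbsolutelyContinuousOnInterval w a b) :
    AbsolutelyContinuousOnInterval (fun t => inner ℝ (u t) (w t)) a b := by
  obtain ⟨C, hC⟩ := hu.exists_bound
  obtain ⟨D, hD⟩ := hw.exists_bound
  refine ac_of_dist_le (C := D) (D := C) hu hw fun s hs t ht => ?_
  have : inner ℝ (u s) (w s) - inner ℝ (u t) (w t) =
      inner ℝ (u s - u t) (w s) + inner ℝ (u t) (w s - w t) := by
    rw [inner_sub_left, inner_sub_right]; ring
  rw [Real.dist_eq, this, dist_eq_norm, dist_eq_norm]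
  refine (abs_add_le _ _).trans (add_le_add ?_ ?_)
  · refine (abs_real_inner_le_norm _ _).trans ?_
    rw [mul_comm]
    exact mul_le_mul_of_nonneg_right (hD s hs) (norm_nonneg _)
  · exact (abs_real_inner_le_norm _ _).trans
      (mul_le_mul_of_nonneg_right (hC t ht) (norm_nonneg _))

theorem ac_norm {E : Type*} [NormedAddCommGroup E] {u : ℝ → E} {a b : ℝ}
    (hu : AbsolutelyContinuousOnInterval u a b) :
    AbsolutelyContinuousOnInterval (fun t => ‖u t‖) a b :=
  ac_of_dist_le' (C := 1) hu fun s _ t _ => by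
    rw [one_mul, dist_eq_norm (u s)]; exact dist_norm_norm_le _ _

theorem ac_inv {u : ℝ → ℝ} {a b : ℝ} (hu : AbsolutelyContinuousOnInterval u a b)
    (h0 : ∀ t ∈ uIcc a b, u t ≠ 0) : AbsolutelyContinuousOnInterval (fun t => (u t)⁻¹) a b := by
  obtain ⟨C, hC⟩ := isCompact_uIcc.exists_bound_of_continuousOn
    (f := fun t => (u t)⁻¹) (hu.continuousOn.inv₀ h0)
  refine ac_of_dist_le' (C := C * C) hu fun s hs t ht => ?_
  rw [Real.dist_eq, Real.dist_eq, inv_sub_inv (h0 s hs) (h0 t ht), abs_div, abs_mul, abs_sub_comm,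
    div_eq_mul_inv, mul_comm, mul_inv, ← abs_inv, ← abs_inv]
  have h1 := hC s hs
  have h2 := hC t ht
  rw [Real.norm_eq_abs] at h1 h2
  have hC0 : 0 ≤ C := (abs_nonneg _).trans h1
  gcongr

end ACVec

/-- `H²` curves on the line, coded by the initial position, the initial velocity and the second
derivative. Only the restriction to `[0,1]` matters. -/
abbrev H2 (E : Type*) [NormedAddCommGroup E] : Type _ := E × E × Lp E 2 (volume : Measure ℝ)

/-! ### Coordinates for `H²` curves -/

section H2

variable {E : Type*} [NormedAddCommGroup E]

def hacc (c : H2 E) : ℝ → E := c.2.2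

theorem locallyIntegrable_lp (h : Lp E 2 (volume : Measure ℝ)) : LocallyIntegrable h volume :=
  (Lp.memLp h).locallyIntegrable one_le_two

theorem intervalIntegrable_lp (h : Lp E 2 (volume : Measure ℝ)) (a b : ℝ) :
    IntervalIntegrable h volume a b :=
  ((locallyIntegrable_lp h).integrableOn_isCompact isCompact_uIcc).intervalIntegrable

variable [NormedSpace ℝ E]

def hvel (c : H2 E) (t : ℝ) : E := c.2.1 + ∫ s in (0 : ℝ)..t, hacc c s

def hpos (c : H2 E) (t : ℝ) : E := c.1 + ∫ s in (0 : ℝ)..t, hvel c s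

/-- Cauchy–Schwarz on an interval. It makes the velocity depend continuously on the `L²`
acceleration. -/
theorem norm_integral_lp_le (h : Lp E 2 (volume : Measure ℝ)) (a b : ℝ) :
    ‖∫ s in a..b, h s‖ ≤ |b - a| ^ (1 / 2 : ℝ) * ‖h‖ := by
  have h0 : ∫⁻ s in uIoc a b, ‖h s‖ₑ ≤ ENNReal.ofReal (|b - a| ^ (1 / 2 : ℝ) * ‖h‖) := by
    rw [← eLpNorm_one_eq_lintegral_enorm]
    refine (eLpNorm_le_eLpNorm_mul_rpow_measure_univ (q := 2) one_le_two
      (Lp.stronglyMeasurable h).aestronglyMeasurable).trans ?_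
    rw [mul_comm, ENNReal.ofReal_mul (by positivity)]
    refine mul_le_mul' ?_ ?_
    · rw [Measure.restrict_apply_univ, uIoc, Real.volume_Ioc, max_sub_min_eq_abs,
        ENNReal.ofReal_rpow_of_nonneg (abs_nonneg _) (by norm_num)]
      norm_num
    · refine (eLpNorm_mono_measure _ Measure.restrict_le_self).trans ?_
      rw [Lp.norm_def, ENNReal.ofReal_toReal (Lp.eLpNorm_ne_top h)]
  rw [intervalIntegral.norm_intervalIntegral_eq]
  refine (norm_integral_le_lintegral_norm _).trans ?_
  refine ENNReal.toReal_le_of_le_ofReal (by positivity) ?_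
  simpa [ofReal_norm] using h0

/-- Near `(c, t)` the integral splits into the contribution of the change of acceleration, small by
Cauchy–Schwarz, and the primitive of a fixed function, continuous in its upper limit. -/
theorem continuous_hvel : Continuous fun x : H2 E × ℝ => hvel x.1 x.2 := by
  unfold hvel
  refine (continuous_snd.fst.comp continuous_fst).add ?_
  rw [continuous_iff_continuousAt]
  rintro ⟨c, t⟩
  have h1 : ∀ x : H2 E × ℝ, ∫ s in (0 : ℝ)..x.2, hacc x.1 s =
      (∫ s in (0 : ℝ)..x.2, (x.1.2.2 - c.2.2 : Lp E 2 (volume : Measure ℝ)) s) +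
        ∫ s in (0 : ℝ)..x.2, c.2.2 s := by
    intro x
    rw [← intervalIntegral.integral_add (intervalIntegrable_lp _ _ _)
      (intervalIntegrable_lp _ _ _)]
    refine intervalIntegral.integral_congr_ae ?_
    filter_upwards [Lp.coeFn_sub x.1.2.2 c.2.2] with s hs _
    rw [hs]; simp [hacc]
  have hA : Tendsto (fun x : H2 E × ℝ => ∫ s in (0 : ℝ)..x.2,
      (x.1.2.2 - c.2.2 : Lp E 2 (volume : Measure ℝ)) s) (𝓝 (c, t)) (𝓝 0) := by
    refine squeeze_zero_norm (fun x => norm_integral_lp_le _ _ _) ?_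
    have : Continuous fun x : H2 E × ℝ =>
        |x.2 - 0| ^ (1 / 2 : ℝ) * ‖x.1.2.2 - c.2.2‖ := by
      refine Continuous.mul (Continuous.rpow_const (by fun_prop) fun _ => Or.inr (by norm_num)) ?_
      fun_prop
    simpa using this.tendsto (c, t)
  have hB : Continuous fun t : ℝ => ∫ s in (0 : ℝ)..t, c.2.2 s :=
    intervalIntegral.continuous_primitive (fun a b => intervalIntegrable_lp _ a b) 0
  have := hA.add ((hB.tendsto t).comp (continuous_snd.tendsto (c, t)))
  simp only [zero_add] at this
  exact Tendsto.congr (fun x => (h1 x).symm) this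

theorem continuous_hvel_right (c : H2 E) : Continuous (hvel c) :=
  continuous_hvel.comp (Continuous.prodMk_right c)

theorem continuous_hpos : Continuous fun x : H2 E × ℝ => hpos x.1 x.2 := by
  unfold hpos
  refine (continuous_fst.comp continuous_fst).add ?_
  exact intervalIntegral.continuous_parametric_intervalIntegral_of_continuous
    (f := fun (x : H2 E × ℝ) s => hvel x.1 s) (μ := volume)
    (continuous_hvel.comp ((continuous_fst.comp continuous_fst).prodMk continuous_snd))
    continuous_snd

theorem continuous_hpos_right (c : H2 E) : Continuous (hpos c) :=
  continuous_hpos.comp (Continuous.prodMk_right c)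

theorem hasDerivAt_hpos [CompleteSpace E] (c : H2 E) (t : ℝ) : HasDerivAt (hpos c) (hvel c t) t :=
  ((continuous_hvel_right c).integral_hasStrictDerivAt 0 t).hasDerivAt.const_add _

theorem ae_hasDerivAt_hvel [CompleteSpace E] (c : H2 E) : ∀ᵐ t, HasDerivAt (hvel c) (hacc c t) t := by
  filter_upwards [LocallyIntegrable.ae_hasDerivAt_integral (locallyIntegrable_lp c.2.2)] with t ht
  exact (ht 0).const_add _

theorem ac_hvel (c : H2 E) (a b : ℝ) : AbsolutelyContinuousOnInterval (hvel c) a b := by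
  refine ac_of_dist_le' (C := 1) (ac_integral (intervalIntegrable_lp c.2.2 a b)) fun s _ t _ => ?_
  rw [one_mul, dist_eq_norm, dist_eq_norm,
    intervalIntegral.integral_interval_sub_left (intervalIntegrable_lp _ _ _)
      (intervalIntegrable_lp _ _ _), hvel, hvel, add_sub_add_left_eq_sub]
  unfold hacc
  rw [intervalIntegral.integral_interval_sub_left (intervalIntegrable_lp _ _ _)
      (intervalIntegrable_lp _ _ _)]

theorem ac_hpos [CompleteSpace E] (c : H2 E) (a b : ℝ) : AbsolutelyContinuousOnInterval (hpos c) a b :=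
  ContDiffOn.absolutelyContinuousOnInterval (ContDiff.contDiffOn (by
    rw [contDiff_one_iff_deriv]
    refine ⟨fun t => (hasDerivAt_hpos c t).differentiableAt, ?_⟩
    rw [funext fun t => (hasDerivAt_hpos c t).deriv]
    exact continuous_hvel_right c))

/-- A function with absolutely continuous derivative is the curve of its initial data and its
second derivative. -/
theorem hvel_hpos_mk [CompleteSpace E] {p v : ℝ → E} {h : Lp E 2 (volume : Measure ℝ)}
    (hp : ∀ t ∈ Icc (0 : ℝ) 1, HasDerivWithinAt p (v t) (Icc 0 1) t)
    (hv : AbsolutelyContinuousOnInterval v 0 1)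
    (hh : ∀ᵐ t, t ∈ Icc (0 : ℝ) 1 → HasDerivAt v (h t) t) {c : H2 E} (hc : c = (p 0, v 0, h)) :
    (∀ t ∈ Icc (0 : ℝ) 1, hvel c t = v t) ∧ ∀ t ∈ Icc (0 : ℝ) 1, hpos c t = p t := by
  subst hc
  have hI : uIcc (0 : ℝ) 1 = Icc 0 1 := uIcc_of_le zero_le_one
  have h1 : ∀ t ∈ Icc (0 : ℝ) 1, hvel (p 0, v 0, h) t = v t := by
    intro t ht
    rw [eq_add_integral_of_ac hv (intervalIntegrable_lp h 0 1) (by simpa [hI] using hh) t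
      (by rwa [hI])]
    rfl
  refine ⟨h1, fun t ht => ?_⟩
  have hvc : ContinuousOn v (Icc 0 1) := by simpa [hI] using hv.continuousOn
  have h2 : ∫ s in (0 : ℝ)..t, hvel (p 0, v 0, h) s = ∫ s in (0 : ℝ)..t, v s :=
    intervalIntegral.integral_congr fun s hs => h1 s (by
      rw [uIcc_of_le ht.1] at hs; exact ⟨hs.1, hs.2.trans ht.2⟩)
  have h3 : ∫ s in (0 : ℝ)..t, v s = p t - p 0 := by
    refine intervalIntegral.integral_eq_sub_of_hasDerivAt_of_le ht.1
      (fun s hs => ((hp s ⟨hs.1, hs.2.trans ht.2⟩).continuousWithinAt.mono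
        (Icc_subset_Icc_right ht.2))) (fun s hs => (hp s ⟨hs.1.le, hs.2.le.trans ht.2⟩).hasDerivAt
          (Icc_mem_nhds hs.1 (hs.2.trans_le ht.2))) ?_
    exact (hvc.mono (by rw [uIcc_of_le ht.1]; exact Icc_subset_Icc_right ht.2)).intervalIntegrable
  rw [hpos, h2, h3]; simp

end H2

/-! ### Continuity of families with values in `L²` -/

/-- For locally uniformly Lipschitz maps, continuity in the parameter has to be tested only on a
dense set. This is needed because composition with `ψ` depends on `ψ` strongly but not in the
operator norm of `L²`. -/
theorem continuous_of_equibounded {T V W : Type*} [TopologicalSpace T] [SeminormedAddCommGroup V]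
    [SeminormedAddCommGroup W] {A : T → V → W}
    (hC : ∀ x₀, ∃ C : ℝ, ∀ᶠ x in 𝓝 x₀, ∀ v w, ‖A x v - A x w‖ ≤ C * ‖v - w‖) {D : Set V}
    (hD : Dense D) (hc : ∀ v ∈ D, Continuous fun x => A x v) {h : T → V} (hh : Continuous h) :
    Continuous fun x => A x (h x) := by
  rw [continuous_iff_continuousAt]
  intro x₀
  obtain ⟨C, hC⟩ := hC x₀
  rw [ContinuousAt, Metric.tendsto_nhds]
  intro ε hε
  set B := |C| + 1 with hB
  have hB0 : 0 < B := by positivity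
  obtain ⟨k, hk, hkD⟩ := hD.exists_dist_lt (h x₀) (ε := ε / (4 * B)) (by positivity)
  rw [dist_eq_norm] at hkD
  have e1 : ∀ᶠ x in 𝓝 x₀, ‖h x - k‖ < ε / (4 * B) :=
    ((hh.sub continuous_const).norm.tendsto x₀).eventually (gt_mem_nhds hkD)
  have e2 : ∀ᶠ x in 𝓝 x₀, ‖A x k - A x₀ k‖ < ε / 2 := by
    have : Tendsto (fun x => ‖A x k - A x₀ k‖) (𝓝 x₀) (𝓝 0) := by
      simpa using ((hc k hk).sub (continuous_const (y := A x₀ k))).norm.tendsto x₀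
    exact this.eventually (gt_mem_nhds (by positivity))
  have hbd : ∀ x, (∀ v w, ‖A x v - A x w‖ ≤ C * ‖v - w‖) → ∀ v w, ‖v - w‖ < ε / (4 * B) →
      ‖A x v - A x w‖ < ε / 4 := fun x hx v w hvw => by
    refine (hx v w).trans_lt ?_
    calc C * ‖v - w‖ ≤ B * ‖v - w‖ := by
          gcongr; linarith [le_abs_self C]
      _ < B * (ε / (4 * B)) := by gcongr
      _ = ε / 4 := by field_simp
  have h0 := hC.self_of_nhds
  filter_upwards [hC, e1, e2] with x hx h1 h2
  have a1 := hbd x hx _ _ h1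
  have a2 := hbd x₀ h0 _ _ hkD
  rw [dist_eq_norm]
  have : A x (h x) - A x₀ (h x₀) =
      (A x (h x) - A x k) + (A x k - A x₀ k) - (A x₀ (h x₀) - A x₀ k) := by abel
  rw [this]
  calc _ ≤ ‖A x (h x) - A x k‖ + ‖A x k - A x₀ k‖ + ‖A x₀ (h x₀) - A x₀ k‖ :=
        (norm_sub_le _ _).trans (by gcongr; exact norm_add_le _ _)
    _ < ε := by linarith

section Lp2

variable {E F : Type*} [NormedAddCommGroup E] [NormedAddCommGroup F]

open Classical in
/-- The `L²` class of a function, zero if the function is not square integrable. -/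
def lp2 (f : ℝ → E) : Lp E 2 (volume : Measure ℝ) :=
  if h : MemLp f 2 volume then h.toLp f else 0

theorem lp2_ae {f : ℝ → E} (h : MemLp f 2 volume) : lp2 f =ᵐ[volume] f := by
  rw [lp2, dif_pos h]; exact h.coeFn_toLp

theorem lp2_congr {f g : ℝ → E} (h : f =ᵐ[volume] g) : lp2 f = lp2 g := by
  by_cases hf : MemLp f 2 volume
  · have hg := hf.ae_eq h
    rw [lp2, lp2, dif_pos hf, dif_pos hg, MemLp.toLp_eq_toLp_iff]; exact h
  · have hg : ¬ MemLp g 2 volume := fun hg => hf (hg.ae_eq h.symm)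
    rw [lp2, lp2, dif_neg hf, dif_neg hg]

theorem norm_lp2_le {f : ℝ → E} {C : ℝ} (hC : 0 ≤ C) (h : MemLp f 2 volume)
    (hf : eLpNorm f 2 volume ≤ ENNReal.ofReal C) : ‖lp2 f‖ ≤ C := by
  rw [lp2, dif_pos h, Lp.norm_toLp]
  exact ENNReal.toReal_le_of_le_ofReal hC hf

theorem lp2_sub {f g : ℝ → E} (hf : MemLp f 2 volume) (hg : MemLp g 2 volume) :
    lp2 f - lp2 g = lp2 (f - g) := by
  rw [lp2, lp2, lp2, dif_pos hf, dif_pos hg, dif_pos (hf.sub hg)]; rfl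

theorem lp2_coe (h : Lp E 2 (volume : Measure ℝ)) : lp2 (h : ℝ → E) = h := by
  rw [lp2, dif_pos (Lp.memLp h)]; exact Lp.toLp_coeFn h _

variable {T : Type*} [TopologicalSpace T]

theorem ContinuousOn.proj_unit {u : T → ℝ → E}
    (hu : ContinuousOn (Function.uncurry u) (univ ×ˢ Icc 0 1)) :
    Continuous fun x : T × I => u x.1 x.2 :=
  hu.comp_continuous (f := fun x : T × I => (x.1, (x.2 : ℝ)))
    (by fun_prop) fun x => ⟨mem_univ _, x.2.2⟩

theorem continuousOn_section {G : Type*} [TopologicalSpace G] {u : T → ℝ → G} (x : T)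
    (hu : ContinuousOn (Function.uncurry u) (univ ×ˢ Icc 0 1)) : ContinuousOn (u x) (Icc 0 1) :=
  hu.comp (f := fun t => (x, t)) (by fun_prop) fun _ ht => ⟨mem_univ _, ht⟩

theorem eventually_forall_Icc {u : T → ℝ → ℝ}
    (hu : ContinuousOn (Function.uncurry u) (univ ×ˢ Icc 0 1)) {x₀ : T} {B : ℝ}
    (h : ∀ t ∈ Icc (0 : ℝ) 1, u x₀ t < B) : ∀ᶠ x in 𝓝 x₀, ∀ t ∈ Icc (0 : ℝ) 1, u x t < B := by
  have := isCompact_univ.eventually_forall_of_forall_eventually (K := (univ : Set I))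
    (x₀ := x₀) (P := fun x t => u x t < B) (fun t _ =>
      ((ContinuousOn.proj_unit hu).tendsto (x₀, t)).eventually (gt_mem_nhds (h t t.2)))
  filter_upwards [this] with x hx t ht using hx ⟨t, ht⟩ (mem_univ _)

theorem memLp_indicator_of_continuousOn {u : ℝ → E} (hu : ContinuousOn u (Icc 0 1)) {a b : ℝ}
    (ha : 0 ≤ a) (hb : b ≤ 1) : MemLp (indicator (Ioc a b) u) 2 volume := by
  have hsub : Ioc a b ⊆ Icc 0 1 := fun t ht => ⟨ha.trans ht.1.le, ht.2.trans hb⟩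
  obtain ⟨C, hC⟩ := isCompact_Icc.exists_bound_of_continuousOn hu
  rw [memLp_indicator_iff_restrict measurableSet_Ioc]
  refine MemLp.of_bound ((hu.mono hsub).aestronglyMeasurable measurableSet_Ioc) C ?_
  filter_upwards [ae_restrict_mem measurableSet_Ioc] with t ht using hC t (hsub ht)

theorem eLpNorm_indicator_le_of_bound {u : ℝ → E} {C : ℝ} {S : Set ℝ}
    (hu : ∀ t, u t ≠ 0 → t ∈ S) (hC : ∀ t, ‖u t‖ ≤ C) :
    eLpNorm u 2 volume ≤ ENNReal.ofReal C * volume S ^ (1 / 2 : ℝ) := by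
  have hC0 : 0 ≤ C := (norm_nonneg _).trans (hC 0)
  calc eLpNorm u 2 volume ≤ eLpNorm (indicator S fun _ => C) 2 volume := by
        refine eLpNorm_mono fun t => ?_
        by_cases ht : t ∈ S
        · rw [indicator_of_mem ht]; exact (hC t).trans (le_abs_self _)
        · have : u t = 0 := by_contra fun h => ht (hu t h)
          simp [this]
    _ ≤ _ := by
        refine (eLpNorm_indicator_const_le C 2).trans (le_of_eq ?_)
        rw [← ofReal_norm, Real.norm_of_nonneg hC0]; norm_num

/-- Two things move: the function, uniformly on `[0,1]` by compactness, and the endpoints. They are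
treated separately through `continuous_of_equibounded`, with `C(I, E)` as the space of functions. -/
theorem continuous_lp2_indicator {a b : T → ℝ} (ha : Continuous a) (hb : Continuous b)
    (ha0 : ∀ x, 0 ≤ a x) (hb1 : ∀ x, b x ≤ 1) {u : T → ℝ → E}
    (hu : ContinuousOn (Function.uncurry u) (univ ×ˢ Icc 0 1)) :
    Continuous fun x => lp2 (indicator (Ioc (a x) (b x)) (u x)) := by
  let U : T → C(I, E) := fun x => ⟨fun t => u x t,
    (ContinuousOn.proj_unit hu).comp (Continuous.prodMk_right x)⟩
  have hU : Continuous U :=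
    ContinuousMap.continuous_of_continuous_uncurry _ (ContinuousOn.proj_unit hu)
  let A : T → C(I, E) → Lp E 2 (volume : Measure ℝ) := fun x k =>
    lp2 (indicator (Ioc (a x) (b x)) (fun t => k (projIcc 0 1 zero_le_one t)))
  have hcont : ∀ k : C(I, E), Continuous (fun t : ℝ => k (projIcc 0 1 zero_le_one t)) :=
    fun k => k.continuous.comp continuous_projIcc
  have hmem : ∀ x (k : C(I, E)), MemLp (indicator (Ioc (a x) (b x))
      (fun t => k (projIcc 0 1 zero_le_one t))) 2 volume := fun x k =>
    memLp_indicator_of_continuousOn (hcont k).continuousOn (ha0 x) (hb1 x)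
  have key : Continuous fun x => A x (U x) := by
    refine continuous_of_equibounded (D := univ) (fun x₀ => ⟨1, Eventually.of_forall
      fun x v w => ?_⟩) dense_univ (fun k _ => ?_) hU
    · rw [one_mul, lp2_sub (hmem x v) (hmem x w), ← indicator_sub']
      refine norm_lp2_le (norm_nonneg _) (by rw [indicator_sub']; exact (hmem x v).sub (hmem x w)) ?_
      refine (eLpNorm_indicator_le_of_bound (C := ‖v - w‖) (S := Ioc 0 1)
        (fun t ht => ?_) fun t => ?_).trans ?_
      · have := mem_of_indicator_ne_zero ht
        exact ⟨(ha0 x).trans_lt this.1, this.2.trans (hb1 x)⟩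
      · refine (norm_indicator_le_norm_self _ _).trans ?_
        exact (v - w).norm_coe_le_norm _
      · simp
    · rw [continuous_iff_continuousAt]
      intro x₀
      rw [ContinuousAt, tendsto_iff_norm_sub_tendsto_zero]
      have hlim : Tendsto (fun x => ‖k‖ * (|a x - a x₀| + |b x - b x₀|) ^ (1 / 2 : ℝ))
          (𝓝 x₀) (𝓝 0) := by
        have : Continuous fun x => ‖k‖ * (|a x - a x₀| + |b x - b x₀|) ^ (1 / 2 : ℝ) :=
          continuous_const.mul (Continuous.rpow_const (by fun_prop) fun _ => Or.inr (by norm_num))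
        simpa using this.tendsto x₀
      refine squeeze_zero (fun _ => norm_nonneg _) (fun x => ?_) hlim
      rw [lp2_sub (hmem x k) (hmem x₀ k)]
      refine norm_lp2_le (by positivity) ((hmem x k).sub (hmem x₀ k)) ?_
      -- The two indicators differ only between old and new endpoints, on a set of measure at most
      -- the sum of the two displacements.
      refine (eLpNorm_indicator_le_of_bound (C := ‖k‖)
        (S := uIoc (a x₀) (a x) ∪ uIoc (b x₀) (b x)) (fun t ht => ?_) fun t => ?_).trans ?_
      · simp only [Pi.sub_apply, indicator, mem_Ioc] at ht
        simp only [mem_union, mem_uIoc]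
        by_contra hn
        push Not at hn
        obtain ⟨⟨h1, h2⟩, h3, h4⟩ := hn
        apply ht
        have e : (a x < t ∧ t ≤ b x) ↔ (a x₀ < t ∧ t ≤ b x₀) := by
          constructor
          · rintro ⟨p, q⟩
            exact ⟨by by_contra! h; exact absurd (h2 p) (not_lt.2 h),
              by by_contra! h; exact absurd (h3 h) (not_lt.2 q)⟩
          · rintro ⟨p, q⟩
            exact ⟨by by_contra! h; exact absurd (h1 p) (not_lt.2 h),
              by by_contra! h; exact absurd (h4 h) (not_lt.2 q)⟩
        simp [e]
      · simp only [Pi.sub_apply]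
        have hk := k.norm_coe_le_norm (projIcc 0 1 zero_le_one t)
        by_cases p : t ∈ Ioc (a x) (b x) <;> by_cases q : t ∈ Ioc (a x₀) (b x₀) <;>
          simp [p, q, hk]
      · rw [ENNReal.ofReal_mul (norm_nonneg _), ← ENNReal.ofReal_rpow_of_nonneg (by positivity)
          (by norm_num)]
        gcongr
        refine (measure_union_le _ _).trans ?_
        rw [ENNReal.ofReal_add (abs_nonneg _) (abs_nonneg _), uIoc, uIoc, Real.volume_Ioc,
          Real.volume_Ioc, max_sub_min_eq_abs, max_sub_min_eq_abs]
  refine key.congr fun x => ?_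
  refine lp2_congr (Eventually.of_forall fun t => ?_)
  by_cases ht : t ∈ Ioc (a x) (b x)
  · have : t ∈ Icc (0 : ℝ) 1 := ⟨(ha0 x).trans ht.1.le, ht.2.trans (hb1 x)⟩
    simp [indicator_of_mem ht, U, projIcc_of_mem _ this]
  · simp [indicator_of_notMem ht]

end Lp2

/-- A function with derivative at least `m` on `[0,1]` does not push the measure of `[0,1]` to
more than `1 / m` times the measure of the line. -/
theorem map_restrict_le {ψ ψ1 : ℝ → ℝ} {m : ℝ} (hm : 0 < m) (hψ : Continuous ψ)
    (hd : ∀ t ∈ Icc (0 : ℝ) 1, HasDerivWithinAt ψ (ψ1 t) (Icc 0 1) t)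
    (h1 : ∀ t ∈ Icc (0 : ℝ) 1, m ≤ ψ1 t) :
    (volume.restrict (Icc (0 : ℝ) 1)).map ψ ≤ ENNReal.ofReal m⁻¹ • (volume : Measure ℝ) := by
  have hmono : StrictMonoOn ψ (Icc 0 1) := by
    refine strictMonoOn_of_deriv_pos (convex_Icc 0 1) hψ.continuousOn fun t ht => ?_
    rw [interior_Icc] at ht
    rw [((hd t (Ioo_subset_Icc_self ht)).hasDerivAt (Icc_mem_nhds ht.1 ht.2)).deriv]
    exact hm.trans_le (h1 t (Ioo_subset_Icc_self ht))
  rw [Measure.le_iff]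
  intro S hS
  rw [Measure.map_apply hψ.measurable hS, Measure.restrict_apply (hψ.measurable hS),
    Measure.smul_apply, smul_eq_mul]
  set R := ψ ⁻¹' S ∩ Icc (0 : ℝ) 1 with hR
  have hRm : MeasurableSet R := (hψ.measurable hS).inter measurableSet_Icc
  -- Change of variables on `R`, where `ψ` is injective.
  have h2 := lintegral_image_eq_lintegral_abs_deriv_mul hRm
    (fun t ht => (hd t ht.2).mono inter_subset_right) (hmono.injOn.mono inter_subset_right)
    (fun _ => 1)
  simp only [lintegral_const, one_mul, mul_one, Measure.restrict_apply MeasurableSet.univ,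
    univ_inter] at h2
  have h3 : ENNReal.ofReal m * volume R ≤ volume S := by
    calc ENNReal.ofReal m * volume R = ∫⁻ _ in R, ENNReal.ofReal m := by simp
      _ ≤ ∫⁻ t in R, ENNReal.ofReal |ψ1 t| :=
          setLIntegral_mono' hRm fun t ht =>
            ENNReal.ofReal_le_ofReal ((h1 t ht.2).trans (le_abs_self _))
      _ = volume (ψ '' R) := h2.symm
      _ ≤ volume S := measure_mono (by rintro _ ⟨t, ht, rfl⟩; exact ht.1)
  rw [ENNReal.ofReal_inv_of_pos hm]
  calc volume R = (ENNReal.ofReal m)⁻¹ * (ENNReal.ofReal m * volume R) := by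
        rw [← mul_assoc, ENNReal.inv_mul_cancel (by simpa using hm) (by simp), one_mul]
    _ ≤ _ := by gcongr

/-- The push-forward of the measure on `[0,1]` is absolutely continuous, so preimages of null sets
are null. -/
theorem ae_comp_of_deriv_pos {ψ ψ1 : ℝ → ℝ} {m : ℝ} (hm : 0 < m) (hψ : Continuous ψ)
    (hd : ∀ t ∈ Icc (0 : ℝ) 1, HasDerivWithinAt ψ (ψ1 t) (Icc 0 1) t)
    (h1 : ∀ t ∈ Icc (0 : ℝ) 1, m ≤ ψ1 t) {P : ℝ → Prop} (hP : ∀ᵐ s, P s) :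
    ∀ᵐ t, t ∈ Icc (0 : ℝ) 1 → P (ψ t) := by
  rw [← ae_restrict_iff' measurableSet_Icc]
  refine ae_of_ae_map hψ.aemeasurable ?_
  exact (Measure.absolutelyContinuous_of_le_smul (map_restrict_le hm hψ hd h1)).ae_le hP

/-! ### The operators `h ↦ A · (h ∘ ψ)` on `L²` -/

section Op

variable {E F : Type*} [NormedAddCommGroup E] [NormedSpace ℝ E] [NormedAddCommGroup F]
  [NormedSpace ℝ F]

/-- Composition with `ψ`, multiplication by `A` and restriction to `(a,b]`. -/
def opFun (a b : ℝ) (A : ℝ → E →L[ℝ] F) (ψ : ℝ → ℝ) (h : ℝ → E) : ℝ → F :=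
  indicator (Ioc a b) fun t => A t (h (ψ t))

/-- The change of variables costs the factor `m⁻¹ ^ (1/2)`. The bound involves only `C` and `m`,
which can be chosen locally uniformly in a continuous family; this gives the equiboundedness below.
-/
theorem opFun_bound {a b : ℝ} (ha : 0 ≤ a) (hb : b ≤ 1) {A : ℝ → E →L[ℝ] F} {C : ℝ}
    (hA : ContinuousOn A (Icc 0 1)) (hC : ∀ t ∈ Icc (0 : ℝ) 1, ‖A t‖ ≤ C) {ψ ψ1 : ℝ → ℝ} {m : ℝ}
    (hm : 0 < m) (hψ : Continuous ψ)
    (hd : ∀ t ∈ Icc (0 : ℝ) 1, HasDerivWithinAt ψ (ψ1 t) (Icc 0 1) t)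
    (h1 : ∀ t ∈ Icc (0 : ℝ) 1, m ≤ ψ1 t) (h : Lp E 2 (volume : Measure ℝ)) :
    MemLp (opFun a b A ψ h) 2 volume ∧
      eLpNorm (opFun a b A ψ h) 2 volume ≤ ENNReal.ofReal (C * m⁻¹ ^ (1 / 2 : ℝ) * ‖h‖) := by
  have hC0 : 0 ≤ C := (norm_nonneg _).trans (hC 0 (by simp))
  have hsub : Ioc a b ⊆ Icc 0 1 := fun t ht => ⟨ha.trans ht.1.le, ht.2.trans hb⟩
  have hcomp : StronglyMeasurable fun t => h (ψ t) :=
    (Lp.stronglyMeasurable h).comp_measurable hψ.measurable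
  have hmeas : AEStronglyMeasurable (opFun a b A ψ h) volume := by
    rw [opFun, aestronglyMeasurable_indicator_iff measurableSet_Ioc]
    exact isBoundedBilinearMap_apply.continuous.comp_aestronglyMeasurable
      (((hA.mono hsub).aestronglyMeasurable measurableSet_Ioc).prodMk
        hcomp.aestronglyMeasurable)
  have hle : eLpNorm (opFun a b A ψ h) 2 volume ≤
      ENNReal.ofReal (C * m⁻¹ ^ (1 / 2 : ℝ) * ‖h‖) := by
    calc eLpNorm (opFun a b A ψ h) 2 volume
        ≤ ENNReal.ofReal C * eLpNorm (indicator (Icc 0 1) fun t => h (ψ t)) 2 volume := by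
          refine eLpNorm_le_mul_eLpNorm_of_ae_le_mul (Eventually.of_forall fun t => ?_) 2
          by_cases ht : t ∈ Ioc a b
          · rw [opFun, indicator_of_mem ht, indicator_of_mem (hsub ht)]
            exact (A t).le_of_opNorm_le (hC t (hsub ht)) _
          · rw [opFun, indicator_of_notMem ht, norm_zero]; positivity
      _ = ENNReal.ofReal C * eLpNorm h 2 ((volume.restrict (Icc (0 : ℝ) 1)).map ψ) := by
          rw [eLpNorm_indicator_eq_eLpNorm_restrict measurableSet_Icc, eLpNorm_map_measure
            (Lp.stronglyMeasurable h).aestronglyMeasurable hψ.aemeasurable]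
          rfl
      _ ≤ ENNReal.ofReal C * eLpNorm h 2 (ENNReal.ofReal m⁻¹ • (volume : Measure ℝ)) := by
          gcongr
          exact map_restrict_le hm hψ hd h1
      _ = _ := by
          rw [eLpNorm_smul_measure_of_ne_top (by norm_num), ENNReal.ofReal_mul (by positivity),
            ENNReal.ofReal_mul hC0, ← ENNReal.ofReal_rpow_of_nonneg (by positivity) (by norm_num),
            Lp.norm_def, ENNReal.ofReal_toReal (Lp.eLpNorm_ne_top h), smul_eq_mul, mul_assoc]
          norm_num
  exact ⟨⟨hmeas, hle.trans_lt ENNReal.ofReal_lt_top⟩, hle⟩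

theorem memLp_opFun {a b : ℝ} (ha : 0 ≤ a) (hb : b ≤ 1) {A : ℝ → E →L[ℝ] F}
    (hA : ContinuousOn A (Icc 0 1)) {ψ ψ1 : ℝ → ℝ} (hψ : Continuous ψ)
    (hψ1 : ContinuousOn ψ1 (Icc 0 1))
    (hd : ∀ t ∈ Icc (0 : ℝ) 1, HasDerivWithinAt ψ (ψ1 t) (Icc 0 1) t)
    (h1 : ∀ t ∈ Icc (0 : ℝ) 1, 0 < ψ1 t) (h : Lp E 2 (volume : Measure ℝ)) :
    MemLp (opFun a b A ψ h) 2 volume := by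
  obtain ⟨C, hC⟩ := isCompact_Icc.exists_bound_of_continuousOn hA
  obtain ⟨s, hs, hmin⟩ := isCompact_Icc.exists_isMinOn (nonempty_Icc.2 zero_le_one) hψ1
  exact (opFun_bound ha hb hA hC (h1 s hs) hψ hd (fun t ht => hmin ht) h).1

variable {T : Type*} [TopologicalSpace T]

/-- The analytic core of all continuity statements. The operators are locally equibounded, and on
functions with a continuous representative, which are dense in `L²`, the claim is
`continuous_lp2_indicator`. -/
theorem continuous_lp2_opFun {a b : T → ℝ} (ha : Continuous a) (hb : Continuous b)
    (ha0 : ∀ x, 0 ≤ a x) (hb1 : ∀ x, b x ≤ 1) {A : T → ℝ → E →L[ℝ] F}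
    (hA : ContinuousOn (Function.uncurry A) (univ ×ˢ Icc 0 1)) {ψ ψ1 : T → ℝ → ℝ}
    (hψ : Continuous (Function.uncurry ψ))
    (hψ1 : ContinuousOn (Function.uncurry ψ1) (univ ×ˢ Icc 0 1))
    (hd : ∀ x, ∀ t ∈ Icc (0 : ℝ) 1, HasDerivWithinAt (ψ x) (ψ1 x t) (Icc 0 1) t)
    (h1 : ∀ x, ∀ t ∈ Icc (0 : ℝ) 1, 0 < ψ1 x t)
    {h : T → Lp E 2 (volume : Measure ℝ)} (hh : Continuous h) :
    Continuous fun x => lp2 (opFun (a x) (b x) (A x) (ψ x) (h x)) := by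
  have hψx : ∀ x, Continuous (ψ x) := fun x => hψ.comp (Continuous.prodMk_right x)
  have hmem : ∀ x (v : Lp E 2 (volume : Measure ℝ)),
      MemLp (opFun (a x) (b x) (A x) (ψ x) v) 2 volume := fun x v =>
    memLp_opFun (ha0 x) (hb1 x) (continuousOn_section x hA) (hψx x) (continuousOn_section x hψ1) (hd x) (h1 x) v
  have hae : ∀ x {P : ℝ → Prop}, (∀ᵐ s, P s) → ∀ᵐ t, t ∈ Icc (0 : ℝ) 1 → P (ψ x t) := by
    intro x P hP
    obtain ⟨s, hs, hmin⟩ := isCompact_Icc.exists_isMinOn (nonempty_Icc.2 zero_le_one) (continuousOn_section x hψ1)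
    exact ae_comp_of_deriv_pos (h1 x s hs) (hψx x) (hd x) (fun t ht => hmin ht) hP
  have hsub : ∀ x, Ioc (a x) (b x) ⊆ Icc 0 1 :=
    fun x t ht => ⟨(ha0 x).trans ht.1.le, ht.2.trans (hb1 x)⟩
  refine continuous_of_equibounded
    (A := fun x (v : Lp E 2 (volume : Measure ℝ)) => lp2 (opFun (a x) (b x) (A x) (ψ x) v))
    (D := {v | ∃ k : ℝ → E, Continuous k ∧ v =ᵐ[volume] k}) (fun x₀ => ?_) ?_ ?_ hh
  · obtain ⟨C, hC⟩ := isCompact_Icc.exists_bound_of_continuousOn (continuousOn_section x₀ hA)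
    obtain ⟨s, hs, hmin⟩ := isCompact_Icc.exists_isMinOn (nonempty_Icc.2 zero_le_one)
      (continuousOn_section x₀ hψ1)
    have hm := h1 x₀ s hs
    have e1 : ∀ᶠ x in 𝓝 x₀, ∀ t ∈ Icc (0 : ℝ) 1, ‖A x t‖ < C + 1 :=
      eventually_forall_Icc (u := fun x t => ‖A x t‖) hA.norm
        fun t ht => (hC t ht).trans_lt (by linarith)
    have e2 : ∀ᶠ x in 𝓝 x₀, ∀ t ∈ Icc (0 : ℝ) 1, - ψ1 x t < - (ψ1 x₀ s / 2) :=
      eventually_forall_Icc (u := fun x t => - ψ1 x t) hψ1.neg fun t ht => by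
        have : ψ1 x₀ s ≤ ψ1 x₀ t := hmin ht
        linarith
    refine ⟨(C + 1) * (ψ1 x₀ s / 2)⁻¹ ^ (1 / 2 : ℝ), ?_⟩
    filter_upwards [e1, e2] with x hx1 hx2 v w
    have hC1 : 0 ≤ C + 1 := (norm_nonneg _).trans (hx1 0 (by simp)).le
    have hbd := opFun_bound (ha0 x) (hb1 x) (continuousOn_section x hA) (fun t ht => (hx1 t ht).le)
      (half_pos hm) (hψx x) (hd x) (fun t ht => (neg_lt_neg_iff.1 (hx2 t ht)).le) (v - w)
    rw [lp2_sub (hmem x v) (hmem x w), lp2_congr (g := opFun (a x) (b x) (A x) (ψ x)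
      (v - w : Lp E 2 (volume : Measure ℝ)))]
    · exact norm_lp2_le (by positivity) hbd.1 hbd.2
    · filter_upwards [hae x (Lp.coeFn_sub v w)] with t ht
      by_cases hI : t ∈ Ioc (a x) (b x)
      · simp only [opFun, Pi.sub_apply, indicator_of_mem hI]
        rw [ht (hsub x hI), Pi.sub_apply, map_sub]
      · simp [opFun, indicator_of_notMem hI]
  · rw [Metric.dense_iff]
    intro v r hr
    obtain ⟨k, -, hk, hkc, hkm⟩ := (Lp.memLp v).exists_hasCompactSupport_eLpNorm_sub_le
      (by norm_num) (ε := ENNReal.ofReal (r / 2)) (by simpa using hr)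
    refine ⟨lp2 k, ?_, k, hkc, lp2_ae hkm⟩
    rw [Metric.mem_ball, dist_comm, dist_eq_norm]
    have : v - lp2 k = lp2 ((v : ℝ → E) - k) := by
      conv_lhs => rw [← lp2_coe v]
      exact lp2_sub (Lp.memLp v) hkm
    rw [this]
    exact (norm_lp2_le (by positivity) ((Lp.memLp v).sub hkm) hk).trans_lt (half_lt_self hr)
  · rintro v ⟨k, hk, hvk⟩
    have : ContinuousOn (Function.uncurry fun x t => A x t (k (ψ x t))) (univ ×ˢ Icc 0 1) :=
      hA.clm_apply (hk.comp hψ).continuousOn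
    refine (continuous_lp2_indicator ha hb ha0 hb1 this).congr fun x => lp2_congr ?_
    filter_upwards [hae x hvk] with t ht
    by_cases hI : t ∈ Ioc (a x) (b x)
    · simp [opFun, indicator_of_mem hI, ht (hsub x hI)]
    · simp [opFun, indicator_of_notMem hI]

end Op

/-! ### Composition, gluing and linear images of `H²` curves -/

section Ops

variable {E : Type*} [NormedAddCommGroup E] [NormedSpace ℝ E]
variable {T : Type*} [TopologicalSpace T]

theorem Continuous.hvel {c : T → H2 E} (hc : Continuous c) {s : T → ℝ} (hs : Continuous s) :
    Continuous fun x => hvel (c x) (s x) := continuous_hvel.comp (hc.prodMk hs)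

theorem Continuous.hpos {c : T → H2 E} (hc : Continuous c) {s : T → ℝ} (hs : Continuous s) :
    Continuous fun x => hpos (c x) (s x) := continuous_hpos.comp (hc.prodMk hs)

theorem strictMonoOn_hpos {ψ : H2 ℝ} (h : ∀ t ∈ Icc (0 : ℝ) 1, 0 < hvel ψ t) :
    StrictMonoOn (hpos ψ) (Icc 0 1) := by
  refine strictMonoOn_of_deriv_pos (convex_Icc 0 1) (continuous_hpos_right ψ).continuousOn
    fun t ht => ?_
  rw [interior_Icc] at ht
  rw [(hasDerivAt_hpos ψ t).deriv]
  exact h t (Ioo_subset_Icc_self ht)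

theorem ae_comp_hpos {ψ : H2 ℝ} (h : ∀ t ∈ Icc (0 : ℝ) 1, 0 < hvel ψ t) {P : ℝ → Prop}
    (hP : ∀ᵐ s, P s) : ∀ᵐ t, t ∈ Icc (0 : ℝ) 1 → P (hpos ψ t) := by
  obtain ⟨s, hs, hmin⟩ := isCompact_Icc.exists_isMinOn (nonempty_Icc.2 zero_le_one)
    (continuous_hvel_right ψ).continuousOn
  exact ae_comp_of_deriv_pos (h s hs) (continuous_hpos_right ψ)
    (fun t _ => (hasDerivAt_hpos ψ t).hasDerivWithinAt) (fun t ht => hmin ht) hP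

theorem ae_ne (a : ℝ) : ∀ᵐ t : ℝ, t ≠ a := by simp [ae_iff]

/-- The curve `c ∘ ψ`. -/
def hcomp (c : H2 E) (ψ : H2 ℝ) : H2 E :=
  (hpos c (hpos ψ 0), hvel ψ 0 • hvel c (hpos ψ 0),
    lp2 (opFun 0 1 (fun t => (hvel ψ t) ^ 2 • ContinuousLinearMap.id ℝ E) (hpos ψ) (hacc c)) +
    lp2 (opFun 0 1 (fun t => ContinuousLinearMap.toSpanSingleton ℝ (hvel c (hpos ψ t)))
      (fun t => t) (hacc ψ)))

theorem hcomp_acc (c : H2 E) {ψ : H2 ℝ} (h : ∀ t ∈ Icc (0 : ℝ) 1, 0 < hvel ψ t) :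
    ∀ᵐ t, t ∈ Icc (0 : ℝ) 1 → hacc (hcomp c ψ) t =
      (hvel ψ t) ^ 2 • hacc c (hpos ψ t) + hacc ψ t • hvel c (hpos ψ t) := by
  have m1 : MemLp (opFun 0 1 (fun t => (hvel ψ t) ^ 2 • ContinuousLinearMap.id ℝ E)
      (hpos ψ) (hacc c)) 2 volume :=
    memLp_opFun le_rfl le_rfl (((continuous_hvel_right ψ).pow 2).smul continuous_const).continuousOn
      (continuous_hpos_right ψ) (continuous_hvel_right ψ).continuousOn
      (fun t _ => (hasDerivAt_hpos ψ t).hasDerivWithinAt) h c.2.2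
  have m2 : MemLp (opFun 0 1 (fun t => ContinuousLinearMap.toSpanSingleton ℝ
      (hvel c (hpos ψ t))) (fun t => t) (hacc ψ)) 2 volume := by
    refine memLp_opFun (ψ1 := fun _ => 1) le_rfl le_rfl ?_ continuous_id continuousOn_const
      (fun t _ => hasDerivWithinAt_id t _) (fun _ _ => one_pos) ψ.2.2
    exact ((ContinuousLinearMap.toSpanSingletonCLE (𝕜 := ℝ) (E := E)).continuous.comp
      ((continuous_hvel_right c).comp (continuous_hpos_right ψ))).continuousOn
  filter_upwards [Lp.coeFn_add (lp2 (opFun 0 1 (fun t => (hvel ψ t) ^ 2 •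
    ContinuousLinearMap.id ℝ E) (hpos ψ) (hacc c))) (lp2 (opFun 0 1 (fun t =>
    ContinuousLinearMap.toSpanSingleton ℝ (hvel c (hpos ψ t))) (fun t => t) (hacc ψ))),
    lp2_ae m1, lp2_ae m2, ae_ne 0] with t h1 h2 h3 h4 ht
  have hI : t ∈ Ioc (0 : ℝ) 1 := ⟨lt_of_le_of_ne ht.1 (Ne.symm h4), ht.2⟩
  change (_ + _ : Lp E 2 (volume : Measure ℝ)) t = _
  rw [h1, Pi.add_apply, h2, h3, opFun, opFun, indicator_of_mem hI, indicator_of_mem hI]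
  simp

theorem continuous_hcomp {c : T → H2 E} {ψ : T → H2 ℝ} (hc : Continuous c) (hψ : Continuous ψ)
    (h : ∀ x, ∀ t ∈ Icc (0 : ℝ) 1, 0 < hvel (ψ x) t) :
    Continuous fun x => hcomp (c x) (ψ x) := by
  have hψt : Continuous (Function.uncurry fun x t => hpos (ψ x) t) :=
    Continuous.hpos (hψ.comp continuous_fst) continuous_snd
  have hψv : Continuous (Function.uncurry fun x t => hvel (ψ x) t) :=
    Continuous.hvel (hψ.comp continuous_fst) continuous_snd
  refine (Continuous.hpos hc (Continuous.hpos hψ continuous_const)).prodMk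
    (((Continuous.hvel hψ continuous_const).smul
      (Continuous.hvel hc (Continuous.hpos hψ continuous_const))).prodMk (Continuous.add ?_ ?_))
  · exact continuous_lp2_opFun (a := fun _ => 0) (b := fun _ => 1) continuous_const
      continuous_const (fun _ => le_rfl) (fun _ => le_rfl)
      ((hψv.pow 2).smul continuous_const).continuousOn hψt hψv.continuousOn
      (fun x t _ => (hasDerivAt_hpos (ψ x) t).hasDerivWithinAt) h hc.snd.snd
  · refine continuous_lp2_opFun (a := fun _ => 0) (b := fun _ => 1) (ψ := fun _ t => t)
      (ψ1 := fun _ _ => 1) continuous_const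
      continuous_const (fun _ => le_rfl) (fun _ => le_rfl) ?_ continuous_snd continuousOn_const
      (fun x t _ => hasDerivWithinAt_id t _) (fun _ _ _ => one_pos) hψ.snd.snd
    exact ((ContinuousLinearMap.toSpanSingletonCLE (𝕜 := ℝ) (E := E)).continuous.comp
      (Continuous.hvel (hc.comp continuous_fst) hψt)).continuousOn

theorem hcomp_spec [CompleteSpace E] (c : H2 E) {ψ : H2 ℝ}
    (h : ∀ t ∈ Icc (0 : ℝ) 1, 0 < hvel ψ t) :
    (∀ t ∈ Icc (0 : ℝ) 1, hvel (hcomp c ψ) t = hvel ψ t • hvel c (hpos ψ t)) ∧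
      ∀ t ∈ Icc (0 : ℝ) 1, hpos (hcomp c ψ) t = hpos c (hpos ψ t) := by
  refine hvel_hpos_mk (p := fun t => hpos c (hpos ψ t))
    (v := fun t => hvel ψ t • hvel c (hpos ψ t)) (h := (hcomp c ψ).2.2) (fun t _ => ?_) ?_ ?_ rfl
  · have := HasDerivAt.scomp t (hasDerivAt_hpos c (hpos ψ t)) (hasDerivAt_hpos ψ t)
    exact this.hasDerivWithinAt
  · have h1 : AbsolutelyContinuousOnInterval (hvel c ∘ hpos ψ) 0 1 :=
      ac_comp (ac_hvel c (hpos ψ 0) (hpos ψ 1)) zero_le_one (ac_hpos ψ 0 1) (strictMonoOn_hpos h)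
    have h2 : AbsolutelyContinuousOnInterval (hvel ψ • (hvel c ∘ hpos ψ)) 0 1 :=
      AbsolutelyContinuousOnInterval.smul (ac_hvel ψ 0 1) h1
    exact h2
  · filter_upwards [hcomp_acc c h, ae_comp_hpos h (ae_hasDerivAt_hvel c), ae_hasDerivAt_hvel ψ]
      with t h1 h2 h3 ht
    have h4 := HasDerivAt.scomp t (h2 ht) (hasDerivAt_hpos ψ t)
    have h5 := HasDerivAt.smul h3 h4
    change HasDerivAt _ (hacc (hcomp c ψ) t) t
    rw [h1 ht, sq, ← smul_smul]
    exact h5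

/-- The curve that runs through `c₁` up to the time `l` and through `c₂` from then on. -/
def hglue (l : ℝ) (c₁ c₂ : H2 E) : H2 E :=
  (c₁.1, c₁.2.1, lp2 (opFun 0 l (fun _ => ContinuousLinearMap.id ℝ E) (fun t => t) (hacc c₁)) +
    lp2 (opFun l 1 (fun _ => ContinuousLinearMap.id ℝ E) (fun t => t) (hacc c₂)))

theorem hglue_acc {l : ℝ} (h0 : 0 ≤ l) (h1 : l ≤ 1) (c₁ c₂ : H2 E) :
    ∀ᵐ t, t ∈ Icc (0 : ℝ) 1 → hacc (hglue l c₁ c₂) t = if t ≤ l then hacc c₁ t else hacc c₂ t := by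
  have mem : ∀ {a b : ℝ} (_ : 0 ≤ a) (_ : b ≤ 1) (c : H2 E), MemLp (opFun a b
      (fun _ => ContinuousLinearMap.id ℝ E) (fun t => t) (hacc c)) 2 volume := fun ha hb c =>
    memLp_opFun (ψ1 := fun _ => 1) ha hb continuousOn_const continuous_id continuousOn_const
      (fun t _ => hasDerivWithinAt_id t _) (fun _ _ => one_pos) c.2.2
  filter_upwards [Lp.coeFn_add (lp2 (opFun 0 l (fun _ => ContinuousLinearMap.id ℝ E)
    (fun t => t) (hacc c₁))) (lp2 (opFun l 1 (fun _ => ContinuousLinearMap.id ℝ E)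
    (fun t => t) (hacc c₂))), lp2_ae (mem le_rfl h1 c₁), lp2_ae (mem h0 le_rfl c₂), ae_ne 0]
    with t e1 e2 e3 e4 ht
  change (_ + _ : Lp E 2 (volume : Measure ℝ)) t = _
  rw [e1, Pi.add_apply, e2, e3, opFun, opFun]
  have ht0 : 0 < t := lt_of_le_of_ne ht.1 (Ne.symm e4)
  by_cases hl : t ≤ l
  · rw [if_pos hl, indicator_of_mem (show t ∈ Ioc 0 l from ⟨ht0, hl⟩),
      indicator_of_notMem fun h => h.1.not_ge hl]
    simp
  · rw [if_neg hl, indicator_of_notMem fun h => hl h.2,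
      indicator_of_mem (show t ∈ Ioc l 1 from ⟨not_le.1 hl, ht.2⟩)]
    simp

theorem continuous_hglue {l : T → ℝ} (hl : Continuous l) (h0 : ∀ x, 0 ≤ l x) (h1 : ∀ x, l x ≤ 1)
    {c₁ c₂ : T → H2 E} (hc₁ : Continuous c₁) (hc₂ : Continuous c₂) :
    Continuous fun x => hglue (l x) (c₁ x) (c₂ x) := by
  refine hc₁.fst.prodMk (hc₁.snd.fst.prodMk (Continuous.add ?_ ?_))
  · exact continuous_lp2_opFun (a := fun _ => 0) (b := l) (ψ := fun _ t => t)
      (ψ1 := fun _ _ => 1) continuous_const hl (fun _ => le_rfl) h1 continuousOn_const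
      continuous_snd continuousOn_const (fun x t _ => hasDerivWithinAt_id t _)
      (fun _ _ _ => one_pos) hc₁.snd.snd
  · exact continuous_lp2_opFun (a := l) (b := fun _ => 1) (ψ := fun _ t => t)
      (ψ1 := fun _ _ => 1) hl continuous_const h0 (fun _ => le_rfl) continuousOn_const
      continuous_snd continuousOn_const (fun x t _ => hasDerivWithinAt_id t _)
      (fun _ _ _ => one_pos) hc₂.snd.snd

theorem hvel_add_integral (c : H2 E) (s t : ℝ) :
    hvel c t = hvel c s + ∫ r in s..t, hacc c r := by
  unfold hvel
  rw [add_assoc, intervalIntegral.integral_add_adjacent_intervals] <;>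
    exact intervalIntegrable_lp c.2.2 _ _

theorem hpos_add_integral (c : H2 E) (s t : ℝ) :
    hpos c t = hpos c s + ∫ r in s..t, hvel c r := by
  unfold hpos
  rw [add_assoc, intervalIntegral.integral_add_adjacent_intervals] <;>
    exact (continuous_hvel_right c).intervalIntegrable _ _

/-- Only positions and velocities have to agree at `l`: a jump of the second derivative is harmless
in `H²`. -/
theorem hglue_spec {l : ℝ} (h0 : 0 ≤ l) (h1 : l ≤ 1) {c₁ c₂ : H2 E}
    (hp : hpos c₁ l = hpos c₂ l) (hv : hvel c₁ l = hvel c₂ l) :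
    (∀ t ∈ Icc (0 : ℝ) 1, hvel (hglue l c₁ c₂) t = if t ≤ l then hvel c₁ t else hvel c₂ t) ∧
    ∀ t ∈ Icc (0 : ℝ) 1, hpos (hglue l c₁ c₂) t = if t ≤ l then hpos c₁ t else hpos c₂ t := by
  have hacc := hglue_acc h0 h1 c₁ c₂
  have v1 : ∀ t ∈ Icc (0 : ℝ) l, hvel (hglue l c₁ c₂) t = hvel c₁ t := by
    intro t ht
    rw [hvel_add_integral _ 0 t, hvel_add_integral c₁ 0 t]
    congr 1
    · simp [hvel, hglue]
    · refine intervalIntegral.integral_congr_ae ?_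
      filter_upwards [hacc] with s hs hst
      rw [uIoc_of_le ht.1] at hst
      rw [hs ⟨hst.1.le, hst.2.trans (ht.2.trans h1)⟩, if_pos (hst.2.trans ht.2)]
  have v2 : ∀ t ∈ Icc l (1 : ℝ), hvel (hglue l c₁ c₂) t = hvel c₂ t := by
    intro t ht
    rw [hvel_add_integral _ l t, hvel_add_integral c₂ l t, v1 l ⟨h0, le_rfl⟩, hv]
    congr 1
    refine intervalIntegral.integral_congr_ae ?_
    filter_upwards [hacc] with s hs hst
    rw [uIoc_of_le ht.1] at hst
    rw [hs ⟨h0.trans hst.1.le, hst.2.trans ht.2⟩, if_neg (not_le.2 hst.1)]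
  have p1 : ∀ t ∈ Icc (0 : ℝ) l, hpos (hglue l c₁ c₂) t = hpos c₁ t := by
    intro t ht
    rw [hpos_add_integral _ 0 t, hpos_add_integral c₁ 0 t]
    congr 1
    · simp [hpos, hglue]
    · refine intervalIntegral.integral_congr fun s hs => ?_
      rw [uIcc_of_le ht.1] at hs
      exact v1 s ⟨hs.1, hs.2.trans ht.2⟩
  have p2 : ∀ t ∈ Icc l (1 : ℝ), hpos (hglue l c₁ c₂) t = hpos c₂ t := by
    intro t ht
    rw [hpos_add_integral _ l t, hpos_add_integral c₂ l t, p1 l ⟨h0, le_rfl⟩, hp]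
    congr 1
    refine intervalIntegral.integral_congr fun s hs => ?_
    rw [uIcc_of_le ht.1] at hs
    exact v2 s ⟨hs.1, hs.2.trans ht.2⟩
  constructor
  · intro t ht
    split_ifs with h
    · exact v1 t ⟨ht.1, h⟩
    · exact v2 t ⟨(not_le.1 h).le, ht.2⟩
  · intro t ht
    split_ifs with h
    · exact p1 t ⟨ht.1, h⟩
    · exact p2 t ⟨(not_le.1 h).le, ht.2⟩

/-- The curve `t ↦ q + m t` on the line. -/
def haff (q m : ℝ) : H2 ℝ := (q, m, 0)

theorem haff_acc (q m : ℝ) : ∀ᵐ t, hacc (haff q m) t = 0 := by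
  filter_upwards [Lp.coeFn_zero ℝ 2 (volume : Measure ℝ)] with t ht using ht

theorem haff_vel (q m t : ℝ) : hvel (haff q m) t = m := by
  rw [hvel, intervalIntegral.integral_congr_ae (g := fun _ => (0 : ℝ))]
  · simp [haff]
  · filter_upwards [haff_acc q m] with s hs _ using hs

theorem haff_pos (q m t : ℝ) : hpos (haff q m) t = q + m * t := by
  rw [hpos, funext (haff_vel q m)]
  simp [haff, mul_comm]

theorem continuous_haff {q m : T → ℝ} (hq : Continuous q) (hm : Continuous m) :
    Continuous fun x => haff (q x) (m x) := hq.prodMk (hm.prodMk continuous_const)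

/-- The curve with position `u`, velocity `u1` and acceleration `u2`. -/
def hsmooth (u u1 u2 : ℝ → E) : H2 E := (u 0, u1 0, lp2 (indicator (Ioc 0 1) u2))

theorem hsmooth_acc {u u1 u2 : ℝ → E} (h2 : ContinuousOn u2 (Icc 0 1)) :
    ∀ᵐ t, t ∈ Icc (0 : ℝ) 1 → hacc (hsmooth u u1 u2) t = u2 t := by
  filter_upwards [lp2_ae (memLp_indicator_of_continuousOn h2 le_rfl le_rfl), ae_ne 0]
    with t h1 h3 ht
  change lp2 (indicator (Ioc 0 1) u2) t = _
  rw [h1, indicator_of_mem (show t ∈ Ioc (0 : ℝ) 1 from ⟨lt_of_le_of_ne ht.1 (Ne.symm h3), ht.2⟩)]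

theorem hsmooth_spec [CompleteSpace E] {u u1 u2 : ℝ → E}
    (hu : ∀ t ∈ Icc (0 : ℝ) 1, HasDerivWithinAt u (u1 t) (Icc 0 1) t)
    (hu1 : ∀ t ∈ Icc (0 : ℝ) 1, HasDerivWithinAt u1 (u2 t) (Icc 0 1) t)
    (h2 : ContinuousOn u2 (Icc 0 1)) :
    (∀ t ∈ Icc (0 : ℝ) 1, hvel (hsmooth u u1 u2) t = u1 t) ∧
      ∀ t ∈ Icc (0 : ℝ) 1, hpos (hsmooth u u1 u2) t = u t := by
  refine hvel_hpos_mk (h := (hsmooth u u1 u2).2.2) hu ?_ ?_ rfl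
  · obtain ⟨C, hC⟩ := isCompact_Icc.exists_bound_of_continuousOn h2
    refine LipschitzOnWith.absolutelyContinuousOnInterval (K := C.toNNReal) ?_
    rw [uIcc_of_le zero_le_one]
    refine (convex_Icc (0 : ℝ) 1).lipschitzOnWith_of_nnnorm_hasDerivWithin_le hu1 fun t ht => ?_
    rw [← NNReal.coe_le_coe, coe_nnnorm]
    exact (hC t ht).trans (Real.le_coe_toNNReal C)
  · filter_upwards [hsmooth_acc (u := u) (u1 := u1) h2, ae_ne 0, ae_ne 1] with t h1 h3 h4 ht
    change HasDerivAt _ (hacc (hsmooth u u1 u2) t) t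
    rw [h1 ht]
    exact (hu1 t ht).hasDerivAt (Icc_mem_nhds (lt_of_le_of_ne ht.1 (Ne.symm h3))
      (lt_of_le_of_ne ht.2 h4))

theorem continuous_hsmooth {u u1 u2 : T → ℝ → E} (hu : Continuous fun x => u x 0)
    (hu1 : Continuous fun x => u1 x 0)
    (h2 : ContinuousOn (Function.uncurry u2) (univ ×ˢ Icc 0 1)) :
    Continuous fun x => hsmooth (u x) (u1 x) (u2 x) :=
  hu.prodMk (hu1.prodMk (continuous_lp2_indicator (a := fun _ => 0) (b := fun _ => 1)
    continuous_const continuous_const (fun _ => le_rfl) (fun _ => le_rfl) h2))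

/-- The image of a curve under a linear map. -/
def hmap (P : E →L[ℝ] E) (c : H2 E) : H2 E :=
  (P (hpos c 0), P (hvel c 0), lp2 (opFun 0 1 (fun _ => P) (fun t => t) (hacc c)))

theorem hmap_acc (P : E →L[ℝ] E) (c : H2 E) :
    ∀ᵐ t, t ∈ Icc (0 : ℝ) 1 → hacc (hmap P c) t = P (hacc c t) := by
  have m : MemLp (opFun 0 1 (fun _ => P) (fun t => t) (hacc c)) 2 volume :=
    memLp_opFun (ψ1 := fun _ => 1) le_rfl le_rfl continuousOn_const continuous_id
      continuousOn_const (fun t _ => hasDerivWithinAt_id t _) (fun _ _ => one_pos) c.2.2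
  filter_upwards [lp2_ae m, ae_ne 0] with t h1 h2 ht
  change lp2 _ t = _
  rw [h1, opFun, indicator_of_mem (show t ∈ Ioc (0 : ℝ) 1 from
    ⟨lt_of_le_of_ne ht.1 (Ne.symm h2), ht.2⟩)]

theorem continuous_hmap {P : T → E →L[ℝ] E} (hP : Continuous P) {c : T → H2 E}
    (hc : Continuous c) : Continuous fun x => hmap (P x) (c x) := by
  refine (hP.clm_apply (Continuous.hpos hc continuous_const)).prodMk
    ((hP.clm_apply (Continuous.hvel hc continuous_const)).prodMk ?_)
  exact continuous_lp2_opFun (a := fun _ => 0) (b := fun _ => 1) (ψ := fun _ t => t)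
    (ψ1 := fun _ _ => 1) (A := fun x _ => P x) continuous_const continuous_const
    (fun _ => le_rfl) (fun _ => le_rfl) (hP.comp continuous_fst).continuousOn continuous_snd
    continuousOn_const (fun x t _ => hasDerivWithinAt_id t _) (fun _ _ _ => one_pos) hc.snd.snd

theorem hmap_spec [CompleteSpace E] (P : E →L[ℝ] E) (c : H2 E) :
    (∀ t ∈ Icc (0 : ℝ) 1, hvel (hmap P c) t = P (hvel c t)) ∧
      ∀ t ∈ Icc (0 : ℝ) 1, hpos (hmap P c) t = P (hpos c t) := by
  refine hvel_hpos_mk (p := fun t => P (hpos c t)) (v := fun t => P (hvel c t))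
    (h := (hmap P c).2.2) (fun t _ => ?_) ?_ ?_ rfl
  · exact (P.hasFDerivAt.comp_hasDerivAt t (hasDerivAt_hpos c t)).hasDerivWithinAt
  · refine ac_of_dist_le' (C := ‖P‖) (ac_hvel c 0 1) fun s _ t _ => ?_
    rw [dist_eq_norm, dist_eq_norm, ← map_sub]
    exact P.le_opNorm _
  · filter_upwards [hmap_acc P c, ae_hasDerivAt_hvel c] with t h1 h2 ht
    change HasDerivAt _ (hacc (hmap P c) t) t
    rw [h1 ht]
    exact P.hasFDerivAt.comp_hasDerivAt t h2

end Ops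

/-! ### Radial projection to the sphere -/

section Normalize

variable {E : Type*} [NormedAddCommGroup E] [InnerProductSpace ℝ E]
variable {T : Type*} [TopologicalSpace T]

/-- The derivative of `1 / ‖c‖`. -/
def rinv1 (p v : E) : ℝ := -(‖p‖⁻¹ ^ 3 * inner ℝ p v)

/-- The second derivative of `c / ‖c‖` is split into `normAcc`, which contains no `c''` and is
continuous in time, and `normOp c` applied to `c''`, to which `continuous_lp2_opFun` applies. -/
def normAcc (p v : E) : E :=
  (3 * ‖p‖⁻¹ ^ 5 * (inner ℝ p v) ^ 2 - ‖p‖⁻¹ ^ 3 * inner ℝ v v) • p + (2 * rinv1 p v) • v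

def normOp (p : E) : E →L[ℝ] E :=
  ‖p‖⁻¹ • ContinuousLinearMap.id ℝ E - (‖p‖⁻¹ ^ 3) • (innerSL ℝ p).smulRight p

/-- The curve `c / ‖c‖`. -/
def hnormalize (c : H2 E) : H2 E :=
  (‖hpos c 0‖⁻¹ • hpos c 0, rinv1 (hpos c 0) (hvel c 0) • hpos c 0 + ‖hpos c 0‖⁻¹ • hvel c 0,
    lp2 (indicator (Ioc 0 1) fun t => normAcc (hpos c t) (hvel c t)) +
    lp2 (opFun 0 1 (fun t => normOp (hpos c t)) (fun t => t) (hacc c)))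

theorem continuousOn_normAcc {p v : T × ℝ → E} {S : Set (T × ℝ)} (hp : ContinuousOn p S)
    (hv : ContinuousOn v S) (h0 : ∀ x ∈ S, p x ≠ 0) :
    ContinuousOn (fun x => normAcc (p x) (v x)) S := by
  have hr : ContinuousOn (fun x => ‖p x‖⁻¹) S := hp.norm.inv₀ fun x hx => norm_ne_zero_iff.2 (h0 x hx)
  unfold normAcc rinv1
  have h1 := hp.inner (𝕜 := ℝ) hv
  have h2 := hv.inner (𝕜 := ℝ) hv
  fun_prop

theorem continuousOn_normOp {p : T × ℝ → E} {S : Set (T × ℝ)} (hp : ContinuousOn p S)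
    (h0 : ∀ x ∈ S, p x ≠ 0) : ContinuousOn (fun x => normOp (p x)) S := by
  have hr : ContinuousOn (fun x => ‖p x‖⁻¹) S := hp.norm.inv₀ fun x hx => norm_ne_zero_iff.2 (h0 x hx)
  unfold normOp
  refine (hr.smul continuousOn_const).sub ((hr.pow 3).smul ?_)
  have h3 : Continuous fun y : E => (innerSL ℝ y).smulRight y :=
    (ContinuousLinearMap.smulRightL ℝ E E).continuous₂.comp
      ((innerSL ℝ).continuous.prodMk continuous_id)
  exact h3.comp_continuousOn hp

theorem continuous_hnormalize {c : T → H2 E} (hc : Continuous c)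
    (h0 : ∀ x, ∀ t ∈ Icc (0 : ℝ) 1, hpos (c x) t ≠ 0) : Continuous fun x => hnormalize (c x) := by
  have hp0 : Continuous fun x => hpos (c x) 0 := Continuous.hpos hc continuous_const
  have hv0 : Continuous fun x => hvel (c x) 0 := Continuous.hvel hc continuous_const
  have hr0 : Continuous fun x => ‖hpos (c x) 0‖⁻¹ :=
    hp0.norm.inv₀ fun x => norm_ne_zero_iff.2 (h0 x 0 (by simp))
  have hp : Continuous (Function.uncurry fun x t => hpos (c x) t) :=
    Continuous.hpos (hc.comp continuous_fst) continuous_snd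
  have hv : Continuous (Function.uncurry fun x t => hvel (c x) t) :=
    Continuous.hvel (hc.comp continuous_fst) continuous_snd
  have h0' : ∀ y ∈ (univ : Set T) ×ˢ Icc (0 : ℝ) 1, Function.uncurry (fun x t => hpos (c x) t) y ≠ 0 :=
    fun y hy => h0 y.1 y.2 hy.2
  refine (hr0.smul hp0).prodMk (Continuous.prodMk ?_ (Continuous.add ?_ ?_))
  · unfold rinv1
    exact ((((hr0.pow 3).mul (hp0.inner hv0)).neg).smul hp0).add (hr0.smul hv0)
  · exact continuous_lp2_indicator (a := fun _ => 0) (b := fun _ => 1)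
      (u := fun x t => normAcc (hpos (c x) t) (hvel (c x) t)) continuous_const
      continuous_const (fun _ => le_rfl) (fun _ => le_rfl)
      (continuousOn_normAcc hp.continuousOn hv.continuousOn h0')
  · exact continuous_lp2_opFun (a := fun _ => 0) (b := fun _ => 1) (ψ := fun _ t => t)
      (ψ1 := fun _ _ => 1) (A := fun x t => normOp (hpos (c x) t)) continuous_const
      continuous_const (fun _ => le_rfl) (fun _ => le_rfl)
      (continuousOn_normOp hp.continuousOn h0') continuous_snd continuousOn_const
      (fun x t _ => hasDerivWithinAt_id t _) (fun _ _ _ => one_pos) hc.snd.snd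

theorem hnormalize_acc {c : H2 E} (h0 : ∀ t ∈ Icc (0 : ℝ) 1, hpos c t ≠ 0) :
    ∀ᵐ t, t ∈ Icc (0 : ℝ) 1 → hacc (hnormalize c) t =
      normAcc (hpos c t) (hvel c t) + normOp (hpos c t) (hacc c t) := by
  have c1 : ContinuousOn (fun t => normAcc (hpos c t) (hvel c t)) (Icc 0 1) :=
    (continuousOn_normAcc (T := Unit) (p := fun y => hpos c y.2) (v := fun y => hvel c y.2)
      (S := univ ×ˢ Icc 0 1) ((continuous_hpos_right c).comp continuous_snd).continuousOn
      ((continuous_hvel_right c).comp continuous_snd).continuousOn (fun y hy => h0 _ hy.2)).comp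
      (f := fun t => ((), t)) (by fun_prop) fun t ht => ⟨mem_univ _, ht⟩
  have c2 : ContinuousOn (fun t => normOp (hpos c t)) (Icc 0 1) :=
    (continuousOn_normOp (T := Unit) (p := fun y => hpos c y.2)
      (S := univ ×ˢ Icc 0 1) ((continuous_hpos_right c).comp continuous_snd).continuousOn
      (fun y hy => h0 _ hy.2)).comp
      (f := fun t => ((), t)) (by fun_prop) fun t ht => ⟨mem_univ _, ht⟩
  have m2 : MemLp (opFun 0 1 (fun t => normOp (hpos c t)) (fun t => t) (hacc c)) 2 volume :=
    memLp_opFun (ψ1 := fun _ => 1) le_rfl le_rfl c2 continuous_id continuousOn_const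
      (fun t _ => hasDerivWithinAt_id t _) (fun _ _ => one_pos) c.2.2
  filter_upwards [Lp.coeFn_add (lp2 (indicator (Ioc 0 1) fun t => normAcc (hpos c t) (hvel c t)))
    (lp2 (opFun 0 1 (fun t => normOp (hpos c t)) (fun t => t) (hacc c))),
    lp2_ae (memLp_indicator_of_continuousOn c1 le_rfl le_rfl), lp2_ae m2, ae_ne 0]
    with t h1 h2 h3 h4 ht
  have hI : t ∈ Ioc (0 : ℝ) 1 := ⟨lt_of_le_of_ne ht.1 (Ne.symm h4), ht.2⟩
  change (_ + _ : Lp E 2 (volume : Measure ℝ)) t = _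
  rw [h1, Pi.add_apply, h2, h3, opFun, indicator_of_mem hI, indicator_of_mem hI]

theorem hasDerivAt_norm_inv {p : ℝ → E} {v : E} {t : ℝ} (hp : HasDerivAt p v t) (h0 : p t ≠ 0) :
    HasDerivAt (fun t => ‖p t‖⁻¹) (rinv1 (p t) v) t := by
  have h1 : HasDerivAt (fun t => ‖p t‖ ^ 2) (2 * inner ℝ (p t) v) t := hp.norm_sq
  have hn : 0 < ‖p t‖ := norm_pos_iff.2 h0
  have h2 := (h1.sqrt (by positivity)).inv (by rw [Real.sqrt_sq hn.le]; exact hn.ne')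
  have h3 : ∀ s, √(‖p s‖ ^ 2) = ‖p s‖ := fun s => Real.sqrt_sq (norm_nonneg _)
  simp only [h3] at h2
  refine h2.congr_deriv ?_
  unfold rinv1
  field_simp

theorem hnormalize_spec [CompleteSpace E] {c : H2 E} (h0 : ∀ t ∈ Icc (0 : ℝ) 1, hpos c t ≠ 0) :
    (∀ t ∈ Icc (0 : ℝ) 1, hvel (hnormalize c) t =
      rinv1 (hpos c t) (hvel c t) • hpos c t + ‖hpos c t‖⁻¹ • hvel c t) ∧
      ∀ t ∈ Icc (0 : ℝ) 1, hpos (hnormalize c) t = ‖hpos c t‖⁻¹ • hpos c t := by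
  have h0' : ∀ t ∈ uIcc (0 : ℝ) 1, hpos c t ≠ 0 := by rwa [uIcc_of_le zero_le_one]
  refine hvel_hpos_mk (p := fun t => ‖hpos c t‖⁻¹ • hpos c t)
    (v := fun t => rinv1 (hpos c t) (hvel c t) • hpos c t + ‖hpos c t‖⁻¹ • hvel c t)
    (h := (hnormalize c).2.2) (fun t ht => ?_) ?_ ?_ rfl
  · have := (hasDerivAt_norm_inv (hasDerivAt_hpos c t) (h0 t ht)).smul (hasDerivAt_hpos c t)
    rw [add_comm] at this
    exact this.hasDerivWithinAt
  · have hr : AbsolutelyContinuousOnInterval (fun t => ‖hpos c t‖⁻¹) 0 1 :=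
      ac_inv (ac_norm (ac_hpos c 0 1)) fun t ht => norm_ne_zero_iff.2 (h0' t ht)
    have hi := ac_inner (ac_hpos c 0 1) (ac_hvel c 0 1)
    have h3 : AbsolutelyContinuousOnInterval (fun t => rinv1 (hpos c t) (hvel c t)) 0 1 := by
      have h4 := ((hr.mul (hr.mul hr)).mul hi).neg
      have h5 : (fun t => rinv1 (hpos c t) (hvel c t)) =
          -((fun t => ‖hpos c t‖⁻¹) * ((fun t => ‖hpos c t‖⁻¹) * fun t => ‖hpos c t‖⁻¹) *
            fun t => inner ℝ (hpos c t) (hvel c t)) := by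
        ext t
        simp only [rinv1, Pi.neg_apply, Pi.mul_apply]
        ring
      rw [h5]
      exact h4
    exact (h3.smul (ac_hpos c 0 1)).add (hr.smul (ac_hvel c 0 1))
  · filter_upwards [hnormalize_acc h0, ae_hasDerivAt_hvel c] with t h1 h2 ht
    have hp := hasDerivAt_hpos c t
    have hr := hasDerivAt_norm_inv hp (h0 t ht)
    have hi := hp.inner ℝ h2
    have h4 := ((hr.pow 3).mul hi).neg
    have h5 := HasDerivAt.add (HasDerivAt.smul h4 hp) (HasDerivAt.smul hr h2)
    change HasDerivAt _ (hacc (hnormalize c) t) t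
    refine HasDerivAt.congr_deriv h5 ?_
    rw [h1 ht]
    simp only [normAcc, normOp, rinv1, sub_apply, smul_apply, ContinuousLinearMap.id_apply,
      ContinuousLinearMap.smulRight_apply, innerSL_apply_apply, Pi.pow_apply, Pi.neg_apply,
      Pi.mul_apply]
    module

end Normalize

/-! ### Reparametrization and concatenation -/

section Rep

variable {X : Type*}

/-- `p` is an orientation preserving reparametrization of `q`. -/
def Rep (p q : ℝ → X) : Prop :=
  ∃ φ : ℝ → ℝ, StrictMonoOn φ (Icc 0 1) ∧ BijOn φ (Icc 0 1) (Icc 0 1) ∧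
    ∀ t ∈ Icc (0 : ℝ) 1, p t = q (φ t)

theorem Rep.of_eqOn {p q : ℝ → X} (h : ∀ t ∈ Icc (0 : ℝ) 1, p t = q t) : Rep p q :=
  ⟨id, strictMono_id.strictMonoOn _, bijOn_id _, h⟩

theorem Rep.refl (p : ℝ → X) : Rep p p := Rep.of_eqOn fun _ _ => rfl

theorem Rep.trans {p q r : ℝ → X} (h : Rep p q) (h' : Rep q r) : Rep p r := by
  obtain ⟨φ, h1, h2, h3⟩ := h
  obtain ⟨ψ, k1, k2, k3⟩ := h'
  exact ⟨ψ ∘ φ, k1.comp h1 h2.mapsTo, k2.comp h2, fun t ht => by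
    rw [h3 t ht, k3 _ (h2.mapsTo ht)]; rfl⟩

theorem Rep.symm {p q : ℝ → X} (h : Rep p q) : Rep q p := by
  obtain ⟨φ, h1, h2, h3⟩ := h
  have hinv := h2.invOn_invFunOn
  have hb : BijOn (Function.invFunOn φ (Icc 0 1)) (Icc 0 1) (Icc 0 1) :=
    (bijOn_comm hinv.symm).1 h2
  refine ⟨_, fun s hs t ht hst => ?_, hb, fun t ht => ?_⟩
  · rw [← h1.lt_iff_lt (hb.mapsTo hs) (hb.mapsTo ht), hinv.2 hs, hinv.2 ht]; exact hst
  · rw [h3 _ (hb.mapsTo ht), hinv.2 ht]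

theorem bijOn_of_continuousOn {φ : ℝ → ℝ} (h : StrictMonoOn φ (Icc 0 1))
    (hc : ContinuousOn φ (Icc 0 1)) (h0 : φ 0 = 0) (h1 : φ 1 = 1) :
    BijOn φ (Icc 0 1) (Icc 0 1) := by
  refine ⟨fun t ht => ?_, h.injOn, ?_⟩
  · constructor
    · rw [← h0]; exact h.monotoneOn (by simp) ht ht.1
    · rw [← h1]; exact h.monotoneOn ht (by simp) ht.2
  · have := intermediate_value_Icc zero_le_one hc
    rwa [h0, h1] at this

/-- First `p`, then `q`. -/
def cat (p q : ℝ → X) (t : ℝ) : X := if t ≤ 1 / 2 then p (2 * t) else q (2 * t - 1)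

/-- First `p` on `[0,r]`, then `q` on `[r,1]`. -/
theorem rep_cat_of_pieces {p q g : ℝ → X} {r : ℝ} (hr0 : 0 < r) (hr1 : r < 1) {φ ψ : ℝ → ℝ}
    (h1 : StrictMonoOn φ (Icc 0 1)) (h2 : BijOn φ (Icc 0 1) (Icc 0 1))
    (k1 : StrictMonoOn ψ (Icc 0 1)) (k2 : BijOn ψ (Icc 0 1) (Icc 0 1))
    (hp : ∀ t ∈ Icc (0 : ℝ) 1, p t = g (r * φ t))
    (hq : ∀ t ∈ Ioc (0 : ℝ) 1, q t = g (r + (1 - r) * ψ t)) : Rep (cat p q) g := by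
  have mem1 : ∀ {t : ℝ}, t ∈ Icc (0 : ℝ) 1 → t ≤ 1 / 2 → 2 * t ∈ Icc (0 : ℝ) 1 := fun ht h =>
    ⟨by linarith [ht.1], by linarith⟩
  have mem2 : ∀ {t : ℝ}, t ∈ Icc (0 : ℝ) 1 → ¬ t ≤ 1 / 2 → 2 * t - 1 ∈ Icc (0 : ℝ) 1 :=
    fun ht h => ⟨by linarith, by linarith [ht.2]⟩
  have end0 : ∀ {χ : ℝ → ℝ}, StrictMonoOn χ (Icc 0 1) → BijOn χ (Icc 0 1) (Icc 0 1) → χ 0 = 0 := by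
    intro χ a b
    obtain ⟨s, hs, hs0⟩ := b.surjOn (show (0 : ℝ) ∈ Icc (0 : ℝ) 1 by simp)
    refine le_antisymm ?_ (b.mapsTo (by simp)).1
    exact (a.monotoneOn (by simp) hs hs.1).trans hs0.le
  have hψ0 := end0 k1 k2
  have hmono : StrictMonoOn (fun t => if t ≤ 1 / 2 then r * φ (2 * t)
      else r + (1 - r) * ψ (2 * t - 1)) (Icc 0 1) := by
    intro s hs t ht hst
    dsimp only
    split_ifs with a b b
    · exact mul_lt_mul_of_pos_left (h1 (mem1 hs a) (mem1 ht b) (by linarith)) hr0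
    · have e1 := (h2.mapsTo (mem1 hs a)).2
      have e2 : 0 < ψ (2 * t - 1) := by
        rw [← hψ0]; exact k1 (by simp) (mem2 ht b) (by linarith)
      have := mul_pos (sub_pos.2 hr1) e2
      nlinarith
    · linarith
    · have := mul_lt_mul_of_pos_left (k1 (mem2 hs a) (mem2 ht b) (by linarith)) (sub_pos.2 hr1)
      linarith
  refine ⟨_, hmono, ⟨?_, hmono.injOn, ?_⟩, ?_⟩
  · intro t ht
    dsimp only
    split_ifs with a
    · obtain ⟨e1, e2⟩ := h2.mapsTo (mem1 ht a)
      exact ⟨by positivity, by nlinarith⟩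
    · obtain ⟨e1, e2⟩ := k2.mapsTo (mem2 ht a)
      have : 0 < 1 - r := sub_pos.2 hr1
      exact ⟨by positivity, by nlinarith⟩
  · intro y hy
    have hr' : 0 < 1 - r := sub_pos.2 hr1
    by_cases hyr : y ≤ r
    · obtain ⟨s, hs, hsy⟩ := h2.surjOn (show y / r ∈ Icc (0 : ℝ) 1 from
        ⟨div_nonneg hy.1 hr0.le, (div_le_one hr0).2 hyr⟩)
      refine ⟨s / 2, ⟨by linarith [hs.1], by linarith [hs.2]⟩, ?_⟩
      dsimp only
      rw [if_pos (by linarith [hs.2]), mul_div_cancel₀ _ two_ne_zero, hsy,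
        mul_div_cancel₀ _ hr0.ne']
    · obtain ⟨s, hs, hsy⟩ := k2.surjOn (show (y - r) / (1 - r) ∈ Icc (0 : ℝ) 1 from
        ⟨div_nonneg (by linarith) hr'.le, (div_le_one hr').2 (by linarith [hy.2])⟩)
      -- `cat` takes its value at the midpoint from the first piece, so a preimage in the second
      -- piece has to be strictly positive.
      have hs0 : 0 < s := by
        refine lt_of_le_of_ne hs.1 fun h => ?_
        rw [← h, hψ0] at hsy
        have : y - r = 0 := by
          rcases div_eq_zero_iff.1 hsy.symm with h | h <;> linarith
        linarith
      refine ⟨(s + 1) / 2, ⟨by linarith [hs.1], by linarith [hs.2]⟩, ?_⟩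
      dsimp only
      rw [if_neg (by linarith), show 2 * ((s + 1) / 2) - 1 = s by ring, hsy,
        mul_div_cancel₀ _ hr'.ne']
      ring
  · intro t ht
    dsimp only [cat]
    split_ifs with a
    · exact hp _ (mem1 ht a)
    · exact hq _ ⟨by linarith, (mem2 ht a).2⟩

theorem rep_cat_id {p q g : ℝ → X} {r : ℝ} (hr0 : 0 < r) (hr1 : r < 1)
    (hp : ∀ t ∈ Icc (0 : ℝ) 1, p t = g (r * t))
    (hq : ∀ t ∈ Ioc (0 : ℝ) 1, q t = g (r + (1 - r) * t)) : Rep (cat p q) g :=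
  rep_cat_of_pieces hr0 hr1 (φ := id) (ψ := id) (strictMono_id.strictMonoOn _) (bijOn_id _)
    (strictMono_id.strictMonoOn _) (bijOn_id _) hp hq

theorem Rep.cat {p p' q q' : ℝ → X} (hp : Rep p p') (hq : Rep q q') :
    Rep (cat p q) (cat p' q') := by
  obtain ⟨φ, h1, h2, h3⟩ := hp
  obtain ⟨ψ, k1, k2, k3⟩ := hq
  have hψ : ∀ t ∈ Ioc (0 : ℝ) 1, 0 < ψ t := fun t ht =>
    (k2.mapsTo (show (0 : ℝ) ∈ Icc (0 : ℝ) 1 by simp)).1.trans_lt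
      (k1 (by simp) ⟨ht.1.le, ht.2⟩ ht.1)
  refine rep_cat_of_pieces (r := 1 / 2) (by norm_num) (by norm_num) h1 h2 k1 k2
    (fun t ht => ?_) fun t ht => ?_
  · rw [LocallyConvex.cat, if_pos (by linarith [(h2.mapsTo ht).2]), h3 t ht]; ring_nf
  · rw [LocallyConvex.cat, if_neg (by linarith [hψ t ht]), k3 t ⟨ht.1.le, ht.2⟩]; ring_nf

theorem rep_cat_assoc (p q r : ℝ → X) : Rep (cat p (cat q r)) (cat (cat p q) r) := by
  have hsec : ∀ t : ℝ, t ∈ Icc (0 : ℝ) 1 → (fun t : ℝ => if t ≤ 1 / 2 then 2 / 3 * t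
      else (4 * t - 1) / 3) t ∈ Icc (0 : ℝ) 1 := fun t ht => by
    dsimp only; split_ifs <;> constructor <;> linarith [ht.1, ht.2]
  have hm : StrictMono (fun t : ℝ => if t ≤ 1 / 2 then 2 / 3 * t else (4 * t - 1) / 3) := by
    intro s t hst
    dsimp only
    split_ifs <;> linarith
  -- On the right, `p` ends at `1/4` and `q` at `1/2`, one third of the way through `[1/4, 1]`.
  -- Hence `ψ` is piecewise linear with `ψ (1/2) = 1/3`.
  refine rep_cat_of_pieces (r := 1 / 4) (by norm_num) (by norm_num) (φ := id)
    (ψ := fun t : ℝ => if t ≤ 1 / 2 then 2 / 3 * t else (4 * t - 1) / 3)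
    (strictMono_id.strictMonoOn _) (bijOn_id _) (hm.strictMonoOn _)
    ⟨hsec, hm.injective.injOn, fun y hy => ?_⟩ (fun t ht => ?_) fun t ht => ?_
  · by_cases h : y ≤ 1 / 3
    · refine ⟨3 / 2 * y, ⟨by linarith [hy.1], by linarith⟩, ?_⟩
      dsimp only
      rw [if_pos (by linarith)]; ring
    · refine ⟨(3 * y + 1) / 4, ⟨by linarith, by linarith [hy.2]⟩, ?_⟩
      dsimp only
      rw [if_neg (by linarith)]; ring
  · simp only [LocallyConvex.cat, id]
    rw [if_pos (by linarith [ht.2]), if_pos (by linarith [ht.2])]; ring_nf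
  · simp only [LocallyConvex.cat]
    split_ifs with h
    all_goals first | (exfalso; linarith [ht.1]) | (congr 1; ring) 

end Rep

/-! ### Prescribing the speed at the ends -/

section Fit

/-- The rational function with value `0`, `1` and derivative `a`, `b` at `0`, `1`. -/
def sig (a b t : ℝ) : ℝ := (t ^ 2 + a * (t * (1 - t))) / (1 + (a + b - 2) * (t * (1 - t)))

def sig1 (a b t : ℝ) : ℝ :=
  (a * (1 - t) ^ 2 + 2 * (t * (1 - t)) + b * t ^ 2) / (1 + (a + b - 2) * (t * (1 - t))) ^ 2

def sig2 (a b t : ℝ) : ℝ :=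
  ((-2 * a * (1 - t) + 2 * (1 - 2 * t) + 2 * b * t) * (1 + (a + b - 2) * (t * (1 - t))) -
    2 * (a * (1 - t) ^ 2 + 2 * (t * (1 - t)) + b * t ^ 2) * ((a + b - 2) * (1 - 2 * t))) /
    (1 + (a + b - 2) * (t * (1 - t))) ^ 3

theorem sig_den_pos {a b t : ℝ} (ha : 0 < a) (hb : 0 < b) (ht : t ∈ Icc (0 : ℝ) 1) :
    0 < 1 + (a + b - 2) * (t * (1 - t)) := by
  have h1 : 0 ≤ t * (1 - t) := mul_nonneg ht.1 (by linarith [ht.2])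
  have h2 : 0 ≤ (a + b) * (t * (1 - t)) := by positivity
  nlinarith [sq_nonneg (2 * t - 1)]

theorem hasDerivAt_sig {a b t : ℝ} (ha : 0 < a) (hb : 0 < b) (ht : t ∈ Icc (0 : ℝ) 1) :
    HasDerivAt (sig a b) (sig1 a b t) t := by
  have hD := (sig_den_pos ha hb ht).ne'
  have h0 : HasDerivAt (fun t : ℝ => t * (1 - t)) (1 - 2 * t) t := by
    refine ((hasDerivAt_id t).mul ((hasDerivAt_id t).const_sub 1)).congr_deriv ?_
    simp; ring
  refine HasDerivAt.congr_deriv (((hasDerivAt_pow 2 t).add (h0.const_mul a)).div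
    ((h0.const_mul (a + b - 2)).const_add 1) hD) ?_
  unfold sig1
  congr 1
  simp
  ring

theorem hasDerivAt_sig1 {a b t : ℝ} (ha : 0 < a) (hb : 0 < b) (ht : t ∈ Icc (0 : ℝ) 1) :
    HasDerivAt (sig1 a b) (sig2 a b t) t := by
  have hD := (sig_den_pos ha hb ht).ne'
  have h0 : HasDerivAt (fun t : ℝ => t * (1 - t)) (1 - 2 * t) t := by
    refine ((hasDerivAt_id t).mul ((hasDerivAt_id t).const_sub 1)).congr_deriv ?_
    simp; ring
  have h1 : HasDerivAt (fun t : ℝ => (1 - t) ^ 2) (-2 * (1 - t)) t := by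
    refine (((hasDerivAt_id t).const_sub 1).pow 2).congr_deriv ?_
    simp
  refine HasDerivAt.congr_deriv ((((h1.const_mul a).add (h0.const_mul 2)).add
    ((hasDerivAt_pow 2 t).const_mul b)).div
    (((h0.const_mul (a + b - 2)).const_add 1).pow 2) (pow_ne_zero 2 hD)) ?_
  unfold sig2
  rw [div_eq_div_iff (by positivity) (by positivity)]
  simp
  ring

/-- The numerator is positive for all positive end slopes. This is the reason for a rational
function: the cubic with the same end data is not monotone when the slopes are large. -/
theorem sig1_pos {a b t : ℝ} (ha : 0 < a) (hb : 0 < b) (ht : t ∈ Icc (0 : ℝ) 1) :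
    0 < sig1 a b t := by
  refine div_pos ?_ (pow_pos (sig_den_pos ha hb ht) 2)
  have h1 : 0 ≤ t * (1 - t) := mul_nonneg ht.1 (by linarith [ht.2])
  rcases eq_or_lt_of_le ht.1 with h | h
  · rw [← h]; simpa using ha
  · have : 0 < b * t ^ 2 := by positivity
    positivity

theorem continuousOn_sig2 : ContinuousOn (fun x : (ℝ × ℝ) × ℝ => sig2 x.1.1 x.1.2 x.2)
    ((Ioi 0 ×ˢ Ioi 0) ×ˢ Icc 0 1) := by
  unfold sig2
  refine ContinuousOn.div (by fun_prop) (by fun_prop) fun x hx => ?_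
  exact (pow_pos (sig_den_pos hx.1.1 hx.1.2 hx.2) 3).ne'

def hsig (a b : ℝ) : H2 ℝ := hsmooth (sig a b) (sig1 a b) (sig2 a b)

theorem hsig_spec {a b : ℝ} (ha : 0 < a) (hb : 0 < b) :
    (∀ t ∈ Icc (0 : ℝ) 1, hvel (hsig a b) t = sig1 a b t) ∧
      ∀ t ∈ Icc (0 : ℝ) 1, hpos (hsig a b) t = sig a b t :=
  hsmooth_spec (fun _ ht => (hasDerivAt_sig ha hb ht).hasDerivWithinAt)
    (fun _ ht => (hasDerivAt_sig1 ha hb ht).hasDerivWithinAt)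
    (continuousOn_sig2.comp (f := fun t => ((a, b), t)) (by fun_prop)
      fun _ ht => ⟨⟨ha, hb⟩, ht⟩)

theorem hsig_vel_pos {a b : ℝ} (ha : 0 < a) (hb : 0 < b) :
    ∀ t ∈ Icc (0 : ℝ) 1, 0 < hvel (hsig a b) t := fun t ht => by
  rw [(hsig_spec ha hb).1 t ht]; exact sig1_pos ha hb ht

theorem hsig_bijOn {a b : ℝ} (ha : 0 < a) (hb : 0 < b) :
    BijOn (hpos (hsig a b)) (Icc 0 1) (Icc 0 1) := by
  refine bijOn_of_continuousOn (strictMonoOn_hpos (hsig_vel_pos ha hb))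
    (continuous_hpos_right _).continuousOn ?_ ?_
  · rw [(hsig_spec ha hb).2 0 (by simp)]; simp [sig]
  · rw [(hsig_spec ha hb).2 1 (by simp)]; simp [sig]

theorem continuous_hsig {T : Type*} [TopologicalSpace T] {a b : T → ℝ} (ha : Continuous a)
    (hb : Continuous b) (ha0 : ∀ x, 0 < a x) (hb0 : ∀ x, 0 < b x) :
    Continuous fun x => hsig (a x) (b x) := by
  refine continuous_hsmooth (by simp [sig]; fun_prop) (by simp [sig1]; fun_prop) ?_
  exact continuousOn_sig2.comp (f := fun y : T × ℝ => ((a y.1, b y.1), y.2)) (by fun_prop)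
    fun y hy => ⟨⟨ha0 _, hb0 _⟩, hy.2⟩

variable {E : Type*} [NormedAddCommGroup E] [NormedSpace ℝ E]

/-- The reparametrization of `c` with speed `α` at `0` and `β` at `1`. -/
def hfit (α β : ℝ) (c : H2 E) : H2 E := hcomp c (hsig (α / ‖hvel c 0‖) (β / ‖hvel c 1‖))

end Fit

theorem det3_eq (u v w : E3) : det3 u v w =
    u 0 * (v 1 * w 2 - v 2 * w 1) - v 0 * (u 1 * w 2 - u 2 * w 1) +
      w 0 * (u 1 * v 2 - u 2 * v 1) := by
  simp [det3, Matrix.det_fin_three]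
  ring

/-- Column operations. This is why the sign of the determinant survives positive reparametrization
and radial projection. -/
theorem det3_flag (p v w : E3) (a b b' d d' d'' : ℝ) :
    det3 (a • p) (b • v + b' • p) (d • w + d' • v + d'' • p) = a * b * d * det3 p v w := by
  simp only [det3_eq, PiLp.add_apply, PiLp.smul_apply, smul_eq_mul]
  ring

/-! ### Oriented flags and locally convex arcs -/

section Flag

/-- The oriented flags spanned by `x` and by `x` and `v` agree. -/
def SameFlag (f g : E3 × E3) : Prop :=
  ∃ l m k : ℝ, 0 < l ∧ 0 < m ∧ g.1 = l • f.1 ∧ g.2 = m • f.2 + k • f.1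

theorem SameFlag.refl (f : E3 × E3) : SameFlag f f :=
  ⟨1, 1, 0, one_pos, one_pos, by simp, by simp⟩

theorem SameFlag.trans {f g h : E3 × E3} (a : SameFlag f g) (b : SameFlag g h) : SameFlag f h := by
  obtain ⟨l, m, k, hl, hm, e1, e2⟩ := a
  obtain ⟨l', m', k', hl', hm', e1', e2'⟩ := b
  refine ⟨l' * l, m' * m, m' * k + k' * l, by positivity, by positivity, ?_, ?_⟩
  · rw [e1', e1, smul_smul]
  · rw [e2', e2, e1]; module

theorem SameFlag.symm {f g : E3 × E3} (a : SameFlag f g) : SameFlag g f := by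
  obtain ⟨l, m, k, hl, hm, e1, e2⟩ := a
  refine ⟨l⁻¹, m⁻¹, -(m⁻¹ * k * l⁻¹), by positivity, by positivity, ?_, ?_⟩
  · rw [e1, smul_smul, inv_mul_cancel₀ hl.ne', one_smul]
  · rw [e1, e2, smul_add, smul_smul, smul_smul, smul_smul, inv_mul_cancel₀ hm.ne',
      neg_mul, mul_assoc, inv_mul_cancel₀ hl.ne']
    module

theorem SameFlag.of_smul {f g : E3 × E3} {m : ℝ} (hm : 0 < m) (h1 : g.1 = f.1)
    (h2 : g.2 = m • f.2) : SameFlag f g :=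
  ⟨1, m, 0, one_pos, hm, by simp [h1], by simp [h2]⟩

/-- Unit length forces `l = 1`, and orthogonality removes the component along the position. -/
theorem SameFlag.exact {f g : E3 × E3} (a : SameFlag f g) (hf : ‖f.1‖ = 1) (hg : ‖g.1‖ = 1)
    (hf' : inner ℝ f.1 f.2 = 0) (hg' : inner ℝ g.1 g.2 = 0) :
    g.1 = f.1 ∧ ∃ m : ℝ, 0 < m ∧ g.2 = m • f.2 := by
  obtain ⟨l, m, k, hl, hm, e1, e2⟩ := a
  have hl1 : l = 1 := by
    rw [e1, norm_smul, hf, mul_one, Real.norm_of_nonneg hl.le] at hg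
    exact hg
  subst hl1
  rw [one_smul] at e1
  refine ⟨e1, m, hm, ?_⟩
  rw [e1, e2, inner_add_right, inner_smul_right, inner_smul_right, hf', real_inner_self_eq_norm_sq,
    hf] at hg'
  have hk : k = 0 := by linarith
  rw [e2, hk, zero_smul, add_zero]

end Flag

/-- The flag of `c` at time `t`. -/
def flag (c : H2 E3) (t : ℝ) : E3 × E3 := (hpos c t, hvel c t)

/-- On `S` the curve `c` lies on the sphere, is immersed and locally convex. -/
structure IsArcOn (S : Set ℝ) (c : H2 E3) : Prop where
  norm : ∀ t ∈ S, ‖hpos c t‖ = 1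
  vel : ∀ t ∈ S, hvel c t ≠ 0
  det : ∀ᵐ t, t ∈ S → 0 < det3 (hpos c t) (hvel c t) (hacc c t)

/-- Locally convex spherical curves on `[0,1]`. -/
abbrev IsArc (c : H2 E3) : Prop := IsArcOn (Icc 0 1) c

theorem IsArcOn.mono {S S' : Set ℝ} {c : H2 E3} (h : IsArcOn S c) (hS : S' ⊆ S) : IsArcOn S' c :=
  ⟨fun t ht => h.norm t (hS ht), fun t ht => h.vel t (hS ht), by
    filter_upwards [h.det] with t h ht using h (hS ht)⟩

theorem inner_eq_zero_of_norm {c : H2 E3} (h : ∀ t ∈ Icc (0 : ℝ) 1, ‖hpos c t‖ = 1) {t : ℝ}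
    (ht : t ∈ Icc (0 : ℝ) 1) : inner ℝ (hpos c t) (hvel c t) = 0 := by
  have h1 : HasDerivWithinAt (fun s => ‖hpos c s‖ ^ 2) (2 * inner ℝ (hpos c t) (hvel c t))
      (Icc 0 1) t := (hasDerivAt_hpos c t).norm_sq.hasDerivWithinAt
  have h2 : HasDerivWithinAt (fun s => ‖hpos c s‖ ^ 2) 0 (Icc 0 1) t :=
    (hasDerivWithinAt_const t (Icc (0 : ℝ) 1) (1 : ℝ)).congr
      (fun s hs => by rw [h s hs, one_pow]) (by rw [h t ht, one_pow])
  have := (uniqueDiffOn_Icc_zero_one t ht).eq_deriv _ h1 h2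
  linarith

theorem IsArc.inner_eq_zero {c : H2 E3} (h : IsArc c) {t : ℝ} (ht : t ∈ Icc (0 : ℝ) 1) :
    inner ℝ (hpos c t) (hvel c t) = 0 :=
  inner_eq_zero_of_norm h.norm ht

/-- The determinant is multiplied by `ψ' ^ 3`; the term with `ψ''` is a multiple of the velocity and
drops out. -/
theorem isArcOn_hcomp {c : H2 E3} {ψ : H2 ℝ} {S S' : Set ℝ} (hS : S ⊆ Icc 0 1)
    (h : ∀ t ∈ Icc (0 : ℝ) 1, 0 < hvel ψ t) (hm : MapsTo (hpos ψ) S S') (hc : IsArcOn S' c) :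
    IsArcOn S (hcomp c ψ) := by
  obtain ⟨hv, hp⟩ := hcomp_spec c h
  refine ⟨fun t ht => ?_, fun t ht => ?_, ?_⟩
  · rw [hp t (hS ht)]; exact hc.norm _ (hm ht)
  · rw [hv t (hS ht)]; exact smul_ne_zero (h t (hS ht)).ne' (hc.vel _ (hm ht))
  · filter_upwards [hcomp_acc c h, ae_comp_hpos h hc.det] with t h1 h2 ht
    rw [hp t (hS ht), hv t (hS ht), h1 (hS ht)]
    have := det3_flag (hpos c (hpos ψ t)) (hvel c (hpos ψ t)) (hacc c (hpos ψ t)) 1 (hvel ψ t) 0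
      (hvel ψ t ^ 2) (hacc ψ t) 0
    simp only [one_smul, zero_smul, add_zero, one_mul] at this
    rw [this]
    exact mul_pos (mul_pos (h t (hS ht)) (pow_pos (h t (hS ht)) 2)) (h2 (hS ht) (hm ht))

theorem isArc_hglue {l : ℝ} (h0 : 0 ≤ l) (h1 : l ≤ 1) {c₁ c₂ : H2 E3}
    (hp : hpos c₁ l = hpos c₂ l) (hv : hvel c₁ l = hvel c₂ l) (hc₁ : IsArcOn (Icc 0 l) c₁)
    (hc₂ : IsArcOn (Icc l 1) c₂) : IsArc (hglue l c₁ c₂) := by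
  obtain ⟨ev, ep⟩ := hglue_spec h0 h1 hp hv
  refine ⟨fun t ht => ?_, fun t ht => ?_, ?_⟩
  · rw [ep t ht]; split_ifs with h
    · exact hc₁.norm t ⟨ht.1, h⟩
    · exact hc₂.norm t ⟨(not_le.1 h).le, ht.2⟩
  · rw [ev t ht]; split_ifs with h
    · exact hc₁.vel t ⟨ht.1, h⟩
    · exact hc₂.vel t ⟨(not_le.1 h).le, ht.2⟩
  · filter_upwards [hglue_acc h0 h1 c₁ c₂, hc₁.det, hc₂.det] with t e1 e2 e3 ht
    rw [ep t ht, ev t ht, e1 ht]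
    split_ifs with h
    · exact e2 ⟨ht.1, h⟩
    · exact e3 ⟨(not_le.1 h).le, ht.2⟩

/-- Curves in space whose radial projection to the sphere is immersed and locally convex. -/
structure IsPreArc (c : H2 E3) : Prop where
  pos : ∀ t ∈ Icc (0 : ℝ) 1, hpos c t ≠ 0
  vel : ∀ t ∈ Icc (0 : ℝ) 1, ∀ k : ℝ, hvel c t ≠ k • hpos c t
  det : ∀ᵐ t, t ∈ Icc (0 : ℝ) 1 → 0 < det3 (hpos c t) (hvel c t) (hacc c t)

/-- The determinant is multiplied by `‖c‖⁻¹ ^ 3`; the other terms of the derivatives are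
combinations of earlier columns. -/
theorem isArc_hnormalize {c : H2 E3} (h : IsPreArc c) : IsArc (hnormalize c) := by
  obtain ⟨ev, ep⟩ := hnormalize_spec h.pos
  have hn : ∀ t ∈ Icc (0 : ℝ) 1, 0 < ‖hpos c t‖ := fun t ht => norm_pos_iff.2 (h.pos t ht)
  refine ⟨fun t ht => ?_, fun t ht h0 => ?_, ?_⟩
  · rw [ep t ht, norm_smul, norm_inv, norm_norm, inv_mul_cancel₀ (hn t ht).ne']
  · rw [ev t ht] at h0
    refine h.vel t ht (-(‖hpos c t‖ * rinv1 (hpos c t) (hvel c t))) ?_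
    have := congrArg (fun y => ‖hpos c t‖ • y) h0
    simp only [smul_add, smul_smul, mul_inv_cancel₀ (hn t ht).ne', one_smul, smul_zero] at this
    rw [neg_smul]
    exact eq_neg_of_add_eq_zero_right this
  · filter_upwards [hnormalize_acc h.pos, h.det] with t h1 h2 ht
    rw [ep t ht, ev t ht, h1 ht]
    have e : normAcc (hpos c t) (hvel c t) + normOp (hpos c t) (hacc c t) =
        ‖hpos c t‖⁻¹ • hacc c t + (2 * rinv1 (hpos c t) (hvel c t)) • hvel c t +
        ((3 * ‖hpos c t‖⁻¹ ^ 5 * (inner ℝ (hpos c t) (hvel c t)) ^ 2 -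
          ‖hpos c t‖⁻¹ ^ 3 * inner ℝ (hvel c t) (hvel c t)) -
          ‖hpos c t‖⁻¹ ^ 3 * inner ℝ (hpos c t) (hacc c t)) • hpos c t := by
      simp only [normAcc, normOp, sub_apply, smul_apply, ContinuousLinearMap.id_apply,
        ContinuousLinearMap.smulRight_apply, innerSL_apply_apply]
      module
    rw [e, add_comm (rinv1 _ _ • _), det3_flag]
    have := inv_pos.2 (hn t ht)
    exact mul_pos (by positivity) (h2 ht)

theorem sameFlag_hnormalize {c : H2 E3} (h : ∀ t ∈ Icc (0 : ℝ) 1, hpos c t ≠ 0) {t : ℝ}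
    (ht : t ∈ Icc (0 : ℝ) 1) : SameFlag (flag c t) (flag (hnormalize c) t) := by
  obtain ⟨ev, ep⟩ := hnormalize_spec h
  have hn := inv_pos.2 (norm_pos_iff.2 (h t ht))
  refine ⟨_, _, rinv1 (hpos c t) (hvel c t), hn, hn, ep t ht, ?_⟩
  simp only [flag]
  rw [ev t ht, add_comm]

section FitArc

variable {T : Type*} [TopologicalSpace T]

theorem continuous_hfit {α β : T → ℝ} (hα : Continuous α) (hβ : Continuous β)
    (hα0 : ∀ x, 0 < α x) (hβ0 : ∀ x, 0 < β x) {c : T → H2 E3} (hc : Continuous c)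
    (h0 : ∀ x, hvel (c x) 0 ≠ 0) (h1 : ∀ x, hvel (c x) 1 ≠ 0) :
    Continuous fun x => hfit (α x) (β x) (c x) := by
  have p0 : ∀ x, 0 < α x / ‖hvel (c x) 0‖ := fun x => div_pos (hα0 x) (norm_pos_iff.2 (h0 x))
  have p1 : ∀ x, 0 < β x / ‖hvel (c x) 1‖ := fun x => div_pos (hβ0 x) (norm_pos_iff.2 (h1 x))
  refine continuous_hcomp hc (continuous_hsig ?_ ?_ p0 p1) fun x => hsig_vel_pos (p0 x) (p1 x)
  · exact hα.div (Continuous.hvel hc continuous_const).norm fun x => norm_ne_zero_iff.2 (h0 x)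
  · exact hβ.div (Continuous.hvel hc continuous_const).norm fun x => norm_ne_zero_iff.2 (h1 x)

variable {α β : ℝ} {c : H2 E3}

theorem hfit_spec (hα : 0 < α) (hβ : 0 < β) (hc : IsArc c) :
    IsArc (hfit α β c) ∧ Rep (hpos (hfit α β c)) (hpos c) ∧
      hpos (hfit α β c) 0 = hpos c 0 ∧ hpos (hfit α β c) 1 = hpos c 1 ∧
      hvel (hfit α β c) 0 = (α / ‖hvel c 0‖) • hvel c 0 ∧
      hvel (hfit α β c) 1 = (β / ‖hvel c 1‖) • hvel c 1 := by
  have p0 : 0 < α / ‖hvel c 0‖ := div_pos hα (norm_pos_iff.2 (hc.vel 0 (by simp)))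
  have p1 : 0 < β / ‖hvel c 1‖ := div_pos hβ (norm_pos_iff.2 (hc.vel 1 (by simp)))
  have hpos' := hsig_vel_pos p0 p1
  obtain ⟨sv, sp⟩ := hsig_spec p0 p1
  obtain ⟨ev, ep⟩ := hcomp_spec c hpos'
  have hb := hsig_bijOn p0 p1
  have m0 : (0 : ℝ) ∈ Icc (0 : ℝ) 1 := by simp
  have m1 : (1 : ℝ) ∈ Icc (0 : ℝ) 1 := by simp
  have z0 := sp 0 m0
  have z1 := sp 1 m1
  have w0 := sv 0 m0
  have w1 := sv 1 m1
  simp only [sig, sig1] at z0 z1 w0 w1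
  norm_num at z0 z1 w0 w1
  unfold hfit
  refine ⟨isArcOn_hcomp subset_rfl hpos' hb.mapsTo hc, ⟨_, strictMonoOn_hpos hpos', hb, ep⟩,
    ?_, ?_, ?_, ?_⟩
  · rw [ep 0 m0, z0]
  · rw [ep 1 m1, z1]
  · rw [ev 0 m0, z0, w0]
  · rw [ev 1 m1, z1, w1]

end FitArc

/-! ### Joining arcs with matching flags -/

section Join

/-- The curve that runs through the arc `a` up to time `l` and follows `b` from then on. -/
def hgvar (l : ℝ) (a b : H2 E3) : H2 E3 :=
  hglue l (hcomp (hfit 1 (l * ‖hvel b l‖) a) (haff 0 l⁻¹)) b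

theorem haff_vel_pos {q m : ℝ} (hm : 0 < m) : ∀ t ∈ Icc (0 : ℝ) 1, 0 < hvel (haff q m) t :=
  fun t _ => by rwa [haff_vel]

theorem continuous_hgvar {T : Type*} [TopologicalSpace T] {l : T → ℝ} {a b : T → H2 E3}
    (hl : Continuous l) (ha : Continuous a) (hb : Continuous b) (l0 : ∀ x, 0 < l x)
    (l1 : ∀ x, l x ≤ 1) (ha' : ∀ x, IsArc (a x)) (hb' : ∀ x, hvel (b x) (l x) ≠ 0) :
    Continuous fun x => hgvar (l x) (a x) (b x) := by
  refine continuous_hglue hl (fun x => (l0 x).le) l1 (continuous_hcomp ?_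
    (continuous_haff continuous_const (hl.inv₀ fun x => (l0 x).ne'))
    fun x => haff_vel_pos (inv_pos.2 (l0 x))) hb
  exact continuous_hfit continuous_const (hl.mul (Continuous.hvel hb hl).norm)
    (fun _ => one_pos) (fun x => mul_pos (l0 x) (norm_pos_iff.2 (hb' x))) ha
    (fun x => (ha' x).vel 0 (by simp)) fun x => (ha' x).vel 1 (by simp)

/-- Compressing an arc from `[0,1]` to `[0,l]` multiplies its velocity by `l⁻¹`. The arc `a` is
therefore first given the final speed `l * ‖hvel b l‖`, after which both velocities agree at `l`.
Its initial speed `1` is an arbitrary choice. -/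
theorem hgvar_spec {l : ℝ} (l0 : 0 < l) (l1 : l ≤ 1) {a b : H2 E3} (ha : IsArc a)
    (hb : IsArcOn (Icc l 1) b) (hp : hpos b l = hpos a 1)
    (hv : ∃ m : ℝ, 0 < m ∧ hvel b l = m • hvel a 1) :
    IsArc (hgvar l a b) ∧ SameFlag (flag a 0) (flag (hgvar l a b) 0) ∧
      flag (hgvar l a b) 1 = flag b 1 ∧
      ∃ φ : ℝ → ℝ, StrictMonoOn φ (Icc 0 1) ∧ BijOn φ (Icc 0 1) (Icc 0 1) ∧
        ∀ t ∈ Icc (0 : ℝ) 1, hpos (hgvar l a b) t =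
          if t ≤ l then hpos a (φ (l⁻¹ * t)) else hpos b t := by
  obtain ⟨m, hm, hv⟩ := hv
  have hbl : hvel b l ≠ 0 := hb.vel l ⟨le_rfl, l1⟩
  have hα : 0 < l * ‖hvel b l‖ := mul_pos l0 (norm_pos_iff.2 hbl)
  obtain ⟨f1, ⟨φ, f2, f3, f4⟩, f5, f6, f7, f8⟩ := hfit_spec one_pos hα ha
  have hli : 0 < l⁻¹ := inv_pos.2 l0
  obtain ⟨cv, cp⟩ := hcomp_spec (hfit 1 (l * ‖hvel b l‖) a) (haff_vel_pos (q := 0) hli)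
  have hlm : l ∈ Icc (0 : ℝ) 1 := ⟨l0.le, l1⟩
  simp only [haff_vel, haff_pos, zero_add] at cv cp
  have ep : hpos (hcomp (hfit 1 (l * ‖hvel b l‖) a) (haff 0 l⁻¹)) l = hpos b l := by
    rw [cp l hlm, inv_mul_cancel₀ l0.ne', f6, hp]
  have ev : hvel (hcomp (hfit 1 (l * ‖hvel b l‖) a) (haff 0 l⁻¹)) l = hvel b l := by
    rw [cv l hlm, inv_mul_cancel₀ l0.ne', f8, hv, norm_smul, Real.norm_of_nonneg hm.le, smul_smul]
    have : ‖hvel a 1‖ ≠ 0 := norm_ne_zero_iff.2 (ha.vel 1 (by simp))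
    congr 1
    field_simp
  have hmaps : MapsTo (hpos (haff 0 l⁻¹)) (Icc 0 l) (Icc 0 1) := fun t ht => by
    rw [haff_pos, zero_add]
    exact ⟨mul_nonneg hli.le ht.1, by
      rw [inv_mul_le_one₀ l0]; exact ht.2⟩
  obtain ⟨gv, gp⟩ := hglue_spec l0.le l1 ep ev
  have harc := isArc_hglue l0.le l1 ep ev
    (isArcOn_hcomp (Icc_subset_Icc_right l1) (haff_vel_pos hli) hmaps f1) hb
  refine ⟨harc, ?_, ?_, φ, f2, f3, fun t ht => ?_⟩
  · refine SameFlag.of_smul (m := l⁻¹ * (1 / ‖hvel a 0‖)) (mul_pos hli (div_pos one_pos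
      (norm_pos_iff.2 (ha.vel 0 (by simp))))) ?_ ?_
    · simp only [flag, hgvar]
      rw [gp 0 (by simp), if_pos l0.le, cp 0 (by simp), mul_zero, f5]
    · simp only [flag, hgvar]
      rw [gv 0 (by simp), if_pos l0.le, cv 0 (by simp), mul_zero, f7, smul_smul]
  · simp only [flag, hgvar]
    rw [gv 1 (by simp), gp 1 (by simp)]
    rcases eq_or_lt_of_le l1 with h | h
    · subst h
      rw [if_pos le_rfl, if_pos le_rfl, ep, ev]
    · rw [if_neg (not_le.2 h), if_neg (not_le.2 h)]
  · rw [hgvar, gp t ht]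
    split_ifs with h
    · rw [cp t ht, f4]
      have := hmaps (show t ∈ Icc 0 l from ⟨ht.1, h⟩)
      rwa [haff_pos, zero_add] at this
    · rfl

/-- The curve `b` run through on `[1/2,1]`. -/
def hlate (b : H2 E3) : H2 E3 := hcomp b (haff (-1) 2)

/-- For `t < 1/2` the values are those of `b` at negative times; they are not used when gluing at
some `l ≥ 1/2`. -/
theorem hlate_spec (b : H2 E3) : (∀ t ∈ Icc (0 : ℝ) 1, hvel (hlate b) t = (2 : ℝ) • hvel b (2 * t - 1)) ∧
    ∀ t ∈ Icc (0 : ℝ) 1, hpos (hlate b) t = hpos b (2 * t - 1) := by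
  have := hcomp_spec b (haff_vel_pos (q := -1) two_pos)
  simp only [haff_vel, haff_pos] at this
  refine ⟨fun t ht => ?_, fun t ht => ?_⟩
  · rw [hlate, this.1 t ht]; ring_nf
  · rw [hlate, this.2 t ht]; ring_nf

theorem continuous_hlate {T : Type*} [TopologicalSpace T] {b : T → H2 E3} (hb : Continuous b) :
    Continuous fun x => hlate (b x) :=
  continuous_hcomp hb continuous_const fun _ => haff_vel_pos two_pos

theorem isArcOn_hlate {b : H2 E3} (hb : IsArc b) : IsArcOn (Icc (1 / 2) 1) (hlate b) :=
  isArcOn_hcomp (Icc_subset_Icc_left (by norm_num)) (haff_vel_pos two_pos) (fun t ht => by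
    rw [haff_pos]; constructor <;> linarith [ht.1, ht.2]) hb

/-- As `l` grows, `b` is swallowed from its beginning: it is followed only from the time `2 * l - 1`
on. For `l = 1/2` all of `b` is left, for `l = 1` nothing. -/
theorem hgvar_hlate_spec {l : ℝ} (l0 : 1 / 2 ≤ l) (l1 : l ≤ 1) {a b : H2 E3} (ha : IsArc a)
    (hb : IsArc b) (hf : SameFlag (flag a 1) (flag b (2 * l - 1))) :
    IsArc (hgvar l a (hlate b)) ∧ SameFlag (flag a 0) (flag (hgvar l a (hlate b)) 0) ∧
      SameFlag (flag b 1) (flag (hgvar l a (hlate b)) 1) ∧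
      (l = 1 / 2 → Rep (hpos (hgvar l a (hlate b))) (cat (hpos a) (hpos b))) ∧
      (l = 1 → Rep (hpos (hgvar l a (hlate b))) (hpos a)) := by
  have lp : 0 < l := lt_of_lt_of_le (by norm_num) l0
  have hlm : l ∈ Icc (0 : ℝ) 1 := ⟨lp.le, l1⟩
  have hlm' : 2 * l - 1 ∈ Icc (0 : ℝ) 1 := ⟨by linarith, by linarith⟩
  obtain ⟨bv, bp⟩ := hlate_spec b
  obtain ⟨e1, m, hm, e2⟩ := hf.exact (ha.norm 1 (by simp)) (hb.norm _ hlm')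
    (ha.inner_eq_zero (by simp)) (hb.inner_eq_zero hlm')
  simp only [flag] at e1 e2
  obtain ⟨h1, h2, h3, φ, k1, k2, k3⟩ := hgvar_spec lp l1 ha
    ((isArcOn_hlate hb).mono (Icc_subset_Icc_left l0)) (by rw [bp l hlm, e1])
    ⟨2 * m, by positivity, by rw [bv l hlm, e2, smul_smul]⟩
  refine ⟨h1, h2, ?_, ?_, ?_⟩
  · rw [h3]
    have : (2 : ℝ) * 1 - 1 = 1 := by norm_num
    refine SameFlag.of_smul (m := 2) two_pos ?_ ?_
    · simp only [flag]; rw [bp 1 (by simp), this]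
    · simp only [flag]; rw [bv 1 (by simp), this]
  · rintro rfl
    refine Rep.trans (Rep.of_eqOn (q := cat (fun t => hpos a (φ t)) (hpos b)) fun t ht => ?_)
      (Rep.cat ⟨φ, k1, k2, fun t _ => rfl⟩ (Rep.refl _))
    rw [k3 t ht, cat]
    split_ifs with h
    · norm_num
    · rw [bp t ht]
  · rintro rfl
    refine ⟨φ, k1, k2, fun t ht => ?_⟩
    rw [k3 t ht, if_pos ht.2, inv_one, one_mul]

/-- First the arc `a`, then the arc `b`. -/
def join (a b : H2 E3) : H2 E3 := hgvar (1 / 2) a (hlate b)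

theorem join_spec {a b : H2 E3} (ha : IsArc a) (hb : IsArc b)
    (hf : SameFlag (flag a 1) (flag b 0)) :
    IsArc (join a b) ∧ SameFlag (flag a 0) (flag (join a b) 0) ∧
      SameFlag (flag b 1) (flag (join a b) 1) ∧ Rep (hpos (join a b)) (cat (hpos a) (hpos b)) := by
  obtain ⟨h1, h2, h3, h4, -⟩ := hgvar_hlate_spec (l := 1 / 2) le_rfl (by norm_num) ha hb
    (by norm_num; exact hf)
  exact ⟨h1, h2, h3, h4 rfl⟩

theorem continuous_hgvar_hlate {T : Type*} [TopologicalSpace T] {l : T → ℝ} {a b : T → H2 E3}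
    (hl : Continuous l) (ha : Continuous a) (hb : Continuous b) (l0 : ∀ x, 1 / 2 ≤ l x)
    (l1 : ∀ x, l x ≤ 1) (ha' : ∀ x, IsArc (a x)) (hb' : ∀ x, IsArc (b x)) :
    Continuous fun x => hgvar (l x) (a x) (hlate (b x)) :=
  continuous_hgvar hl ha (continuous_hlate hb) (fun x => lt_of_lt_of_le (by norm_num) (l0 x)) l1 ha'
    fun x => (isArcOn_hlate (hb' x)).vel _ ⟨l0 x, l1 x⟩

theorem continuous_join {T : Type*} [TopologicalSpace T] {a b : T → H2 E3}
    (ha : Continuous a) (hb : Continuous b) (ha' : ∀ x, IsArc (a x)) (hb' : ∀ x, IsArc (b x)) :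
    Continuous fun x => join (a x) (b x) :=
  continuous_hgvar_hlate continuous_const ha hb (fun _ => le_rfl) (fun _ => by norm_num) ha' hb'

end Join

/-! ### Passage between `H2Curve` and the coordinates `H2` -/

section Convert

theorem ae_I_iff {P : ℝ → Prop} :
    (∀ᵐ t : I, P t) ↔ ∀ᵐ t : ℝ, t ∈ Icc (0 : ℝ) 1 → P t := by
  rw [← ae_restrict_iff' measurableSet_Icc]
  exact (ae_restrict_iff_subtype measurableSet_Icc).symm

theorem measurePreserving_coe :
    MeasurePreserving ((↑) : I → ℝ) volume (volume.restrict (Icc 0 1)) :=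
  measurePreserving_subtype_coe measurableSet_Icc

theorem setIntegral_Iic_I {E : Type*} [NormedAddCommGroup E] [NormedSpace ℝ E] (F : ℝ → E) (t : I) :
    ∫ s in Iic t, F s = ∫ s in (0 : ℝ)..t, F s := by
  have h1 : (Iic t : Set I) = ((↑) : I → ℝ) ⁻¹' (Iic (t : ℝ)) := by ext s; simp
  rw [h1, measurePreserving_coe.setIntegral_preimage_emb
    (MeasurableEmbedding.subtype_coe measurableSet_Icc), intervalIntegral.integral_of_le t.2.1,
    Measure.restrict_restrict measurableSet_Iic, ← integral_Icc_eq_integral_Ioc]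
  congr 2
  ext s
  simp only [mem_inter_iff, mem_Iic, mem_Icc]
  exact ⟨fun h => ⟨h.2.1, h.1⟩, fun h => ⟨h.2, h.1, h.2.trans t.2.2⟩⟩

theorem memLp_coe (h : Lp E3 2 (volume : Measure ℝ)) : MemLp (fun t : I => h (t : ℝ)) 2 volume :=
  ((Lp.memLp h).restrict (Icc 0 1)).comp_measurePreserving measurePreserving_coe

def accI (c : H2 E3) : Lp E3 2 (volume : Measure I) := (memLp_coe c.2.2).toLp _

theorem accI_ae (c : H2 E3) : accI c =ᵐ[volume] fun t : I => hacc c t := MemLp.coeFn_toLp _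

theorem continuous_accI : Continuous accI := by
  have : ∀ c d : H2 E3, dist (accI c) (accI d) ≤ dist c.2.2 d.2.2 := by
    intro c d
    have e : accI c - accI d = (memLp_coe (c.2.2 - d.2.2)).toLp _ := by
      rw [accI, accI, ← MemLp.toLp_sub, MemLp.toLp_eq_toLp_iff]
      have := measurePreserving_coe.quasiMeasurePreserving.ae
        (ae_restrict_of_ae (s := Icc (0 : ℝ) 1) (Lp.coeFn_sub c.2.2 d.2.2))
      filter_upwards [this] with t ht
      exact ht.symm
    rw [dist_eq_norm, dist_eq_norm, e, Lp.norm_toLp, Lp.norm_def]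
    refine ENNReal.toReal_mono (Lp.eLpNorm_ne_top _) ?_
    refine (eLpNorm_comp_measurePreserving (p := 2)
      (Lp.stronglyMeasurable (c.2.2 - d.2.2)).aestronglyMeasurable measurePreserving_coe).trans_le ?_
    exact eLpNorm_mono_measure _ Measure.restrict_le_self
  rw [continuous_iff_continuousAt]
  intro d
  rw [ContinuousAt, tendsto_iff_dist_tendsto_zero]
  refine squeeze_zero (fun _ => dist_nonneg) (fun c => this c d) ?_
  have : Continuous fun c : H2 E3 => dist c.2.2 d.2.2 := by fun_prop
  simpa using this.tendsto d

/-- The restriction of a curve to `[0,1]`. -/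
def ofH2 (c : H2 E3) : H2Curve where
  pos := ⟨fun t => hpos c t, (continuous_hpos_right c).comp continuous_subtype_val⟩
  vel := ⟨fun t => hvel c t, (continuous_hvel_right c).comp continuous_subtype_val⟩
  acc := accI c
  pos_eq t := by
    change hpos c t = hpos c (0 : ℝ) + ∫ s in Iic t, hvel c s
    rw [setIntegral_Iic_I]; simp [hpos]
  vel_eq t := by
    change hvel c t = hvel c (0 : ℝ) + ∫ s in Iic t, accI c s
    rw [integral_congr_ae (ae_restrict_of_ae (accI_ae c)), setIntegral_Iic_I]; simp [hvel]

theorem continuous_ofH2 : Continuous ofH2 := by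
  refine continuous_induced_rng.2 ?_
  have hp : Continuous fun c : H2 E3 => (ofH2 c).pos :=
    ContinuousMap.continuous_of_continuous_uncurry _
      (continuous_hpos.comp (f := fun x : H2 E3 × I => (x.1, (x.2 : ℝ))) (by fun_prop))
  have hv : Continuous fun c : H2 E3 => (ofH2 c).vel :=
    ContinuousMap.continuous_of_continuous_uncurry _
      (continuous_hvel.comp (f := fun x : H2 E3 × I => (x.1, (x.2 : ℝ))) (by fun_prop))
  exact ((ContinuousMap.toLp 2 volume ℝ).continuous.comp hp).prodMk
    (((ContinuousMap.toLp 2 volume ℝ).continuous.comp hv).prodMk continuous_accI)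

/-- Extension by zero; `projIcc` only turns a real number into a point of `I`. -/
def accR (h : Lp E3 2 (volume : Measure I)) : ℝ → E3 :=
  indicator (Icc 0 1) fun t => h (projIcc 0 1 zero_le_one t)

theorem measurePreserving_proj :
    MeasurePreserving (projIcc (0 : ℝ) 1 zero_le_one) (volume.restrict (Icc 0 1)) volume := by
  refine ⟨continuous_projIcc.measurable, ?_⟩
  rw [← measurePreserving_coe.map_eq, Measure.map_map continuous_projIcc.measurable
    measurable_subtype_coe]
  have : projIcc (0 : ℝ) 1 zero_le_one ∘ ((↑) : I → ℝ) = id := by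
    ext t; simp [projIcc_val]
  rw [this, Measure.map_id]

theorem memLp_accR (h : Lp E3 2 (volume : Measure I)) : MemLp (accR h) 2 volume := by
  rw [accR, memLp_indicator_iff_restrict measurableSet_Icc]
  exact (Lp.memLp h).comp_measurePreserving measurePreserving_proj

theorem continuous_lp2_accR : Continuous fun h => lp2 (accR h) := by
  have : ∀ c d : Lp E3 2 (volume : Measure I), dist (lp2 (accR c)) (lp2 (accR d)) ≤ dist c d := by
    intro c d
    rw [dist_eq_norm, dist_eq_norm, lp2_sub (memLp_accR c) (memLp_accR d),
      lp2_congr (g := accR (c - d))]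
    · refine norm_lp2_le (norm_nonneg _) (memLp_accR _) ?_
      rw [accR, eLpNorm_indicator_eq_eLpNorm_restrict measurableSet_Icc]
      have := eLpNorm_comp_measurePreserving (p := 2)
        (Lp.stronglyMeasurable (c - d)).aestronglyMeasurable measurePreserving_proj
      rw [Lp.norm_def, ENNReal.ofReal_toReal (Lp.eLpNorm_ne_top _), ← this]
      rfl
    · have := measurePreserving_proj.quasiMeasurePreserving.ae (Lp.coeFn_sub c d)
      rw [ae_restrict_iff' measurableSet_Icc] at this
      filter_upwards [this] with t ht
      by_cases hI : t ∈ Icc (0 : ℝ) 1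
      · simp only [accR, Pi.sub_apply, indicator_of_mem hI]; exact (ht hI).symm
      · simp [accR, indicator_of_notMem hI]
  exact (LipschitzWith.of_dist_le_mul (K := 1) (by simpa using this)).continuous

/-- A curve on `[0,1]` extended to the line. -/
def toH2 (c : H2Curve) : H2 E3 := (c.pos 0, c.vel 0, lp2 (accR c.acc))

theorem toH2_acc (c : H2Curve) : ∀ᵐ t : I, hacc (toH2 c) t = c.acc t := by
  have h := ae_restrict_of_ae (s := Icc (0 : ℝ) 1) (lp2_ae (memLp_accR c.acc))
  filter_upwards [measurePreserving_coe.quasiMeasurePreserving.ae h] with t ht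
  change lp2 (accR c.acc) t = _
  rw [ht, accR, indicator_of_mem t.2, projIcc_val]

theorem toH2_vel (c : H2Curve) (t : I) : hvel (toH2 c) t = c.vel t := by
  rw [c.vel_eq t, hvel, ← setIntegral_Iic_I]
  congr 1
  exact integral_congr_ae (ae_restrict_of_ae (toH2_acc c))

theorem toH2_pos (c : H2Curve) (t : I) : hpos (toH2 c) t = c.pos t := by
  rw [c.pos_eq t, hpos, ← setIntegral_Iic_I]
  congr 1
  exact integral_congr_ae (ae_of_all _ fun s => toH2_vel c s)

/-- The velocity is the derivative of the position, and the acceleration is almost everywhere that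
of the velocity. -/
theorem H2Curve.ext_pos {c d : H2Curve} (h : ∀ t, c.pos t = d.pos t) : c = d := by
  have hp : ∀ t ∈ Icc (0 : ℝ) 1, hpos (toH2 c) t = hpos (toH2 d) t := fun t ht => by
    rw [toH2_pos c ⟨t, ht⟩, toH2_pos d ⟨t, ht⟩, h]
  have hv : ∀ t ∈ Icc (0 : ℝ) 1, hvel (toH2 c) t = hvel (toH2 d) t := fun t ht =>
    (uniqueDiffOn_Icc_zero_one t ht).eq_deriv _ (hasDerivAt_hpos (toH2 c) t).hasDerivWithinAt
      ((hasDerivAt_hpos (toH2 d) t).hasDerivWithinAt.congr hp (hp t ht))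
  have ha : ∀ᵐ t : ℝ, t ∈ Icc (0 : ℝ) 1 → hacc (toH2 c) t = hacc (toH2 d) t := by
    filter_upwards [ae_hasDerivAt_hvel (toH2 c), ae_hasDerivAt_hvel (toH2 d)] with t h1 h2 ht
    exact (uniqueDiffOn_Icc_zero_one t ht).eq_deriv _ h1.hasDerivWithinAt
      (h2.hasDerivWithinAt.congr hv (hv t ht))
  have e1 : c.pos = d.pos := ContinuousMap.ext h
  have e2 : c.vel = d.vel := ContinuousMap.ext fun t => by
    rw [← toH2_vel, ← toH2_vel, hv t t.2]
  have e3 : c.acc = d.acc := Lp.ext (by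
    filter_upwards [toH2_acc c, toH2_acc d, ae_I_iff.2 ha] with t h1 h2 h3
    rw [← h1, ← h2, h3])
  cases c; cases d
  simp only at e1 e2 e3
  subst e1 e2 e3
  rfl

/-- Closed arcs with the initial and final flag and the speed `1` at both ends. -/
structure IsLoop (c : H2 E3) : Prop where
  arc : IsArc c
  start : flag c 0 = (e₁, e₂)
  finish : flag c 1 = (e₁, e₂)

theorem IsLoop.mem {c : H2 E3} (h : IsLoop c) : ofH2 c ∈ locallyConvex := by
  have h0 := h.start
  have h1 := h.finish
  simp only [flag, Prod.mk.injEq] at h0 h1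
  refine ⟨⟨fun t => h.arc.norm t t.2, fun t => h.arc.vel t t.2, h0.1, h1.1, h0.2, h1.2⟩, ?_⟩
  filter_upwards [accI_ae c, ae_I_iff.2 h.arc.det] with t h1 h2
  change 0 < det3 (hpos c t) (hvel c t) (accI c t)
  rw [h1]; exact h2

theorem toH2_isLoop (c : locallyConvex) : IsLoop (toH2 c.1) := by
  obtain ⟨c, ⟨hn, hv, h1, h2, h3, h4⟩, hd⟩ := c
  refine ⟨⟨fun t ht => ?_, fun t ht => ?_, ?_⟩, ?_, ?_⟩
  · rw [toH2_pos c ⟨t, ht⟩]; exact hn _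
  · rw [toH2_vel c ⟨t, ht⟩]; exact hv _
  · rw [← ae_I_iff]
    filter_upwards [hd, toH2_acc c] with t h1 h2
    rw [toH2_pos c t, toH2_vel c t, h2]; exact h1
  · have := toH2_pos c 0
    have h' := toH2_vel c 0
    simp only [Icc.coe_zero] at this h'
    rw [flag, this, h', h1, h3]
  · have := toH2_pos c 1
    have h' := toH2_vel c 1
    simp only [Icc.coe_one] at this h'
    rw [flag, this, h', h2, h4]

/-- The topology of `H2Curve` is given by three `L²` classes, so continuity of the values at `0`
would be a Sobolev embedding. It is taken as a hypothesis, which is trivial for curves starting at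
`e₁` with velocity `e₂`. -/
theorem continuous_toH2 {T : Type*} [TopologicalSpace T] {g : T → H2Curve} (hg : Continuous g)
    {a b : T → E3} (ha : Continuous a) (hb : Continuous b) (h1 : ∀ x, (g x).pos 0 = a x)
    (h2 : ∀ x, (g x).vel 0 = b x) : Continuous fun x => toH2 (g x) := by
  have hL : Continuous fun x => (g x).toL2 := continuous_induced_dom.comp hg
  refine (ha.congr fun x => (h1 x).symm).prodMk ((hb.congr fun x => (h2 x).symm).prodMk ?_)
  exact continuous_lp2_accR.comp hL.snd.snd

variable {T : Type*} [TopologicalSpace T]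

theorem continuous_toH2_immersions (g : C(T, immersions)) : Continuous fun x => toH2 (g x).1 :=
  continuous_toH2 (continuous_subtype_val.comp g.continuous) continuous_const continuous_const
    (fun x => (g x).2.2.2.1) fun x => (g x).2.2.2.2.2.1

theorem continuous_toH2_locallyConvex (g : C(T, locallyConvex)) :
    Continuous fun x => toH2 (g x).1 :=
  continuous_toH2_immersions (inclusion.comp g)

/-- A continuous family of closed arcs as a map to `𝓛_I`. -/
def mkMap (c : T → H2 E3) (hc : Continuous c) (h : ∀ x, IsLoop (c x)) : C(T, locallyConvex) :=
  ⟨fun x => ⟨ofH2 (c x), (h x).mem⟩, (continuous_ofH2.comp hc).subtype_mk _⟩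

theorem mkMap_pos (c : T → H2 E3) (hc : Continuous c) (h : ∀ x, IsLoop (c x)) (x : T) {t : ℝ}
    (ht : t ∈ Icc (0 : ℝ) 1) : hpos (toH2 (mkMap c hc h x).1) t = hpos (c x) t :=
  toH2_pos _ ⟨t, ht⟩

theorem locallyConvex_ext {c d : locallyConvex}
    (h : ∀ t ∈ Icc (0 : ℝ) 1, hpos (toH2 c.1) t = hpos (toH2 d.1) t) : c = d :=
  Subtype.ext (H2Curve.ext_pos fun t => by rw [← toH2_pos, ← toH2_pos, h t t.2])

end Convert

/-! ### Regularity of reparametrizations -/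

section Reparam

theorem continuousOn_of_bijOn {φ : ℝ → ℝ} (h1 : StrictMonoOn φ (Icc 0 1))
    (h2 : BijOn φ (Icc 0 1) (Icc 0 1)) : ContinuousOn φ (Icc 0 1) := by
  let f : I → I := fun t => ⟨φ t, h2.mapsTo t.2⟩
  have hf : Continuous f := by
    refine Monotone.continuous_of_surjective (fun s t hst => h1.monotoneOn s.2 t.2 hst) fun y => ?_
    obtain ⟨t, ht, hty⟩ := h2.surjOn y.2
    exact ⟨⟨t, ht⟩, Subtype.ext hty⟩
  rw [continuousOn_iff_continuous_domRestrict]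
  exact continuous_subtype_val.comp hf

theorem bijOn_zero_one {φ : ℝ → ℝ} (h1 : StrictMonoOn φ (Icc 0 1))
    (h2 : BijOn φ (Icc 0 1) (Icc 0 1)) : φ 0 = 0 ∧ φ 1 = 1 := by
  have m0 : (0 : ℝ) ∈ Icc (0 : ℝ) 1 := by simp
  have m1 : (1 : ℝ) ∈ Icc (0 : ℝ) 1 := by simp
  obtain ⟨s, hs, hs0⟩ := h2.surjOn m0
  obtain ⟨s', hs', hs1⟩ := h2.surjOn m1
  exact ⟨le_antisymm ((h1.monotoneOn m0 hs hs.1).trans hs0.le) (h2.mapsTo m0).1,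
    le_antisymm (h2.mapsTo m1).2 (hs1.ge.trans (h1.monotoneOn hs' m1 hs'.2))⟩

variable {E : Type*} [NormedAddCommGroup E] [InnerProductSpace ℝ E] [CompleteSpace E]

/-- A reparametrization between immersed curves is differentiable. -/
theorem hasDerivWithinAt_reparam {c d : H2 E}
    (hd : ∀ t ∈ Icc (0 : ℝ) 1, hvel d t ≠ 0) {φ : ℝ → ℝ} (h1 : StrictMonoOn φ (Icc 0 1))
    (h2 : BijOn φ (Icc 0 1) (Icc 0 1)) (h3 : ∀ t ∈ Icc (0 : ℝ) 1, hpos c t = hpos d (φ t))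
    {t : ℝ} (ht : t ∈ Icc (0 : ℝ) 1) :
    HasDerivWithinAt φ (‖hvel c t‖ / ‖hvel d (φ t)‖) (Icc 0 1) t := by
  set u := hvel d (φ t) with hu
  have hu0 : u ≠ 0 := hd _ (h2.mapsTo ht)
  have huu : inner ℝ u u ≠ 0 := inner_self_ne_zero.2 hu0
  -- Both curves are projected to the direction `u` of the velocity of `d`. The difference quotient
  -- of `φ` is then a quotient of two scalar difference quotients whose limits are known.
  have A : HasDerivAt (fun s => inner ℝ u (hpos d s)) (inner ℝ u u) (φ t) :=
    ((innerSL ℝ u).hasFDerivAt).comp_hasDerivAt (φ t) (hasDerivAt_hpos d (φ t))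
  have B : HasDerivWithinAt (fun s => inner ℝ u (hpos c s)) (inner ℝ u (hvel c t)) (Icc 0 1) t :=
    (((innerSL ℝ u).hasFDerivAt).comp_hasDerivAt t (hasDerivAt_hpos c t)).hasDerivWithinAt
  have hφ : Tendsto φ (𝓝[Icc 0 1 \ {t}] t) (𝓝[≠] (φ t)) := by
    refine tendsto_nhdsWithin_iff.2 ⟨((continuousOn_of_bijOn h1 h2) t ht).mono_left
      (nhdsWithin_mono _ sdiff_subset), ?_⟩
    filter_upwards [self_mem_nhdsWithin] with s hs
    exact fun h => hs.2 (h1.injOn hs.1 ht h)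
  have C : HasDerivWithinAt φ (inner ℝ u (hvel c t) / inner ℝ u u) (Icc 0 1) t := by
    rw [hasDerivWithinAt_iff_tendsto_slope] at B ⊢
    have A' := (hasDerivAt_iff_tendsto_slope.1 A).comp hφ
    refine (B.div A' huu).congr' ?_
    filter_upwards [self_mem_nhdsWithin,
      (A'.eventually_ne huu)] with s hs hne
    have hst : s - t ≠ 0 := sub_ne_zero.2 hs.2
    have hφst : φ s - φ t ≠ 0 := sub_ne_zero.2 fun h => hs.2 (h1.injOn hs.1 ht h)
    simp only [Function.comp, slope_def_field, Pi.div_apply] at hne ⊢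
    rw [h3 s hs.1, h3 t ht]
    have hne' := (div_ne_zero_iff.1 hne).1
    field_simp
  -- The chain rule makes the velocities proportional. As `φ` is increasing, the factor is
  -- nonnegative and equals the quotient of the speeds.
  have D : hvel c t = (inner ℝ u (hvel c t) / inner ℝ u u) • u := by
    refine (uniqueDiffOn_Icc_zero_one t ht).eq_deriv _
      (hasDerivAt_hpos c t).hasDerivWithinAt ?_
    have := HasDerivAt.scomp_hasDerivWithinAt t (hasDerivAt_hpos d (φ t)) C
    exact this.congr h3 (h3 t ht)
  have hnn : 0 ≤ inner ℝ u (hvel c t) / inner ℝ u u := by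
    rw [← C.derivWithin (uniqueDiffOn_Icc_zero_one t ht)]
    exact h1.monotoneOn.derivWithin_nonneg
  convert C using 1
  conv_lhs => rw [D]
  rw [norm_smul, Real.norm_of_nonneg hnn, mul_div_cancel_right₀ _ (norm_ne_zero_iff.2 hu0)]

/-- By the formula for `φ'` both lengths have the same derivative in `t`. Thus `φ` is determined by
arc lengths, which depend continuously on the curves. -/
theorem length_reparam {c d : H2 E}
    (hd : ∀ t ∈ Icc (0 : ℝ) 1, hvel d t ≠ 0) {φ : ℝ → ℝ} (h1 : StrictMonoOn φ (Icc 0 1))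
    (h2 : BijOn φ (Icc 0 1) (Icc 0 1)) (h3 : ∀ t ∈ Icc (0 : ℝ) 1, hpos c t = hpos d (φ t))
    {t : ℝ} (ht : t ∈ Icc (0 : ℝ) 1) :
    ∫ s in (0 : ℝ)..(φ t), ‖hvel d s‖ = ∫ s in (0 : ℝ)..t, ‖hvel c s‖ := by
  have key : ∀ s ∈ Icc (0 : ℝ) 1, HasDerivWithinAt (fun s =>
      (∫ r in (0 : ℝ)..(φ s), ‖hvel d r‖) - ∫ r in (0 : ℝ)..s, ‖hvel c r‖) 0 (Icc 0 1) s := by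
    intro s hs
    have A := ((continuous_hvel_right d).norm.integral_hasStrictDerivAt 0 (φ s)).hasDerivAt
    have B := ((continuous_hvel_right c).norm.integral_hasStrictDerivAt 0 s).hasDerivAt
    have C := A.comp_hasDerivWithinAt s (hasDerivWithinAt_reparam hd h1 h2 h3 hs)
    refine (C.sub B.hasDerivWithinAt).congr_deriv ?_
    rw [mul_div_cancel₀ _ (norm_ne_zero_iff.2 (hd _ (h2.mapsTo hs))), sub_self]
  have := (convex_Icc (0 : ℝ) 1).norm_image_sub_le_of_norm_hasDerivWithin_le (C := 0) key
    (fun s _ => by simp) (show (0 : ℝ) ∈ Icc (0 : ℝ) 1 by simp) ht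
  rw [zero_mul, norm_le_zero_iff, (bijOn_zero_one h1 h2).1] at this
  simp only [intervalIntegral.integral_same, sub_self, sub_zero] at this
  exact sub_eq_zero.1 this

variable {T : Type*} [TopologicalSpace T]

/-- The maps `φ x` are given one by one, without any continuity in `x`. It follows from
`length_reparam`: near `x₀` the speed of `d` is bounded below, so closeness of arc lengths gives
closeness of the parameters. -/
theorem continuous_reparam {c d : T → H2 E} (hcc : Continuous c) (hdc : Continuous d)
    (hd : ∀ x, ∀ t ∈ Icc (0 : ℝ) 1, hvel (d x) t ≠ 0) {φ : T → ℝ → ℝ}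
    (h1 : ∀ x, StrictMonoOn (φ x) (Icc 0 1)) (h2 : ∀ x, BijOn (φ x) (Icc 0 1) (Icc 0 1))
    (h3 : ∀ x, ∀ t ∈ Icc (0 : ℝ) 1, hpos (c x) t = hpos (d x) (φ x t)) :
    Continuous fun y : T × I => φ y.1 y.2 := by
  have len : ∀ {e : T → H2 E}, Continuous e →
      Continuous fun y : T × ℝ => ∫ s in (0 : ℝ)..y.2, ‖hvel (e y.1) s‖ := fun {e} he =>
    intervalIntegral.continuous_parametric_intervalIntegral_of_continuous
      (f := fun (y : T × ℝ) s => ‖hvel (e y.1) s‖) (μ := volume)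
      (Continuous.hvel (he.comp (continuous_fst.comp continuous_fst)) continuous_snd).norm
      continuous_snd
  rw [continuous_iff_continuousAt]
  rintro ⟨x₀, t₀⟩
  set s₀ := φ x₀ t₀ with hs₀
  have hs₀m : s₀ ∈ Icc (0 : ℝ) 1 := (h2 x₀).mapsTo t₀.2
  obtain ⟨r, hr, hmin⟩ := isCompact_Icc.exists_isMinOn (nonempty_Icc.2 zero_le_one)
    (continuous_hvel_right (d x₀)).norm.continuousOn (s := Icc (0 : ℝ) 1)
  set m := ‖hvel (d x₀) r‖ with hm
  have hm0 : 0 < m := norm_pos_iff.2 (hd x₀ r hr)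
  have e1 : ∀ᶠ x in 𝓝 x₀, ∀ t ∈ Icc (0 : ℝ) 1, -‖hvel (d x) t‖ < -(m / 2) :=
    eventually_forall_Icc (u := fun x t => -‖hvel (d x) t‖)
      (Continuous.hvel (hdc.comp continuous_fst) continuous_snd).norm.neg.continuousOn
      fun t ht => by
        have : m ≤ ‖hvel (d x₀) t‖ := hmin ht
        linarith
  rw [ContinuousAt, tendsto_iff_dist_tendsto_zero]
  have hlim : Tendsto (fun y : T × I => (m / 2)⁻¹ * |(∫ s in (0 : ℝ)..y.2, ‖hvel (c y.1) s‖) -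
      ∫ s in (0 : ℝ)..s₀, ‖hvel (d y.1) s‖|) (𝓝 (x₀, t₀)) (𝓝 0) := by
    have hcont : Continuous fun y : T × I => (m / 2)⁻¹ * |(∫ s in (0 : ℝ)..y.2, ‖hvel (c y.1) s‖) -
      ∫ s in (0 : ℝ)..s₀, ‖hvel (d y.1) s‖| := by
      refine continuous_const.mul (Continuous.abs (Continuous.sub ?_ ?_))
      · exact (len hcc).comp (f := fun y : T × I => (y.1, (y.2 : ℝ))) (by fun_prop)
      · exact (len hdc).comp (f := fun y : T × I => (y.1, s₀)) (by fun_prop)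
    have := hcont.tendsto (x₀, t₀)
    rwa [← length_reparam (hd x₀) (h1 x₀) (h2 x₀) (h3 x₀) t₀.2, ← hs₀, sub_self, abs_zero,
      mul_zero] at this
  refine squeeze_zero' (Eventually.of_forall fun _ => dist_nonneg) ?_ hlim
  filter_upwards [continuous_fst.continuousAt.eventually e1] with y hy
  have ii : ∀ a b, IntervalIntegrable (fun s => ‖hvel (d y.1) s‖) volume a b := fun a b =>
    (continuous_hvel_right _).norm.intervalIntegrable _ _
  have hym : φ y.1 y.2 ∈ Icc (0 : ℝ) 1 := (h2 y.1).mapsTo y.2.2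
  rw [← length_reparam (hd y.1) (h1 y.1) (h2 y.1) (h3 y.1) y.2.2,
    intervalIntegral.integral_interval_sub_left (ii _ _) (ii _ _), Real.dist_eq,
    inv_mul_eq_div, le_div_iff₀ (by positivity)]
  have key : ∀ a b : ℝ, a ∈ Icc (0 : ℝ) 1 → b ∈ Icc (0 : ℝ) 1 → a ≤ b →
      (b - a) * (m / 2) ≤ ∫ s in a..b, ‖hvel (d y.1) s‖ := by
    intro a b ha hb hab
    have := intervalIntegral.integral_mono_on (μ := volume) hab (f := fun _ => m / 2)
      (g := fun s => ‖hvel (d y.1) s‖) intervalIntegrable_const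
      (ii _ _)
      fun s hs => (neg_lt_neg_iff.1 (hy s ⟨ha.1.trans hs.1, hs.2.trans hb.2⟩)).le
    rwa [intervalIntegral.integral_const, smul_eq_mul] at this
  rcases le_total s₀ (φ y.1 y.2) with h | h
  · rw [abs_of_nonneg (sub_nonneg.2 h)]
    exact (key _ _ hs₀m hym h).trans (le_abs_self _)
  · rw [abs_sub_comm, abs_of_nonneg (sub_nonneg.2 h), intervalIntegral.integral_symm, abs_neg]
    exact (key _ _ hym hs₀m h).trans (le_abs_self _)

/-- The reparametrization `Φ` as an `H²` function. -/
def hrep (c d : H2 E) (Φ : ℝ → ℝ) : H2 ℝ :=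
  (0, ‖hvel c 0‖ * ‖hvel d (Φ 0)‖⁻¹,
    lp2 (opFun 0 1 (fun t => (‖hvel c t‖⁻¹ * ‖hvel d (Φ t)‖⁻¹) • innerSL ℝ (hvel c t))
      (fun t => t) (hacc c)) +
    lp2 (opFun 0 1 (fun t => (-(‖hvel c t‖ ^ 2 * ‖hvel d (Φ t)‖⁻¹ ^ 4)) • innerSL ℝ (hvel d (Φ t)))
      Φ (hacc d)))

theorem continuous_hrep {c d : T → H2 E} (hcc : Continuous c) (hdc : Continuous d)
    (hc : ∀ x, ∀ t ∈ Icc (0 : ℝ) 1, hvel (c x) t ≠ 0)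
    (hd : ∀ x, ∀ t ∈ Icc (0 : ℝ) 1, hvel (d x) t ≠ 0) {Φ : T → ℝ → ℝ}
    (hΦ : Continuous (Function.uncurry Φ)) (hm : ∀ x, MapsTo (Φ x) (Icc 0 1) (Icc 0 1))
    (hΦd : ∀ x, ∀ t ∈ Icc (0 : ℝ) 1, HasDerivWithinAt (Φ x)
      (‖hvel (c x) t‖ * ‖hvel (d x) (Φ x t)‖⁻¹) (Icc 0 1) t) :
    Continuous fun x => hrep (c x) (d x) (Φ x) := by
  have cv : Continuous fun y : T × ℝ => hvel (c y.1) y.2 :=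
    Continuous.hvel (hcc.comp continuous_fst) continuous_snd
  have dv : Continuous fun y : T × ℝ => hvel (d y.1) (Φ y.1 y.2) :=
    Continuous.hvel (hdc.comp continuous_fst) hΦ
  have cn : ContinuousOn (fun y : T × ℝ => ‖hvel (c y.1) y.2‖⁻¹) (univ ×ˢ Icc 0 1) :=
    cv.norm.continuousOn.inv₀ fun y hy => norm_ne_zero_iff.2 (hc _ _ hy.2)
  have dn : ContinuousOn (fun y : T × ℝ => ‖hvel (d y.1) (Φ y.1 y.2)‖⁻¹) (univ ×ˢ Icc 0 1) :=
    dv.norm.continuousOn.inv₀ fun y hy => norm_ne_zero_iff.2 (hd _ _ (hm _ hy.2))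
  refine continuous_const.prodMk (Continuous.prodMk ?_ (Continuous.add ?_ ?_))
  · refine (Continuous.hvel hcc continuous_const).norm.mul (Continuous.inv₀
      (dv.comp (f := fun x => (x, (0 : ℝ))) (by fun_prop)).norm fun x =>
      norm_ne_zero_iff.2 (hd _ _ (hm _ (by simp))))
  · exact continuous_lp2_opFun (a := fun _ => 0) (b := fun _ => 1) (ψ := fun _ t => t)
      (ψ1 := fun _ _ => 1) continuous_const continuous_const (fun _ => le_rfl) (fun _ => le_rfl)
      ((cn.mul dn).smul ((innerSL ℝ).continuous.comp cv).continuousOn) continuous_snd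
      continuousOn_const (fun x t _ => hasDerivWithinAt_id t _) (fun _ _ _ => one_pos) hcc.snd.snd
  · exact continuous_lp2_opFun (a := fun _ => 0) (b := fun _ => 1) (ψ := Φ)
      (ψ1 := fun x t => ‖hvel (c x) t‖ * ‖hvel (d x) (Φ x t)‖⁻¹)
      continuous_const continuous_const (fun _ => le_rfl) (fun _ => le_rfl)
      (((cv.norm.continuousOn.pow 2).mul (dn.pow 4)).neg.smul
        ((innerSL ℝ).continuous.comp dv).continuousOn) hΦ
      (cv.norm.continuousOn.mul dn) hΦd (fun x t ht => mul_pos (norm_pos_iff.2 (hc x t ht))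
        (inv_pos.2 (norm_pos_iff.2 (hd _ _ (hm _ ht))))) hdc.snd.snd

/-- The derivative `‖c'‖ / ‖d' ∘ Φ‖` is absolutely continuous because `Φ` is Lipschitz and strictly
increasing. Differentiating this quotient gives the two terms in `hrep`, so `Φ` is itself of class
`H²`. -/
theorem hrep_spec {c d : H2 E} (hc : ∀ t ∈ Icc (0 : ℝ) 1, hvel c t ≠ 0)
    (hd : ∀ t ∈ Icc (0 : ℝ) 1, hvel d t ≠ 0) {Φ : ℝ → ℝ}
    (hΦ : Continuous Φ) (hm : MapsTo Φ (Icc 0 1) (Icc 0 1)) (h0 : Φ 0 = 0)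
    (hmono : StrictMonoOn Φ (Icc 0 1))
    (hΦd : ∀ t ∈ Icc (0 : ℝ) 1, HasDerivWithinAt Φ (‖hvel c t‖ * ‖hvel d (Φ t)‖⁻¹) (Icc 0 1) t) :
    (∀ t ∈ Icc (0 : ℝ) 1, hvel (hrep c d Φ) t = ‖hvel c t‖ * ‖hvel d (Φ t)‖⁻¹) ∧
      ∀ t ∈ Icc (0 : ℝ) 1, hpos (hrep c d Φ) t = Φ t := by
  have hI : uIcc (0 : ℝ) 1 = Icc 0 1 := uIcc_of_le zero_le_one
  have cv := continuous_hvel_right c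
  have dv : Continuous fun t => hvel d (Φ t) := (continuous_hvel_right d).comp hΦ
  have cn : ContinuousOn (fun t => ‖hvel c t‖⁻¹) (Icc 0 1) :=
    cv.norm.continuousOn.inv₀ fun t ht => norm_ne_zero_iff.2 (hc _ ht)
  have dn : ContinuousOn (fun t => ‖hvel d (Φ t)‖⁻¹) (Icc 0 1) :=
    dv.norm.continuousOn.inv₀ fun t ht => norm_ne_zero_iff.2 (hd _ (hm ht))
  have ψc : ContinuousOn (fun t => ‖hvel c t‖ * ‖hvel d (Φ t)‖⁻¹) (Icc 0 1) :=
    cv.norm.continuousOn.mul dn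
  have ψpos : ∀ t ∈ Icc (0 : ℝ) 1, 0 < ‖hvel c t‖ * ‖hvel d (Φ t)‖⁻¹ := fun t ht =>
    mul_pos (norm_pos_iff.2 (hc t ht)) (inv_pos.2 (norm_pos_iff.2 (hd _ (hm ht))))
  refine hvel_hpos_mk (p := Φ) (v := fun t => ‖hvel c t‖ * ‖hvel d (Φ t)‖⁻¹)
    (h := (hrep c d Φ).2.2) hΦd ?_ ?_ (by simp only [hrep, h0])
  · have acΦ : AbsolutelyContinuousOnInterval Φ 0 1 := by
      obtain ⟨C, hC⟩ := isCompact_Icc.exists_bound_of_continuousOn ψc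
      have : LipschitzOnWith C.toNNReal Φ (Icc 0 1) :=
        (convex_Icc 0 1).lipschitzOnWith_of_nnnorm_hasDerivWithin_le hΦd fun t ht => by
          rw [← NNReal.coe_le_coe, coe_nnnorm]
          exact (hC t ht).trans (Real.le_coe_toNNReal C)
      rw [← hI] at this
      exact this.absolutelyContinuousOnInterval
    have acd : AbsolutelyContinuousOnInterval (hvel d ∘ Φ) 0 1 :=
      ac_comp (ac_hvel d _ _) zero_le_one acΦ hmono
    exact (ac_norm (ac_hvel c 0 1)).mul (ac_inv (ac_norm acd) fun t ht => by
      rw [hI] at ht; exact norm_ne_zero_iff.2 (hd _ (hm ht)))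
  · have m1 : MemLp (opFun 0 1 (fun t => (‖hvel c t‖⁻¹ * ‖hvel d (Φ t)‖⁻¹) • innerSL ℝ (hvel c t))
      (fun t => t) (hacc c)) 2 volume :=
      memLp_opFun (ψ1 := fun _ => 1) le_rfl le_rfl
        ((cn.mul dn).smul ((innerSL ℝ).continuous.comp cv).continuousOn) continuous_id
        continuousOn_const (fun t _ => hasDerivWithinAt_id t _) (fun _ _ => one_pos) c.2.2
    have m2 : MemLp (opFun 0 1 (fun t => (-(‖hvel c t‖ ^ 2 * ‖hvel d (Φ t)‖⁻¹ ^ 4)) •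
      innerSL ℝ (hvel d (Φ t))) Φ (hacc d)) 2 volume :=
      memLp_opFun le_rfl le_rfl (((cv.norm.continuousOn.pow 2).mul (dn.pow 4)).neg.smul
        ((innerSL ℝ).continuous.comp dv).continuousOn) hΦ ψc hΦd ψpos d.2.2
    obtain ⟨s, hs, hmin⟩ := isCompact_Icc.exists_isMinOn (nonempty_Icc.2 zero_le_one) ψc
    have hae := ae_comp_of_deriv_pos (ψpos s hs) hΦ hΦd (fun t ht => hmin ht)
      (ae_hasDerivAt_hvel d)
    filter_upwards [Lp.coeFn_add (lp2 (opFun 0 1 (fun t => (‖hvel c t‖⁻¹ * ‖hvel d (Φ t)‖⁻¹) •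
      innerSL ℝ (hvel c t)) (fun t => t) (hacc c))) (lp2 (opFun 0 1 (fun t => (-(‖hvel c t‖ ^ 2 *
      ‖hvel d (Φ t)‖⁻¹ ^ 4)) • innerSL ℝ (hvel d (Φ t))) Φ (hacc d))), lp2_ae m1, lp2_ae m2,
      ae_ne 0, ae_ne 1, hae, ae_hasDerivAt_hvel c] with t h1 h2 h3 h4 h5 h6 h7 ht
    have hI' : t ∈ Ioc (0 : ℝ) 1 := ⟨lt_of_le_of_ne ht.1 (Ne.symm h4), ht.2⟩
    have hn : ‖hvel c t‖ ≠ 0 := norm_ne_zero_iff.2 (hc t ht)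
    have hΦt : HasDerivAt Φ (‖hvel c t‖ * ‖hvel d (Φ t)‖⁻¹) t :=
      (hΦd t ht).hasDerivAt (Icc_mem_nhds hI'.1 (lt_of_le_of_ne ht.2 h5))
    have k1 : HasDerivAt (fun t => ‖hvel c t‖) (‖hvel c t‖⁻¹ * inner ℝ (hvel c t) (hacc c t)) t := by
      have := (h7.norm_sq).sqrt (by positivity)
      simp only [Real.sqrt_sq (norm_nonneg _)] at this
      refine this.congr_deriv ?_
      field_simp
    have k2 := hasDerivAt_norm_inv (HasDerivAt.scomp t (h6 ht) hΦt) (hd _ (hm ht))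
    have k3 := k1.mul k2
    change HasDerivAt (fun t => ‖hvel c t‖ * ‖hvel d (Φ t)‖⁻¹) ((_ + _ : Lp ℝ 2 (volume : Measure ℝ)) t) t
    rw [h1, Pi.add_apply, h2, h3, opFun, opFun, indicator_of_mem hI', indicator_of_mem hI']
    refine k3.congr_deriv ?_
    simp only [rinv1, smul_apply, innerSL_apply_apply, Function.comp, inner_smul_right, smul_eq_mul]
    ring

end Reparam

/-! ### Independence of the parametrization up to homotopy -/

section Homotopy

theorem hvel_combo {E : Type*} [NormedAddCommGroup E] [NormedSpace ℝ E] (a b : ℝ) (c d : H2 E)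
    (t : ℝ) : hvel (a • c + b • d) t = a • hvel c t + b • hvel d t := by
  have h : ∫ s in (0 : ℝ)..t, hacc (a • c + b • d) s =
      ∫ s in (0 : ℝ)..t, (a • hacc c s + b • hacc d s) := by
    refine intervalIntegral.integral_congr_ae ?_
    filter_upwards [Lp.coeFn_add (a • c.2.2) (b • d.2.2), Lp.coeFn_smul a c.2.2,
      Lp.coeFn_smul b d.2.2] with s h1 h2 h3 _
    change (a • c.2.2 + b • d.2.2 : Lp E 2 (volume : Measure ℝ)) s = _
    rw [h1, Pi.add_apply, h2, h3]; rfl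
  have i1 : IntervalIntegrable (fun s => a • hacc c s) volume 0 t :=
    (intervalIntegrable_lp c.2.2 0 t).smul a
  have i2 : IntervalIntegrable (fun s => b • hacc d s) volume 0 t :=
    (intervalIntegrable_lp d.2.2 0 t).smul b
  rw [hvel, h, intervalIntegral.integral_add i1 i2, intervalIntegral.integral_smul,
    intervalIntegral.integral_smul, hvel, hvel, smul_add, smul_add]
  change a • c.2.1 + b • d.2.1 + _ = _
  abel

theorem hpos_combo {E : Type*} [NormedAddCommGroup E] [NormedSpace ℝ E] (a b : ℝ) (c d : H2 E)
    (t : ℝ) : hpos (a • c + b • d) t = a • hpos c t + b • hpos d t := by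
  have i1 : IntervalIntegrable (fun s => a • hvel c s) volume 0 t :=
    ((continuous_hvel_right c).const_smul a).intervalIntegrable _ _
  have i2 : IntervalIntegrable (fun s => b • hvel d s) volume 0 t :=
    ((continuous_hvel_right d).const_smul b).intervalIntegrable _ _
  simp only [hpos, hvel_combo]
  rw [intervalIntegral.integral_add i1 i2, intervalIntegral.integral_smul,
    intervalIntegral.integral_smul, smul_add, smul_add]
  change a • c.1 + b • d.1 + _ = _
  abel

/-- Families of curves that differ by reparametrizations are homotopic. -/
theorem homotopic_of_rep {K : Type*} [TopologicalSpace K] (g g' : C(K, locallyConvex))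
    (h : ∀ p, Rep (hpos (toH2 (g p).1)) (hpos (toH2 (g' p).1))) : g.Homotopic g' := by
  choose φ hφ1 hφ2 hφ3 using h
  have hcc := continuous_toH2_locallyConvex g
  have hdc := continuous_toH2_locallyConvex g'
  have lc := fun p => toH2_isLoop (g p)
  have ld := fun p => toH2_isLoop (g' p)
  have hc := fun p => (lc p).arc.vel
  have hd := fun p => (ld p).arc.vel
  set Φ : K → ℝ → ℝ := fun p t => φ p (projIcc 0 1 zero_le_one t) with hΦ
  have Φeq : ∀ p, EqOn (Φ p) (φ p) (Icc 0 1) := fun p t ht => by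
    rw [hΦ]; simp only [projIcc_of_mem zero_le_one ht]
  have Φc : Continuous (Function.uncurry Φ) :=
    (continuous_reparam hcc hdc hd hφ1 hφ2 hφ3).comp
      (f := fun y : K × ℝ => (y.1, projIcc (0 : ℝ) 1 zero_le_one y.2))
      (continuous_fst.prodMk (continuous_projIcc.comp continuous_snd))
  have Φm : ∀ p, MapsTo (Φ p) (Icc 0 1) (Icc 0 1) := fun p t ht => by
    rw [Φeq p ht]; exact (hφ2 p).mapsTo ht
  have Φ0 : ∀ p, Φ p 0 = 0 := fun p => by
    rw [Φeq p (by simp)]; exact (bijOn_zero_one (hφ1 p) (hφ2 p)).1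
  have Φ1 : ∀ p, Φ p 1 = 1 := fun p => by
    rw [Φeq p (by simp)]; exact (bijOn_zero_one (hφ1 p) (hφ2 p)).2
  have Φd : ∀ p, ∀ t ∈ Icc (0 : ℝ) 1, HasDerivWithinAt (Φ p)
      (‖hvel (toH2 (g p).1) t‖ * ‖hvel (toH2 (g' p).1) (Φ p t)‖⁻¹) (Icc 0 1) t := fun p t ht => by
    rw [← div_eq_mul_inv, Φeq p ht]
    exact (hasDerivWithinAt_reparam (hd p) (hφ1 p) (hφ2 p) (hφ3 p) ht).congr (Φeq p) (Φeq p ht)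
  have spec := fun p => hrep_spec (Φ := Φ p) (hc p) (hd p) (Φc.comp (Continuous.prodMk_right p)) (Φm p) (Φ0 p)
    ((hφ1 p).congr (Φeq p).symm) (Φd p)
  set Ψ : K → H2 ℝ := fun p => hrep (toH2 (g p).1) (toH2 (g' p).1) (Φ p)
  have Ψc : Continuous Ψ := continuous_hrep hcc hdc hc hd Φc Φm Φd
  -- Increasing functions with positive derivative form a convex set. Hence `g' ∘ χ` with `χ = s ·
  -- id + (1 - s) · Φ` joins `g = g' ∘ Φ` to `g'`.
  set χ : I × K → H2 ℝ := fun x => (x.1 : ℝ) • haff 0 1 + (1 - (x.1 : ℝ)) • Ψ x.2 with hχ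
  have χv : ∀ x : I × K, ∀ t ∈ Icc (0 : ℝ) 1, hvel (χ x) t =
      x.1 + (1 - x.1) * (‖hvel (toH2 (g x.2).1) t‖ * ‖hvel (toH2 (g' x.2).1) (Φ x.2 t)‖⁻¹) :=
    fun x t ht => by
      rw [hχ, hvel_combo, haff_vel, (spec x.2).1 t ht]; simp
  have χp : ∀ x : I × K, ∀ t ∈ Icc (0 : ℝ) 1, hpos (χ x) t = x.1 * t + (1 - x.1) * Φ x.2 t :=
    fun x t ht => by
      rw [hχ, hpos_combo, haff_pos, (spec x.2).2 t ht]; simp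
  have χpos : ∀ x, ∀ t ∈ Icc (0 : ℝ) 1, 0 < hvel (χ x) t := by
    intro x t ht
    rw [χv x t ht]
    have k1 : 0 < ‖hvel (toH2 (g x.2).1) t‖ * ‖hvel (toH2 (g' x.2).1) (Φ x.2 t)‖⁻¹ :=
      mul_pos (norm_pos_iff.2 (hc x.2 t ht)) (inv_pos.2 (norm_pos_iff.2 (hd _ _ (Φm _ ht))))
    rcases x.1.2.1.eq_or_lt with h0 | h0
    · rw [← h0]; simpa using k1
    · have := mul_nonneg (sub_nonneg.2 x.1.2.2) k1.le
      linarith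
  have χc : Continuous χ := ((continuous_subtype_val.comp continuous_fst).smul continuous_const).add
      ((continuous_const.sub (continuous_subtype_val.comp continuous_fst)).smul
        (Ψc.comp continuous_snd))
  have m0 : (0 : ℝ) ∈ Icc (0 : ℝ) 1 := by simp
  have m1 : (1 : ℝ) ∈ Icc (0 : ℝ) 1 := by simp
  have χ0 : ∀ x, hpos (χ x) 0 = 0 := fun x => by rw [χp x 0 m0, Φ0]; ring
  have χ1 : ∀ x, hpos (χ x) 1 = 1 := fun x => by rw [χp x 1 m1, Φ1]; ring
  have loop : ∀ x : I × K, IsLoop (hcomp (toH2 (g' x.2).1) (χ x)) := by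
    intro x
    have sp := hcomp_spec (toH2 (g' x.2).1) (χpos x)
    -- At the ends both curves have velocity `e₂`, so `Φ' = 1` there. Every `χ` then has derivative
    -- `1` at the ends and the velocity `e₂` is kept.
    have fin : ∀ t ∈ Icc (0 : ℝ) 1, flag (toH2 (g x.2).1) t = (e₁, e₂) →
        flag (toH2 (g' x.2).1) t = (e₁, e₂) → Φ x.2 t = t →
        flag (hcomp (toH2 (g' x.2).1) (χ x)) t = (e₁, e₂) := by
      intro t ht f1 f2 hΦt
      simp only [flag, Prod.mk.injEq] at f1 f2 ⊢
      have hχt : hpos (χ x) t = t := by rw [χp x t ht, hΦt]; ring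
      have hn : ‖e₂‖ = 1 := by simp [e₂, EuclideanSpace.norm_eq, Fin.sum_univ_three]
      rw [sp.1 t ht, sp.2 t ht, hχt, χv x t ht, hΦt, f1.2, f2.2, f2.1, hn]
      simp
    refine ⟨isArcOn_hcomp subset_rfl (χpos x) (fun t ht => ?_) (ld x.2).arc, ?_, ?_⟩
    · have mo := (strictMonoOn_hpos (χpos x)).monotoneOn
      exact ⟨(χ0 x).ge.trans (mo m0 ht ht.1), (mo ht m1 ht.2).trans (χ1 x).le⟩
    · exact fin 0 m0 (lc _).start (ld _).start (Φ0 _)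
    · exact fin 1 m1 (lc _).finish (ld _).finish (Φ1 _)
  have Hc : Continuous fun x : I × K => hcomp (toH2 (g' x.2).1) (χ x) :=
    continuous_hcomp (hdc.comp continuous_snd) χc χpos
  refine ⟨⟨mkMap _ Hc loop, fun p => ?_, fun p => ?_⟩⟩
  · refine locallyConvex_ext fun t ht => ?_
    refine (mkMap_pos _ Hc loop (0, p) ht).trans ?_
    rw [(hcomp_spec _ (χpos (0, p))).2 t ht, χp _ t ht, hφ3 p t ht, ← Φeq p ht]
    simp
  · refine locallyConvex_ext fun t ht => ?_
    refine (mkMap_pos _ Hc loop (1, p) ht).trans ?_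
    rw [(hcomp_spec _ (χpos (1, p))).2 t ht, χp _ t ht]
    simp

end Homotopy

/-! ### Projective transformations of arcs -/

section Linear

/-- The linear map of `ℝ³` given by a matrix. -/
def mv (A : Matrix (Fin 3) (Fin 3) ℝ) : E3 →L[ℝ] E3 := Matrix.toEuclideanCLM (𝕜 := ℝ) A

theorem mv_apply (A : Matrix (Fin 3) (Fin 3) ℝ) (x : E3) (i : Fin 3) :
    mv A x i = A i 0 * x 0 + A i 1 * x 1 + A i 2 * x 2 := by
  have : mv A x i = (A.mulVec x.ofLp) i := by
    rw [mv, ← Matrix.ofLp_toEuclideanCLM]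
  rw [this, Matrix.mulVec, dotProduct, Fin.sum_univ_three]

theorem mv_mul (A B : Matrix (Fin 3) (Fin 3) ℝ) (x : E3) : mv (A * B) x = mv A (mv B x) := by
  rw [mv, map_mul]; rfl

theorem mv_one (x : E3) : mv 1 x = x := by
  rw [mv, map_one]; rfl

theorem continuous_mv : Continuous mv :=
  LinearMap.continuous_of_finiteDimensional
    ((Matrix.toEuclideanCLM (n := Fin 3) (𝕜 := ℝ)).toAlgEquiv.toLinearMap)

theorem mv_injective {A : Matrix (Fin 3) (Fin 3) ℝ} (h : 0 < A.det) {x : E3} (hx : mv A x = 0) :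
    x = 0 := by
  have h1 : A⁻¹ * A = 1 := Matrix.nonsing_inv_mul A (isUnit_iff_ne_zero.2 h.ne')
  rw [← mv_one x, ← h1, mv_mul, hx, map_zero]

theorem det3_mv (A : Matrix (Fin 3) (Fin 3) ℝ) (u v w : E3) :
    det3 (mv A u) (mv A v) (mv A w) = A.det * det3 u v w := by
  simp only [det3_eq, mv_apply, Matrix.det_fin_three]
  ring

/-- The image of a flag under a linear map. -/
def mapFlag (A : Matrix (Fin 3) (Fin 3) ℝ) (f : E3 × E3) : E3 × E3 := (mv A f.1, mv A f.2)

theorem SameFlag.map {f g : E3 × E3} (h : SameFlag f g) (A : Matrix (Fin 3) (Fin 3) ℝ) :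
    SameFlag (mapFlag A f) (mapFlag A g) := by
  obtain ⟨l, m, k, hl, hm, e1, e2⟩ := h
  exact ⟨l, m, k, hl, hm, by simp [mapFlag, e1], by simp [mapFlag, e2]⟩

theorem mapFlag_mul (A B : Matrix (Fin 3) (Fin 3) ℝ) (f : E3 × E3) :
    mapFlag (A * B) f = mapFlag A (mapFlag B f) := by
  simp only [mapFlag, mv_mul]

theorem mapFlag_one (f : E3 × E3) : mapFlag 1 f = f := by
  simp only [mapFlag, mv_one]

/-- The standard flag. -/
def stdFlag : E3 × E3 := (e₁, e₂)

/-- The image of a spherical curve under the projective transformation given by a matrix. -/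
def hproj (A : Matrix (Fin 3) (Fin 3) ℝ) (c : H2 E3) : H2 E3 := hnormalize (hmap (mv A) c)

variable {A : Matrix (Fin 3) (Fin 3) ℝ} {c : H2 E3}

theorem isArc_inner_ne {c : H2 E3} (hc : IsArc c) {t : ℝ} (ht : t ∈ Icc (0 : ℝ) 1) (k : ℝ) :
    hvel c t ≠ k • hpos c t := by
  intro h
  have h1 := hc.inner_eq_zero ht
  rw [h, inner_smul_right, real_inner_self_eq_norm_sq, hc.norm t ht] at h1
  have hk : k = 0 := by linarith
  rw [hk, zero_smul] at h
  exact hc.vel t ht h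

/-- `det3` is multiplied by `A.det > 0`, and an injective linear map keeps position and velocity
independent. -/
theorem isPreArc_hmap (hA : 0 < A.det) (hc : IsArc c) : IsPreArc (hmap (mv A) c) := by
  obtain ⟨ev, ep⟩ := hmap_spec (mv A) c
  refine ⟨fun t ht h0 => ?_, fun t ht k h0 => ?_, ?_⟩
  · rw [ep t ht] at h0
    have := hc.norm t ht
    rw [mv_injective hA h0, norm_zero] at this
    exact zero_ne_one this
  · rw [ep t ht, ev t ht, ← map_smul, ← sub_eq_zero, ← map_sub] at h0
    exact isArc_inner_ne hc ht k (sub_eq_zero.1 (mv_injective hA h0))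
  · filter_upwards [hmap_acc (mv A) c, hc.det] with t h1 h2 ht
    rw [ep t ht, ev t ht, h1 ht, det3_mv]
    exact mul_pos hA (h2 ht)

theorem hproj_spec (hA : 0 < A.det) (hc : IsArc c) : IsArc (hproj A c) ∧
    (∀ t ∈ Icc (0 : ℝ) 1, SameFlag (mapFlag A (flag c t)) (flag (hproj A c) t)) ∧
    ∀ t ∈ Icc (0 : ℝ) 1, hpos (hproj A c) t = ‖mv A (hpos c t)‖⁻¹ • mv A (hpos c t) := by
  have h := isPreArc_hmap hA hc
  obtain ⟨ev, ep⟩ := hmap_spec (mv A) c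
  refine ⟨isArc_hnormalize h, fun t ht => ?_, fun t ht => ?_⟩
  · have := sameFlag_hnormalize h.pos ht
    simp only [flag] at this ⊢
    rwa [ev t ht, ep t ht] at this
  · rw [hproj, (hnormalize_spec h.pos).2 t ht, ep t ht]

theorem continuous_hproj {T : Type*} [TopologicalSpace T] {A : T → Matrix (Fin 3) (Fin 3) ℝ}
    (hA : Continuous A) (hA0 : ∀ x, 0 < (A x).det) {c : T → H2 E3} (hc : Continuous c)
    (hc' : ∀ x, IsArc (c x)) : Continuous fun x => hproj (A x) (c x) :=
  continuous_hnormalize (continuous_hmap (continuous_mv.comp hA) hc)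
    fun x => (isPreArc_hmap (hA0 x) (hc' x)).pos

end Linear

/-! ### Circles through `e₁` and the rotations about their axes -/

section Circles

/-- The point of the circle through `e₁` with axis `(sin φ, 0, cos φ)`, at the angle `x`
from `e₁`. -/
def cpt (φ x : ℝ) : E3 :=
  !₂[Real.sin φ ^ 2, 0, Real.sin φ * Real.cos φ] +
    (Real.cos x • !₂[Real.cos φ ^ 2, 0, -(Real.sin φ * Real.cos φ)] +
      Real.sin x • !₂[0, Real.cos φ, 0])

def cpt1 (φ x : ℝ) : E3 :=
  -Real.sin x • !₂[Real.cos φ ^ 2, 0, -(Real.sin φ * Real.cos φ)] +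
    Real.cos x • !₂[0, Real.cos φ, 0]

def cpt2 (φ x : ℝ) : E3 :=
  -Real.cos x • !₂[Real.cos φ ^ 2, 0, -(Real.sin φ * Real.cos φ)] +
    -Real.sin x • !₂[0, Real.cos φ, 0]

theorem hasDerivAt_cpt (φ x : ℝ) : HasDerivAt (cpt φ) (cpt1 φ x) x :=
  (((Real.hasDerivAt_cos x).smul_const _).add ((Real.hasDerivAt_sin x).smul_const _)).const_add _

theorem hasDerivAt_cpt1 (φ x : ℝ) : HasDerivAt (cpt1 φ) (cpt2 φ x) x :=
  ((Real.hasDerivAt_sin x).neg.smul_const _).add ((Real.hasDerivAt_cos x).smul_const _)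

theorem continuous_toLp3 {T : Type*} [TopologicalSpace T] {a b c : T → ℝ} (ha : Continuous a)
    (hb : Continuous b) (hc : Continuous c) : Continuous fun x => (!₂[a x, b x, c x] : E3) := by
  refine (PiLp.continuous_toLp 2 _).comp (continuous_pi fun i => ?_)
  fin_cases i <;> simpa

theorem continuous_circle_axes :
    (Continuous fun x : ℝ × ℝ => (!₂[Real.sin x.1 ^ 2, 0, Real.sin x.1 * Real.cos x.1] : E3)) ∧
    (Continuous fun x : ℝ × ℝ =>
      (!₂[Real.cos x.1 ^ 2, 0, -(Real.sin x.1 * Real.cos x.1)] : E3)) ∧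
    Continuous fun x : ℝ × ℝ => (!₂[0, Real.cos x.1, 0] : E3) :=
  ⟨continuous_toLp3 (by fun_prop) (by fun_prop) (by fun_prop),
    continuous_toLp3 (by fun_prop) (by fun_prop) (by fun_prop),
    continuous_toLp3 (by fun_prop) (by fun_prop) (by fun_prop)⟩

theorem continuous_cpt : Continuous fun x : ℝ × ℝ => cpt x.1 x.2 := by
  obtain ⟨h1, h2, h3⟩ := continuous_circle_axes
  unfold cpt
  fun_prop

theorem continuous_cpt1 : Continuous fun x : ℝ × ℝ => cpt1 x.1 x.2 := by
  obtain ⟨h1, h2, h3⟩ := continuous_circle_axes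
  unfold cpt1
  fun_prop

theorem continuous_cpt2 : Continuous fun x : ℝ × ℝ => cpt2 x.1 x.2 := by
  obtain ⟨h1, h2, h3⟩ := continuous_circle_axes
  unfold cpt2
  fun_prop

/-- The matrix of the rotation by the angle `x` around the axis `(sin φ, 0, cos φ)`. -/
def rot (φ x : ℝ) : Matrix (Fin 3) (Fin 3) ℝ :=
  !![Real.sin φ ^ 2 + Real.cos φ ^ 2 * Real.cos x, -(Real.cos φ * Real.sin x),
      Real.sin φ * Real.cos φ * (1 - Real.cos x);
    Real.cos φ * Real.sin x, Real.cos x, -(Real.sin φ * Real.sin x);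
    Real.sin φ * Real.cos φ * (1 - Real.cos x), Real.sin φ * Real.sin x,
      Real.cos φ ^ 2 + Real.sin φ ^ 2 * Real.cos x]

theorem rot_det (φ x : ℝ) : (rot φ x).det = 1 := by
  have h1 := Real.sin_sq_add_cos_sq φ
  have h2 := Real.sin_sq_add_cos_sq x
  simp only [rot, Matrix.det_fin_three, Matrix.of_apply, Matrix.cons_val', Matrix.cons_val_zero,
    Matrix.cons_val_one, Matrix.cons_val, Matrix.cons_val_fin_one]
  generalize Real.sin φ = s at *
  generalize Real.cos φ = c at *
  generalize Real.sin x = y at *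
  generalize Real.cos x = z at *
  have hs : s ^ 2 = 1 - c ^ 2 := by linarith
  have hy : y ^ 2 = 1 - z ^ 2 := by linarith
  grind

theorem continuous_rot : Continuous fun x : ℝ × ℝ => rot x.1 x.2 := by
  refine continuous_matrix fun i j => ?_
  fin_cases i <;> fin_cases j <;> simp [rot] <;> fun_prop

theorem rot_mul (φ x y : ℝ) : rot φ x * rot φ y = rot φ (x + y) := by
  have h1 := Real.sin_sq_add_cos_sq φ
  ext i j
  simp only [Matrix.mul_apply, Fin.sum_univ_three]
  fin_cases i <;> fin_cases j <;>
    simp [rot, Real.cos_add, Real.sin_add] <;> grind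

theorem rot_zero (φ : ℝ) : rot φ 0 = 1 := by
  have h1 := Real.sin_sq_add_cos_sq φ
  ext i j
  fin_cases i <;> fin_cases j <;> simp [rot, h1]

theorem rot_two_pi (φ : ℝ) : rot φ (2 * Real.pi) = 1 := by
  rw [← rot_zero φ]
  simp [rot]

theorem mv_rot_cpt (φ x y : ℝ) : mv (rot φ x) (cpt φ y) = cpt φ (x + y) := by
  have h1 := Real.sin_sq_add_cos_sq φ
  ext i
  rw [mv_apply]
  fin_cases i <;> simp [rot, cpt, Real.cos_add, Real.sin_add] <;> grind

theorem norm_cpt (φ x : ℝ) : ‖cpt φ x‖ = 1 := by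
  have h1 := Real.sin_sq_add_cos_sq φ
  have h2 := Real.sin_sq_add_cos_sq x
  rw [EuclideanSpace.norm_eq, Real.sqrt_eq_one, Fin.sum_univ_three]
  simp [cpt]
  grind

/-- Positive for `0 < φ < π/2`. The limits are a great circle (`φ = 0`) and the point `e₁` (`φ =
π/2`). -/
theorem det3_cpt (φ x : ℝ) : det3 (cpt φ x) (cpt1 φ x) (cpt2 φ x) = Real.sin φ * Real.cos φ ^ 2 := by
  have h1 := Real.sin_sq_add_cos_sq φ
  have h2 := Real.sin_sq_add_cos_sq x
  simp [det3_eq, cpt, cpt1, cpt2]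
  grind

end Circles

section CircleArcs

/-- The arc of the length `θ` of a circle, starting at `e₁`. -/
def carc (φ θ : ℝ) : H2 E3 :=
  hsmooth (fun t => cpt φ (θ * t)) (fun t => θ • cpt1 φ (θ * t)) fun t => θ ^ 2 • cpt2 φ (θ * t)

theorem hasDerivAt_cpt_mul (φ θ t : ℝ) :
    HasDerivAt (fun t => cpt φ (θ * t)) (θ • cpt1 φ (θ * t)) t :=
  HasDerivAt.scomp t (hasDerivAt_cpt φ (θ * t)) (by simpa using (hasDerivAt_id t).const_mul θ)

theorem hasDerivAt_cpt1_mul (φ θ t : ℝ) :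
    HasDerivAt (fun t => θ • cpt1 φ (θ * t)) (θ ^ 2 • cpt2 φ (θ * t)) t := by
  have h : HasDerivAt (fun t => cpt1 φ (θ * t)) (θ • cpt2 φ (θ * t)) t :=
    HasDerivAt.scomp t (hasDerivAt_cpt1 φ (θ * t)) (by simpa using (hasDerivAt_id t).const_mul θ)
  have := h.const_smul θ
  rwa [smul_smul, ← sq] at this

theorem carc_cont2 (φ θ : ℝ) : Continuous fun t => θ ^ 2 • cpt2 φ (θ * t) := by
  have h : Continuous fun t => cpt2 φ (θ * t) :=
    continuous_cpt2.comp (f := fun t => (φ, θ * t)) (by fun_prop)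
  fun_prop

theorem carc_pos (φ θ : ℝ) {t : ℝ} (ht : t ∈ Icc (0 : ℝ) 1) : hpos (carc φ θ) t = cpt φ (θ * t) :=
  (hsmooth_spec (fun t _ => (hasDerivAt_cpt_mul φ θ t).hasDerivWithinAt)
    (fun t _ => (hasDerivAt_cpt1_mul φ θ t).hasDerivWithinAt) (carc_cont2 φ θ).continuousOn).2 t ht

theorem carc_vel (φ θ : ℝ) {t : ℝ} (ht : t ∈ Icc (0 : ℝ) 1) :
    hvel (carc φ θ) t = θ • cpt1 φ (θ * t) :=
  (hsmooth_spec (fun t _ => (hasDerivAt_cpt_mul φ θ t).hasDerivWithinAt)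
    (fun t _ => (hasDerivAt_cpt1_mul φ θ t).hasDerivWithinAt) (carc_cont2 φ θ).continuousOn).1 t ht

theorem mv_rot_e1 (φ x : ℝ) : mv (rot φ x) e₁ = cpt φ x := by
  ext i
  rw [mv_apply]
  fin_cases i <;> simp [rot, cpt, e₁] <;> ring

/-- The factor is the radius of the circle. When it is positive, the flag at the angle `x` is the
rotated standard flag. -/
theorem mv_rot_e2 (φ x : ℝ) : Real.cos φ • mv (rot φ x) e₂ = cpt1 φ x := by
  ext i
  rw [PiLp.smul_apply, mv_apply]
  fin_cases i <;> simp [rot, cpt1, e₂] <;> ring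

theorem carc_spec {φ θ : ℝ} (hs : 0 < Real.sin φ) (hc : 0 < Real.cos φ) (hθ : 0 < θ) :
    IsArc (carc φ θ) ∧
      ∀ t ∈ Icc (0 : ℝ) 1, SameFlag (mapFlag (rot φ (θ * t)) stdFlag) (flag (carc φ θ) t) := by
  refine ⟨⟨fun t ht => ?_, fun t ht h0 => ?_, ?_⟩, fun t ht => ?_⟩
  · rw [carc_pos _ _ ht, norm_cpt]
  · rw [carc_vel _ _ ht] at h0
    have h1 := det3_cpt φ (θ * t)
    rw [(smul_eq_zero.1 h0).resolve_left hθ.ne'] at h1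
    have h2 : 0 < Real.sin φ * Real.cos φ ^ 2 := by positivity
    rw [← h1] at h2
    simp [det3_eq] at h2
  · filter_upwards [hsmooth_acc (u := fun t => cpt φ (θ * t)) (u1 := fun t => θ • cpt1 φ (θ * t))
      (carc_cont2 φ θ).continuousOn] with t h1 ht
    rw [carc_pos _ _ ht, carc_vel _ _ ht, carc, h1 ht]
    have := det3_flag (cpt φ (θ * t)) (cpt1 φ (θ * t)) (cpt2 φ (θ * t)) 1 θ 0 (θ ^ 2) 0 0
    simp only [one_smul, zero_smul, add_zero, det3_cpt] at this
    rw [this]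
    positivity
  · refine SameFlag.of_smul (m := θ * Real.cos φ) (by positivity) ?_ ?_
    · simp only [flag, mapFlag, stdFlag]
      rw [carc_pos _ _ ht, mv_rot_e1]
    · simp only [flag, mapFlag, stdFlag]
      rw [carc_vel _ _ ht, ← mv_rot_e2, smul_smul]

theorem carc_flag_zero {φ θ : ℝ} (hs : 0 < Real.sin φ) (hc : 0 < Real.cos φ) (hθ : 0 < θ) :
    SameFlag stdFlag (flag (carc φ θ) 0) := by
  have := (carc_spec hs hc hθ).2 0 (by simp)
  rwa [mul_zero, rot_zero, mapFlag_one] at this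

theorem carc_flag_one {φ θ : ℝ} (hs : 0 < Real.sin φ) (hc : 0 < Real.cos φ) (hθ : 0 < θ) :
    SameFlag (mapFlag (rot φ θ) stdFlag) (flag (carc φ θ) 1) := by
  have := (carc_spec hs hc hθ).2 1 (by simp)
  rwa [mul_one] at this

theorem continuous_carc {T : Type*} [TopologicalSpace T] {φ θ : T → ℝ} (hφ : Continuous φ)
    (hθ : Continuous θ) : Continuous fun x => carc (φ x) (θ x) := by
  refine continuous_hsmooth ?_ ?_ ?_
  · exact continuous_cpt.comp (f := fun x => (φ x, θ x * 0)) (by fun_prop)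
  · exact hθ.smul (continuous_cpt1.comp (f := fun x => (φ x, θ x * 0)) (by fun_prop))
  · exact (((hθ.comp continuous_fst).pow 2).smul (continuous_cpt2.comp
      (f := fun y : T × ℝ => (φ y.1, θ y.1 * y.2)) (by fun_prop))).continuousOn

theorem sin_pi_div_four_pos : 0 < Real.sin (Real.pi / 4) := by
  rw [Real.sin_pi_div_four]; positivity

theorem cos_pi_div_four_pos : 0 < Real.cos (Real.pi / 4) := by
  rw [Real.cos_pi_div_four]; positivity

/-- The `n`-fold circle. -/
def nuArc (n : ℕ) : H2 E3 := carc (Real.pi / 4) (2 * Real.pi * n)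

theorem rot_two_pi_mul (φ : ℝ) (n : ℕ) : rot φ (2 * Real.pi * n) = 1 := by
  induction n with
  | zero => simp [rot_zero]
  | succ n ih =>
    push_cast
    rw [mul_add, ← rot_mul, ih, mul_one, rot_two_pi, mul_one]

theorem nuArc_spec {n : ℕ} (hn : 0 < n) : IsArc (nuArc n) ∧ SameFlag stdFlag (flag (nuArc n) 0) ∧
    SameFlag stdFlag (flag (nuArc n) 1) := by
  have hθ : 0 < 2 * Real.pi * n := by
    have := Real.pi_pos
    positivity
  refine ⟨(carc_spec sin_pi_div_four_pos cos_pi_div_four_pos hθ).1,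
    carc_flag_zero sin_pi_div_four_pos cos_pi_div_four_pos hθ, ?_⟩
  have := carc_flag_one sin_pi_div_four_pos cos_pi_div_four_pos hθ
  rwa [rot_two_pi_mul, mapFlag_one] at this

theorem nuArc_pos (n : ℕ) {t : ℝ} (ht : t ∈ Icc (0 : ℝ) 1) :
    hpos (nuArc n) t = cpt (Real.pi / 4) (2 * Real.pi * (n * t)) := by
  rw [nuArc, carc_pos _ _ ht, mul_assoc]

theorem nu_apply (n : ℕ) (t : I) : nu n t = hpos (nuArc n) t := by
  rw [nuArc_pos n t.2]
  have h2 : √2 / 2 * (√2 / 2) = 1 / 2 := by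
    rw [div_mul_div_comm, Real.mul_self_sqrt (by norm_num)]; norm_num
  have h3 : (√2 / 2) ^ 2 = 1 / 2 := by rw [sq, h2]
  ext i
  change (!₂[_, _, _] : E3) i = _
  fin_cases i <;>
    simp only [cpt, Real.sin_pi_div_four, Real.cos_pi_div_four, h2, h3] <;> simp <;> ring

/-- A circle drawn in two steps. -/
theorem rep_cat_circle (φ : ℝ) {α β : ℝ} (hα : 0 < α) (hβ : 0 < β) {p q g : ℝ → E3}
    (hp : ∀ t ∈ Icc (0 : ℝ) 1, p t = cpt φ (α * t))
    (hq : ∀ t ∈ Icc (0 : ℝ) 1, q t = cpt φ (α + β * t))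
    (hg : ∀ t ∈ Icc (0 : ℝ) 1, g t = cpt φ ((α + β) * t)) : Rep (cat p q) g := by
  have hαβ : 0 < α + β := by positivity
  have h : Rep (cat p q) fun t => cpt φ ((α + β) * t) := by
    refine rep_cat_id (r := α / (α + β)) (by positivity) ?_ (fun t ht => ?_) fun t ht => ?_
    · rw [div_lt_one hαβ]; linarith
    · rw [hp t ht]; congr 1; field_simp
    · rw [hq t ⟨ht.1.le, ht.2⟩]; congr 1; field_simp; ring
  exact h.trans (Rep.of_eqOn fun t ht => (hg t ht).symm)

theorem cpt_add_two_pi_mul (φ x : ℝ) (n : ℕ) : cpt φ (2 * Real.pi * n + x) = cpt φ x := by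
  rw [← mv_rot_cpt, rot_two_pi_mul, mv_one]

theorem rep_nuArc_add {m n : ℕ} (hm : 0 < m) (hn : 0 < n) :
    Rep (cat (hpos (nuArc m)) (hpos (nuArc n))) (hpos (nuArc (m + n))) := by
  have := Real.pi_pos
  refine rep_cat_circle (Real.pi / 4) (α := 2 * Real.pi * m) (β := 2 * Real.pi * n) (by positivity)
    (by positivity) (fun t ht => carc_pos _ _ ht) (fun t ht => ?_) fun t ht => ?_
  · rw [nuArc, carc_pos _ _ ht, cpt_add_two_pi_mul]
  · rw [nuArc, carc_pos _ _ ht]; push_cast; congr 1; ring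

end CircleArcs

/-! ### Closed arcs, homotopies between them, and `ν_n * f` -/

section Closing

/-- Locally convex curves that start and end with the standard flag. -/
structure IsClosedArc (c : H2 E3) : Prop where
  arc : IsArc c
  start : SameFlag stdFlag (flag c 0)
  finish : SameFlag stdFlag (flag c 1)

theorem norm_e1 : ‖e₁‖ = 1 := by simp [e₁, EuclideanSpace.norm_eq, Fin.sum_univ_three]

theorem norm_e2 : ‖e₂‖ = 1 := by simp [e₂, EuclideanSpace.norm_eq, Fin.sum_univ_three]

theorem inner_e1_e2 : inner ℝ e₁ e₂ = 0 := by simp [e₁, e₂, PiLp.inner_apply, Fin.sum_univ_three]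

theorem IsArc.exact_stdFlag {c : H2 E3} (h : IsArc c) {t : ℝ} (ht : t ∈ Icc (0 : ℝ) 1)
    (hf : SameFlag stdFlag (flag c t)) : hpos c t = e₁ ∧ ∃ m : ℝ, 0 < m ∧ hvel c t = m • e₂ :=
  hf.exact norm_e1 (h.norm t ht) inner_e1_e2 (h.inner_eq_zero ht)

theorem isLoop_hfit {c : H2 E3} (h : IsClosedArc c) : IsLoop (hfit 1 1 c) := by
  obtain ⟨h1, -, h3, h4, h5, h6⟩ := hfit_spec one_pos one_pos h.arc
  obtain ⟨p0, m, hm, v0⟩ := IsArc.exact_stdFlag h.arc (by simp) h.start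
  obtain ⟨p1, m', hm', v1⟩ := IsArc.exact_stdFlag h.arc (by simp) h.finish
  refine ⟨h1, ?_, ?_⟩
  · rw [flag, h3, h5, p0, v0, norm_smul, norm_e2, Real.norm_of_nonneg hm.le, smul_smul, mul_one,
      one_div_mul_cancel hm.ne', one_smul]
  · rw [flag, h4, h6, p1, v1, norm_smul, norm_e2, Real.norm_of_nonneg hm'.le, smul_smul, mul_one,
      one_div_mul_cancel hm'.ne', one_smul]

theorem IsLoop.isClosedArc {c : H2 E3} (h : IsLoop c) : IsClosedArc c :=
  ⟨h.arc, by rw [h.start]; exact SameFlag.refl _, by rw [h.finish]; exact SameFlag.refl _⟩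

variable {T : Type*} [TopologicalSpace T]

theorem continuous_hfit_one {c : T → H2 E3} (hc : Continuous c) (h : ∀ x, IsClosedArc (c x)) :
    Continuous fun x => hfit 1 1 (c x) :=
  continuous_hfit continuous_const continuous_const (fun _ => one_pos) (fun _ => one_pos) hc
    (fun x => (h x).arc.vel 0 (by simp)) fun x => (h x).arc.vel 1 (by simp)

/-- The map to `𝓛_I` given by a continuous family of closed arcs. -/
def closeMap (c : T → H2 E3) (hc : Continuous c) (h : ∀ x, IsClosedArc (c x)) :
    C(T, locallyConvex) :=
  mkMap (fun x => hfit 1 1 (c x)) (continuous_hfit_one hc h) fun x => isLoop_hfit (h x)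

theorem closeMap_rep (c : T → H2 E3) (hc : Continuous c) (h : ∀ x, IsClosedArc (c x)) (x : T) :
    Rep (hpos (toH2 (closeMap c hc h x).1)) (hpos (c x)) :=
  (Rep.of_eqOn fun _ ht => mkMap_pos _ _ _ x ht).trans (hfit_spec one_pos one_pos (h x).arc).2.1

/-- The ends of a continuous family of closed arcs are homotopic, in any parametrization. -/
theorem homotopic_of_closed {c : I × T → H2 E3} (hc : Continuous c) (h : ∀ x, IsClosedArc (c x))
    (g₀ g₁ : C(T, locallyConvex)) (h₀ : ∀ p, Rep (hpos (toH2 (g₀ p).1)) (hpos (c (0, p))))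
    (h₁ : ∀ p, Rep (hpos (toH2 (g₁ p).1)) (hpos (c (1, p)))) : g₀.Homotopic g₁ := by
  let H := closeMap c hc h
  let k : I → C(T, locallyConvex) := fun s => H.comp ⟨fun p => (s, p), by fun_prop⟩
  have e : (k 0).Homotopic (k 1) := ⟨⟨H, fun p => rfl, fun p => rfl⟩⟩
  have e0 : g₀.Homotopic (k 0) :=
    homotopic_of_rep _ _ fun p => (h₀ p).trans (closeMap_rep c hc h (0, p)).symm
  have e1 : (k 1).Homotopic g₁ :=
    homotopic_of_rep _ _ fun p => (closeMap_rep c hc h (1, p)).trans (h₁ p).symm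
  exact (e0.trans e).trans e1

end Closing

section NuConcat

variable {K : Type*} [TopologicalSpace K]

theorem trans_apply_eq_cat (n : ℕ) (c : locallyConvex) (t : I) :
    ((nu n).trans (toPath c)) t = cat (hpos (nuArc n)) (hpos (toH2 c.1)) t := by
  rw [Path.trans_apply, cat]
  split_ifs with h
  · exact nu_apply n _
  · exact (toH2_pos c.1 _).symm

theorem isNuConcat_iff {n : ℕ} {f g : C(K, locallyConvex)} : IsNuConcat n f g ↔
    ∀ p, Rep (hpos (toH2 (g p).1)) (cat (hpos (nuArc n)) (hpos (toH2 (f p).1))) := by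
  refine forall_congr' fun p => ⟨?_, ?_⟩
  · rintro ⟨φ, hφ⟩
    have h1 : StrictMonoOn (fun t : ℝ => (φ (projIcc 0 1 zero_le_one t) : ℝ)) (Icc 0 1) :=
      fun s hs t ht hst => by
        simp only [projIcc_of_mem zero_le_one hs, projIcc_of_mem zero_le_one ht]
        exact φ.strictMono (a := ⟨s, hs⟩) (b := ⟨t, ht⟩) hst
    refine ⟨fun t => φ (projIcc 0 1 zero_le_one t), h1,
      ⟨fun t _ => (φ _).2, h1.injOn, fun s hs => ⟨φ.symm ⟨s, hs⟩, (φ.symm _).2, ?_⟩⟩, fun t ht => ?_⟩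
    · simp
    · simp only [projIcc_of_mem zero_le_one ht]
      rw [toH2_pos (g p).1 ⟨t, ht⟩, hφ, trans_apply_eq_cat]
  · rintro ⟨φ, h1, h2, h3⟩
    refine ⟨StrictMono.orderIsoOfSurjective (fun t : I => (⟨φ t, h2.mapsTo t.2⟩ : I))
      (fun s t hst => h1 s.2 t.2 hst) fun s => ?_, fun t => ?_⟩
    · obtain ⟨t, ht, e⟩ := h2.surjOn s.2
      exact ⟨⟨t, ht⟩, Subtype.ext e⟩
    · rw [← toH2_pos, h3 t t.2, trans_apply_eq_cat]
      rfl

theorem isClosedArc_join {a b : H2 E3} (ha : IsClosedArc a) (hb : IsClosedArc b) :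
    IsClosedArc (join a b) := by
  obtain ⟨h1, h2, h3, -⟩ := join_spec ha.arc hb.arc (ha.finish.symm.trans hb.start)
  exact ⟨h1, ha.start.trans h2, hb.finish.trans h3⟩

theorem isClosedArc_nuArc {n : ℕ} (hn : 0 < n) : IsClosedArc (nuArc n) :=
  ⟨(nuArc_spec hn).1, (nuArc_spec hn).2.1, (nuArc_spec hn).2.2⟩

theorem exists_isNuConcat (f : C(K, locallyConvex)) {n : ℕ} (hn : 0 < n) :
    ∃ g : C(K, locallyConvex), IsNuConcat n f g := by
  have hf := fun p => (toH2_isLoop (f p)).isClosedArc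
  have ha := isClosedArc_nuArc hn
  refine ⟨closeMap (fun p => join (nuArc n) (toH2 (f p).1)) (continuous_join continuous_const
    (continuous_toH2_locallyConvex f) (fun _ => ha.arc) fun p => (hf p).arc)
    fun p => isClosedArc_join ha (hf p), isNuConcat_iff.2 fun p => ?_⟩
  exact (closeMap_rep _ _ _ p).trans
    (join_spec ha.arc (hf p).arc (ha.finish.symm.trans (hf p).start)).2.2.2

end NuConcat

/-! ### Frames of spherical curves -/

section Frames

/-- The matrix with columns `x`, `v` and `x × v`. -/
def frame (x v : E3) : Matrix (Fin 3) (Fin 3) ℝ :=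
  !![x 0, v 0, x 1 * v 2 - x 2 * v 1;
    x 1, v 1, x 2 * v 0 - x 0 * v 2;
    x 2, v 2, x 0 * v 1 - x 1 * v 0]

theorem mapFlag_frame (x v : E3) : mapFlag (frame x v) stdFlag = (x, v) := by
  refine Prod.ext ?_ ?_ <;> ext i <;> simp only [mapFlag, stdFlag, mv_apply] <;>
    fin_cases i <;> simp [frame, e₁, e₂]

theorem frame_std : frame e₁ e₂ = 1 := by
  ext i j
  fin_cases i <;> fin_cases j <;> simp [frame, e₁, e₂]

/-- The determinant is the squared length of `x × v`, computed by Lagrange's identity. -/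
theorem frame_det_pos {x v : E3} (hx : ‖x‖ = 1) (hv : v ≠ 0) (h : inner ℝ x v = 0) :
    0 < (frame x v).det := by
  have h1 : x 0 ^ 2 + x 1 ^ 2 + x 2 ^ 2 = 1 := by
    have := real_inner_self_eq_norm_sq x
    rw [hx, PiLp.inner_apply, Fin.sum_univ_three] at this
    simp at this
    linarith
  have h2 : 0 < v 0 ^ 2 + v 1 ^ 2 + v 2 ^ 2 := by
    have := real_inner_self_eq_norm_sq v
    have hp := norm_pos_iff.2 hv
    rw [PiLp.inner_apply, Fin.sum_univ_three] at this
    simp at this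
    nlinarith
  have h3 : x 0 * v 0 + x 1 * v 1 + x 2 * v 2 = 0 := by
    rw [PiLp.inner_apply, Fin.sum_univ_three] at h
    simp at h
    linarith
  have h4 : (frame x v).det = (x 0 ^ 2 + x 1 ^ 2 + x 2 ^ 2) * (v 0 ^ 2 + v 1 ^ 2 + v 2 ^ 2) -
      (x 0 * v 0 + x 1 * v 1 + x 2 * v 2) ^ 2 := by
    simp [frame, Matrix.det_fin_three]
    ring
  rw [h4, h1, h3]
  linarith

theorem continuous_frame : Continuous fun x : E3 × E3 => frame x.1 x.2 := by
  refine continuous_matrix fun i j => ?_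
  fin_cases i <;> fin_cases j <;> simp [frame] <;> fun_prop

end Frames

/-! ### Moved circles and chains of them -/

section Omega

theorem mv_sub (A B : Matrix (Fin 3) (Fin 3) ℝ) (x : E3) : mv (A - B) x = mv A x - mv B x := by
  rw [mv, map_sub]; rfl

/-- The circle `ν₁`, moved by a matrix that passes from `A` to `B`. -/
def omU (A B : Matrix (Fin 3) (Fin 3) ℝ) (t : ℝ) : E3 :=
  mv A (cpt (Real.pi / 4) (2 * Real.pi * t)) +
    (3 * t ^ 2 - 2 * t ^ 3) • mv (B - A) (cpt (Real.pi / 4) (2 * Real.pi * t))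

def omU1 (A B : Matrix (Fin 3) (Fin 3) ℝ) (t : ℝ) : E3 :=
  mv A ((2 * Real.pi) • cpt1 (Real.pi / 4) (2 * Real.pi * t)) +
    ((3 * t ^ 2 - 2 * t ^ 3) • mv (B - A) ((2 * Real.pi) • cpt1 (Real.pi / 4) (2 * Real.pi * t)) +
      (6 * t - 6 * t ^ 2) • mv (B - A) (cpt (Real.pi / 4) (2 * Real.pi * t)))

def omU2 (A B : Matrix (Fin 3) (Fin 3) ℝ) (t : ℝ) : E3 :=
  mv A ((2 * Real.pi) ^ 2 • cpt2 (Real.pi / 4) (2 * Real.pi * t)) +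
    (((3 * t ^ 2 - 2 * t ^ 3) •
      mv (B - A) ((2 * Real.pi) ^ 2 • cpt2 (Real.pi / 4) (2 * Real.pi * t)) +
      (6 * t - 6 * t ^ 2) • mv (B - A) ((2 * Real.pi) • cpt1 (Real.pi / 4) (2 * Real.pi * t))) +
      ((6 * t - 6 * t ^ 2) • mv (B - A) ((2 * Real.pi) • cpt1 (Real.pi / 4) (2 * Real.pi * t)) +
        (6 - 12 * t) • mv (B - A) (cpt (Real.pi / 4) (2 * Real.pi * t))))

theorem hasDerivAt_mv (A : Matrix (Fin 3) (Fin 3) ℝ) {u : ℝ → E3} {u' : E3} {t : ℝ}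
    (h : HasDerivAt u u' t) : HasDerivAt (fun t => mv A (u t)) (mv A u') t :=
  (mv A).hasFDerivAt.comp_hasDerivAt t h

theorem hasDerivAt_blend (t : ℝ) :
    HasDerivAt (fun t : ℝ => 3 * t ^ 2 - 2 * t ^ 3) (6 * t - 6 * t ^ 2) t := by
  refine (((hasDerivAt_pow 2 t).const_mul 3).sub ((hasDerivAt_pow 3 t).const_mul 2)).congr_deriv ?_
  norm_num; ring

theorem hasDerivAt_blend1 (t : ℝ) :
    HasDerivAt (fun t : ℝ => 6 * t - 6 * t ^ 2) (6 - 12 * t) t := by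
  refine (((hasDerivAt_id t).const_mul 6).sub ((hasDerivAt_pow 2 t).const_mul 6)).congr_deriv ?_
  norm_num; ring

theorem hasDerivAt_omU (A B : Matrix (Fin 3) (Fin 3) ℝ) (t : ℝ) :
    HasDerivAt (omU A B) (omU1 A B t) t := by
  have h := hasDerivAt_cpt_mul (Real.pi / 4) (2 * Real.pi) t
  exact (hasDerivAt_mv A h).add ((hasDerivAt_blend t).smul (hasDerivAt_mv (B - A) h))

theorem hasDerivAt_omU1 (A B : Matrix (Fin 3) (Fin 3) ℝ) (t : ℝ) :
    HasDerivAt (omU1 A B) (omU2 A B t) t := by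
  have h := hasDerivAt_cpt_mul (Real.pi / 4) (2 * Real.pi) t
  have h1 := hasDerivAt_cpt1_mul (Real.pi / 4) (2 * Real.pi) t
  exact (hasDerivAt_mv A h1).add (((hasDerivAt_blend t).smul (hasDerivAt_mv (B - A) h1)).add
    ((hasDerivAt_blend1 t).smul (hasDerivAt_mv (B - A) h)))

theorem continuous_omU_all {T : Type*} [TopologicalSpace T] {A B : T → Matrix (Fin 3) (Fin 3) ℝ}
    {t : T → ℝ} (hA : Continuous A) (hB : Continuous B) (ht : Continuous t) :
    (Continuous fun x => omU (A x) (B x) (t x)) ∧ (Continuous fun x => omU1 (A x) (B x) (t x)) ∧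
      Continuous fun x => omU2 (A x) (B x) (t x) := by
  have c0 : Continuous fun x => cpt (Real.pi / 4) (2 * Real.pi * t x) :=
    continuous_cpt.comp (f := fun x => (Real.pi / 4, 2 * Real.pi * t x)) (by fun_prop)
  have c1 : Continuous fun x => cpt1 (Real.pi / 4) (2 * Real.pi * t x) :=
    continuous_cpt1.comp (f := fun x => (Real.pi / 4, 2 * Real.pi * t x)) (by fun_prop)
  have c2 : Continuous fun x => cpt2 (Real.pi / 4) (2 * Real.pi * t x) :=
    continuous_cpt2.comp (f := fun x => (Real.pi / 4, 2 * Real.pi * t x)) (by fun_prop)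
  have mA : Continuous fun x => mv (A x) := continuous_mv.comp hA
  have mB : Continuous fun x => mv (B x - A x) := continuous_mv.comp (hB.sub hA)
  unfold omU omU1 omU2
  exact ⟨by fun_prop, by fun_prop, by fun_prop⟩

/-- The moved circle `omU A B` is locally convex. -/
def Good (A B : Matrix (Fin 3) (Fin 3) ℝ) : Prop :=
  ∀ t ∈ Icc (0 : ℝ) 1, 0 < det3 (omU A B t) (omU1 A B t) (omU2 A B t)

/-- For equal matrices the blend disappears and the curve is a linear image of a circle. -/
theorem good_self {A : Matrix (Fin 3) (Fin 3) ℝ} (hA : 0 < A.det) : Good A A := by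
  intro t _
  have hpi := Real.pi_pos
  simp only [omU, omU1, omU2, sub_self]
  have h0 : ∀ x, mv 0 x = 0 := fun x => by rw [mv, map_zero]; rfl
  simp only [h0, smul_zero, add_zero, det3_mv]
  have := det3_flag (cpt (Real.pi / 4) (2 * Real.pi * t)) (cpt1 (Real.pi / 4) (2 * Real.pi * t))
    (cpt2 (Real.pi / 4) (2 * Real.pi * t)) 1 (2 * Real.pi) 0 ((2 * Real.pi) ^ 2) 0 0
  simp only [one_smul, zero_smul, add_zero, det3_cpt] at this
  rw [this]
  have := sin_pi_div_four_pos
  have := cos_pi_div_four_pos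
  positivity

theorem continuous_det3 {T : Type*} [TopologicalSpace T] {u v w : T → E3} (hu : Continuous u)
    (hv : Continuous v) (hw : Continuous w) : Continuous fun x => det3 (u x) (v x) (w x) := by
  simp only [det3_eq]
  fun_prop

/-- Positivity of a continuous function on the compact interval `[0,1]` is an open condition. -/
theorem eventually_good {T : Type*} [TopologicalSpace T] {A B : T → Matrix (Fin 3) (Fin 3) ℝ}
    (hA : Continuous A) (hB : Continuous B) {x₀ : T} (h : Good (A x₀) (B x₀)) :
    ∀ᶠ x in 𝓝 x₀, Good (A x) (B x) := by
  obtain ⟨h0, h1, h2⟩ := continuous_omU_all (T := T × ℝ) (t := Prod.snd) (hA.comp continuous_fst)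
    (hB.comp continuous_fst) continuous_snd
  have := eventually_forall_Icc (B := 0) (x₀ := x₀) (u := fun x t =>
    -det3 (omU (A x) (B x) t) (omU1 (A x) (B x) t) (omU2 (A x) (B x) t))
    (continuous_det3 h0 h1 h2).neg.continuousOn fun t ht => neg_neg_of_pos (h t ht)
  filter_upwards [this] with x hx t ht
  exact neg_lt_zero.1 (hx t ht)

def hom (A B : Matrix (Fin 3) (Fin 3) ℝ) : H2 E3 :=
  hnormalize (hsmooth (omU A B) (omU1 A B) (omU2 A B))

variable {A B : Matrix (Fin 3) (Fin 3) ℝ}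

theorem hom_smooth_spec (A B : Matrix (Fin 3) (Fin 3) ℝ) :
    (∀ t ∈ Icc (0 : ℝ) 1, hvel (hsmooth (omU A B) (omU1 A B) (omU2 A B)) t = omU1 A B t) ∧
      ∀ t ∈ Icc (0 : ℝ) 1, hpos (hsmooth (omU A B) (omU1 A B) (omU2 A B)) t = omU A B t :=
  hsmooth_spec (fun t _ => (hasDerivAt_omU A B t).hasDerivWithinAt)
    (fun t _ => (hasDerivAt_omU1 A B t).hasDerivWithinAt)
    (continuous_omU_all continuous_const continuous_const continuous_id).2.2.continuousOn

theorem isPreArc_hom (h : Good A B) : IsPreArc (hsmooth (omU A B) (omU1 A B) (omU2 A B)) := by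
  obtain ⟨ev, ep⟩ := hom_smooth_spec A B
  refine ⟨fun t ht h0 => ?_, fun t ht k h0 => ?_, ?_⟩
  · have := h t ht
    rw [← ep t ht, h0] at this
    simp [det3_eq] at this
  · have := h t ht
    rw [← ep t ht, ← ev t ht, h0, det3_eq] at this
    simp only [PiLp.smul_apply, smul_eq_mul] at this
    ring_nf at this
    exact lt_irrefl _ this
  · filter_upwards [hsmooth_acc (u := omU A B) (u1 := omU1 A B) (u2 := omU2 A B)
      (continuous_omU_all continuous_const continuous_const continuous_id).2.2.continuousOn]
      with t h1 ht
    rw [ep t ht, ev t ht, h1 ht]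
    exact h t ht

theorem cpt_zero (φ : ℝ) : cpt φ 0 = e₁ := by rw [← mv_rot_e1, rot_zero, mv_one]

theorem cpt1_zero (φ : ℝ) : cpt1 φ 0 = Real.cos φ • e₂ := by rw [← mv_rot_e2, rot_zero, mv_one]

theorem cpt_two_pi (φ : ℝ) : cpt φ (2 * Real.pi) = e₁ := by rw [← mv_rot_e1, rot_two_pi, mv_one]

theorem cpt1_two_pi (φ : ℝ) : cpt1 φ (2 * Real.pi) = Real.cos φ • e₂ := by
  rw [← mv_rot_e2, rot_two_pi, mv_one]

/-- The weight `3t² - 2t³` goes from `0` to `1` with zero derivative at both ends, so the end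
velocities are those of the circle moved by `A` and by `B` alone. -/
theorem hom_spec (h : Good A B) : IsArc (hom A B) ∧
    SameFlag (mapFlag A stdFlag) (flag (hom A B) 0) ∧
    SameFlag (mapFlag B stdFlag) (flag (hom A B) 1) := by
  obtain ⟨ev, ep⟩ := hom_smooth_spec A B
  have hp := isPreArc_hom h
  have m : 0 < 2 * Real.pi * Real.cos (Real.pi / 4) :=
    mul_pos Real.two_pi_pos cos_pi_div_four_pos
  refine ⟨isArc_hnormalize hp, ?_, ?_⟩
  · refine SameFlag.trans ?_ (sameFlag_hnormalize hp.pos (by simp))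
    refine SameFlag.of_smul m ?_ ?_
    · simp [flag, mapFlag, stdFlag, ep, omU, cpt_zero]
    · simp [flag, mapFlag, stdFlag, ev, omU1, cpt1_zero, smul_smul]
  · refine SameFlag.trans ?_ (sameFlag_hnormalize hp.pos (by simp))
    refine SameFlag.of_smul m ?_ ?_
    · simp only [flag, mapFlag, stdFlag]
      rw [ep 1 (by simp), omU, mul_one, cpt_two_pi, mv_sub]
      norm_num
    · simp only [flag, mapFlag, stdFlag]
      rw [ev 1 (by simp), omU1, mul_one, cpt1_two_pi, mv_sub, mv_sub, map_smul, map_smul, smul_smul]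
      norm_num [smul_smul]

theorem hom_one_pos {t : ℝ} (ht : t ∈ Icc (0 : ℝ) 1) : hpos (hom 1 1) t = hpos (nuArc 1) t := by
  have hp := isPreArc_hom (good_self (A := 1) (by simp))
  have h0 : ∀ x, mv 0 x = 0 := fun x => by rw [mv, map_zero]; rfl
  rw [hom, (hnormalize_spec hp.pos).2 t ht, (hom_smooth_spec 1 1).2 t ht, nuArc_pos 1 ht, omU,
    sub_self, h0, smul_zero, add_zero, mv_one, norm_cpt]
  simp

variable {T : Type*} [TopologicalSpace T]

theorem continuous_hom {A B : T → Matrix (Fin 3) (Fin 3) ℝ} (hA : Continuous A) (hB : Continuous B)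
    (h : ∀ x, Good (A x) (B x)) : Continuous fun x => hom (A x) (B x) := by
  obtain ⟨h0, h1, -⟩ := continuous_omU_all (t := fun _ : T => 0) hA hB continuous_const
  obtain ⟨-, -, h2⟩ := continuous_omU_all (T := T × ℝ) (t := Prod.snd) (hA.comp continuous_fst)
    (hB.comp continuous_fst) continuous_snd
  exact continuous_hnormalize (continuous_hsmooth h0 h1 h2.continuousOn)
    fun x => (isPreArc_hom (h x)).pos

/-- Consecutive moved circles through the frames `F 0, …, F (m + 1)`. -/
def chain : ℕ → (ℕ → Matrix (Fin 3) (Fin 3) ℝ) → H2 E3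
  | 0, F => hom (F 0) (F 1)
  | m + 1, F => join (hom (F 0) (F 1)) (chain m fun i => F (i + 1))

theorem chain_spec (m : ℕ) {F : ℕ → Matrix (Fin 3) (Fin 3) ℝ} (h : ∀ i ≤ m, Good (F i) (F (i + 1))) :
    IsArc (chain m F) ∧ SameFlag (mapFlag (F 0) stdFlag) (flag (chain m F) 0) ∧
      SameFlag (mapFlag (F (m + 1)) stdFlag) (flag (chain m F) 1) := by
  induction m generalizing F with
  | zero => exact hom_spec (h 0 le_rfl)
  | succ m ih =>
    obtain ⟨h1, h2, h3⟩ := hom_spec (h 0 (Nat.zero_le _))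
    obtain ⟨k1, k2, k3⟩ := ih (F := fun i => F (i + 1)) fun i hi => h (i + 1) (by omega)
    obtain ⟨j1, j2, j3, -⟩ := join_spec h1 k1 (h3.symm.trans k2)
    exact ⟨j1, h2.trans j2, k3.trans j3⟩

theorem continuous_chain (m : ℕ) {F : T → ℕ → Matrix (Fin 3) (Fin 3) ℝ}
    (hF : ∀ i, Continuous fun x => F x i) (h : ∀ x, ∀ i ≤ m, Good (F x i) (F x (i + 1))) :
    Continuous fun x => chain m (F x) := by
  induction m generalizing F with
  | zero => exact continuous_hom (hF 0) (hF 1) fun x => h x 0 le_rfl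
  | succ m ih =>
    exact continuous_join (continuous_hom (hF 0) (hF 1) fun x => h x 0 (Nat.zero_le _))
      (ih (F := fun x i => F x (i + 1)) (fun i => hF (i + 1)) fun x i hi => h x (i + 1) (by omega))
      (fun x => (hom_spec (h x 0 (Nat.zero_le _))).1)
      fun x => (chain_spec m fun i hi => h x (i + 1) (by omega)).1

/-- With identity frames each link is `ν₁`; `chain m` has `m + 1` links. -/
theorem chain_one (m : ℕ) : Rep (hpos (chain m fun _ => 1)) (hpos (nuArc (m + 1))) := by
  have hg : Good 1 1 := good_self (A := 1) (by simp)
  induction m with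
  | zero => exact Rep.of_eqOn fun t ht => hom_one_pos ht
  | succ m ih =>
    obtain ⟨h1, h2, h3⟩ := hom_spec hg
    obtain ⟨k1, k2, k3⟩ := chain_spec m (F := fun _ => 1) fun _ _ => hg
    have h := (join_spec h1 k1 (h3.symm.trans k2)).2.2.2
    refine h.trans ?_
    rw [show m + 1 + 1 = 1 + (m + 1) by ring]
    exact (Rep.cat (Rep.of_eqOn fun t ht => hom_one_pos ht) ih).trans
      (rep_nuArc_add one_pos (Nat.succ_pos m))

end Omega

/-! ### Contraction in the presence of many circles -/

section Subdivision

theorem exists_good_step {T : Type*} [TopologicalSpace T] [CompactSpace T]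
    {G : T → ℝ → Matrix (Fin 3) (Fin 3) ℝ} (hG : Continuous (Function.uncurry G))
    (h : ∀ x, ∀ t ∈ Icc (0 : ℝ) 1, 0 < (G x t).det) :
    ∃ ε > 0, ∀ x, ∀ s ∈ Icc (0 : ℝ) 1, ∀ t ∈ Icc (0 : ℝ) 1, |t - s| < ε → Good (G x s) (G x t) := by
  -- The step is treated as a parameter `z.1`. For step `0` the two frames coincide and `good_self`
  -- applies; compactness of `T × I` then gives one step size for all. `projIcc` keeps the shifted
  -- time in `[0,1]`.
  let B : ℝ × (T × I) → Matrix (Fin 3) (Fin 3) ℝ := fun z =>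
    G z.2.1 (projIcc 0 1 zero_le_one (z.2.2 + z.1))
  have hB : Continuous B := hG.comp (f := fun z : ℝ × (T × I) =>
    (z.2.1, ((projIcc (0 : ℝ) 1 zero_le_one (z.2.2 + z.1) : I) : ℝ)))
    ((continuous_fst.comp continuous_snd).prodMk (continuous_subtype_val.comp
      (continuous_projIcc.comp (by fun_prop))))
  have hA : Continuous fun z : ℝ × (T × I) => G z.2.1 z.2.2 :=
    hG.comp (f := fun z : ℝ × (T × I) => (z.2.1, (z.2.2 : ℝ))) (by fun_prop)
  have := isCompact_univ.eventually_forall_of_forall_eventually (K := (univ : Set (T × I)))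
    (x₀ := (0 : ℝ)) (P := fun ε y => Good (G y.1 y.2) (B (ε, y))) fun y _ => by
      refine eventually_good (x₀ := ((0 : ℝ), y)) hA hB ?_
      have : B (0, y) = G y.1 y.2 := by simp [B]
      rw [this]
      exact good_self (h y.1 y.2 y.2.2)
  obtain ⟨ε, hε, H⟩ := Metric.eventually_nhds_iff.1 this
  refine ⟨ε, hε, fun x s hs t ht hst => ?_⟩
  have := H (y := t - s) (by simpa using hst) (x, ⟨s, hs⟩) (mem_univ _)
  simp only [B, add_sub_cancel] at this
  rwa [projIcc_of_mem zero_le_one ht] at this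

/-- The frame of a curve. -/
def hframe (c : H2 E3) (t : ℝ) : Matrix (Fin 3) (Fin 3) ℝ := frame (hpos c t) (hvel c t)

theorem continuous_hframe {T : Type*} [TopologicalSpace T] {c : T → H2 E3} (hc : Continuous c)
    {t : T → ℝ} (ht : Continuous t) : Continuous fun x => hframe (c x) (t x) :=
  continuous_frame.comp (f := fun x => (hpos (c x) (t x), hvel (c x) (t x)))
    ((Continuous.hpos hc ht).prodMk (Continuous.hvel hc ht))

theorem hframe_flag (c : H2 E3) (t : ℝ) : mapFlag (hframe c t) stdFlag = flag c t :=
  mapFlag_frame _ _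

theorem hframe_det_pos (c : immersions) {t : ℝ} (ht : t ∈ Icc (0 : ℝ) 1) :
    0 < (hframe (toH2 c.1) t).det := by
  have hn : ∀ t ∈ Icc (0 : ℝ) 1, ‖hpos (toH2 c.1) t‖ = 1 := fun t ht => by
    rw [toH2_pos c.1 ⟨t, ht⟩]; exact c.2.1 _
  refine frame_det_pos (hn t ht) ?_ (inner_eq_zero_of_norm hn ht)
  rw [toH2_vel c.1 ⟨t, ht⟩]; exact c.2.2.1 _

theorem immersions_flag (c : immersions) :
    flag (toH2 c.1) 0 = stdFlag ∧ flag (toH2 c.1) 1 = stdFlag := by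
  obtain ⟨c, -, -, h0, h1, h2, h3⟩ := c
  have p0 := toH2_pos c 0
  have p1 := toH2_pos c 1
  have v0 := toH2_vel c 0
  have v1 := toH2_vel c 1
  simp only [Icc.coe_zero, Icc.coe_one] at p0 p1 v0 v1
  rw [flag, flag, p0, p1, v0, v1, h0, h1, h2, h3]
  exact ⟨rfl, rfl⟩

theorem hframe_std {c : H2 E3} {t : ℝ} (h : flag c t = stdFlag) : hframe c t = 1 := by
  simp only [flag, stdFlag, Prod.mk.injEq] at h
  rw [hframe, h.1, h.2, frame_std]

variable {K : Type*} [TopologicalSpace K]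

/-- With sufficiently many circles the curves of a family that is contractible among immersions
can be replaced by chains of moved circles. -/
theorem nullhomotopic_of_large [CompactSpace K] (f : C(K, locallyConvex))
    (hf : (inclusion.comp f).Nullhomotopic) : ∃ M₀ : ℕ, ∀ M ≥ M₀, ∀ g : C(K, locallyConvex),
      IsNuConcat M f g → g.Nullhomotopic := by
  obtain ⟨y, ⟨H⟩⟩ := hf
  have hHc : Continuous fun x => toH2 (H x).1 := continuous_toH2_immersions H.toContinuousMap
  -- The step size is uniform over the whole homotopy, as `I × K` is compact.
  obtain ⟨ε, hε, hgood⟩ := exists_good_step (T := I × K) (G := fun x t => hframe (toH2 (H x).1) t)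
    (continuous_hframe (T := (I × K) × ℝ) (hHc.comp continuous_fst) continuous_snd)
    fun x t ht => hframe_det_pos (H x) ht
  obtain ⟨N, hN⟩ := exists_nat_one_div_lt hε
  refine ⟨N + 1, fun M hM g hg => ?_⟩
  obtain ⟨m, rfl⟩ : ∃ m, M = m + 1 := ⟨M - 1, by omega⟩
  have hm : (0 : ℝ) < m + 1 := by positivity
  have hstep : 1 / ((m : ℝ) + 1) < ε := by
    refine lt_of_le_of_lt (one_div_le_one_div_of_le (by positivity) ?_) hN
    have : N ≤ m := by omega
    have : (N : ℝ) ≤ m := by exact_mod_cast this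
    linarith
  have mem : ∀ θ ∈ Icc (0 : ℝ) 1, ∀ i ≤ m + 1, θ * ((i : ℝ) / (m + 1)) ∈ Icc (0 : ℝ) 1 := by
    intro θ hθ i hi
    have h1 : (i : ℝ) ≤ m + 1 := by exact_mod_cast hi
    have h2 : (i : ℝ) / (m + 1) ≤ 1 := (div_le_one hm).2 h1
    exact ⟨mul_nonneg hθ.1 (by positivity), mul_le_one₀ hθ.2 (by positivity) h2⟩
  -- The interval `[0, θ]` is cut into `m + 1` equal parts. They have length at most `1 / (m + 1)`,
  -- so one `m` serves for all `θ`.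
  have good : ∀ x, ∀ θ ∈ Icc (0 : ℝ) 1, ∀ i ≤ m, Good
      (hframe (toH2 (H x).1) (θ * ((i : ℕ) / (m + 1))))
      (hframe (toH2 (H x).1) (θ * (((i + 1 : ℕ) : ℝ) / (m + 1)))) := by
    intro x θ hθ i hi
    refine hgood x _ (mem θ hθ i (by omega)) _ (mem θ hθ (i + 1) (by omega)) ?_
    have : θ * (((i + 1 : ℕ) : ℝ) / (m + 1)) - θ * ((i : ℕ) / (m + 1)) = θ * (1 / (m + 1)) := by
      push_cast; ring
    rw [this, abs_of_nonneg (mul_nonneg hθ.1 (by positivity))]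
    exact (mul_le_of_le_one_left (by positivity) hθ.2).trans_lt hstep
  have e0 : ∀ p, (H (0, p)).1 = (f p).1 := fun p => by rw [H.apply_zero]; rfl
  have e1 : ∀ p, H (1, p) = y := fun p => H.apply_one p
  -- the chain for `H x` up to the time `θ`
  let ch : I × K → ℝ → H2 E3 := fun x θ =>
    chain m fun i => hframe (toH2 (H x).1) (θ * ((i : ℝ) / (m + 1)))
  have chs : ∀ x, ∀ θ ∈ Icc (0 : ℝ) 1, IsArc (ch x θ) ∧ SameFlag stdFlag (flag (ch x θ) 0) ∧
      SameFlag (flag (toH2 (H x).1) θ) (flag (ch x θ) 1) := by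
    intro x θ hθ
    obtain ⟨h1, h2, h3⟩ := chain_spec m (good x θ hθ)
    refine ⟨h1, ?_, ?_⟩
    · rw [hframe_flag] at h2
      simpa [(immersions_flag (H x)).1] using h2
    · rw [hframe_flag] at h3
      have : θ * (((m + 1 : ℕ) : ℝ) / (m + 1)) = θ := by
        push_cast; field_simp
      rwa [this] at h3
  have chc : ∀ {X : Type _} [TopologicalSpace X] {u : X → I × K} {θ : X → ℝ}, Continuous u →
      Continuous θ → (∀ z, θ z ∈ Icc (0 : ℝ) 1) → Continuous fun z => ch (u z) (θ z) := by
    intro X _ u θ hu hθ hm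
    exact continuous_chain m (fun i => continuous_hframe (hHc.comp hu)
      (hθ.mul continuous_const)) fun z => good (u z) (θ z) (hm z)
  have m1 : (1 : ℝ) ∈ Icc (0 : ℝ) 1 := by simp
  have cl : ∀ x, IsClosedArc (ch x 1) := fun x => by
    obtain ⟨h1, h2, h3⟩ := chs x 1 m1
    rw [(immersions_flag (H x)).2] at h3
    exact ⟨h1, h2, h3⟩
  have clc : Continuous fun x => ch x 1 := chc continuous_id continuous_const fun _ => m1
  let g₁ : C(K, locallyConvex) := closeMap (fun p => ch (0, p) 1)
    (clc.comp (f := fun p => ((0 : I), p)) (by fun_prop)) fun p => cl (0, p)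
  have hfl := fun p => toH2_isLoop (f p)
  have step1 : g.Homotopic g₁ := by
    -- With this `l` the curve `hlate (f p)` is at the time `s` of `f p` when the chain hands over,
    -- which is where the chain up to `θ = s` ends.
    let l : I × K → ℝ := fun x => (1 + (x.1 : ℝ)) / 2
    have l0 : ∀ x, 1 / 2 ≤ l x := fun x => by have := x.1.2.1; simp only [l]; linarith
    have l1 : ∀ x, l x ≤ 1 := fun x => by have := x.1.2.2; simp only [l]; linarith
    have lc : Continuous l := by fun_prop
    have hl0 : ∀ p, l (0, p) = 1 / 2 := fun p => by simp [l]
    have hl1 : ∀ p, l (1, p) = 1 := fun p => by norm_num [l]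
    have l2 : ∀ x, 2 * l x - 1 = x.1 := fun x => by simp only [l]; ring
    have spec := fun x : I × K => hgvar_hlate_spec (l0 x) (l1 x) (chs (0, x.2) x.1 x.1.2).1
      (hfl x.2).arc (by
        have := (chs (0, x.2) x.1 x.1.2).2.2
        rw [e0] at this
        rw [l2]
        exact this.symm)
    refine homotopic_of_closed (c := fun x => hgvar (l x) (ch (0, x.2) x.1)
      (hlate (toH2 (f x.2).1))) ?_ (fun x => ?_) _ _ (fun p => ?_) fun p => ?_
    · exact continuous_hgvar_hlate lc (chc (X := I × K) (u := fun x => (0, x.2))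
        (θ := fun x => x.1) (by fun_prop) (by fun_prop) fun x => x.1.2)
        ((continuous_toH2_locallyConvex f).comp continuous_snd) l0 l1
        (fun x => (chs (0, x.2) x.1 x.1.2).1) fun x => (hfl x.2).arc
    · obtain ⟨h1, h2, h3, -⟩ := spec x
      exact ⟨h1, (chs (0, x.2) x.1 x.1.2).2.1.trans h2, (hfl x.2).isClosedArc.finish.trans h3⟩
    · refine ((isNuConcat_iff.1 hg p).trans ?_).trans
        ((spec (0, p)).2.2.2.1 (hl0 p)).symm
      refine Rep.symm (Rep.cat ?_ (Rep.refl _))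
      -- For `θ = 0` all division points are `0`, where the frame is the identity, and the chain is
      -- `ν_{m+1}`.
      have : ch (0, p) ((0 : I) : ℝ) = chain m fun _ => 1 := by
        simp only [ch, Icc.coe_zero, zero_mul, hframe_std (immersions_flag (H (0, p))).1]
      rw [this]
      exact chain_one m
    · exact (closeMap_rep _ _ _ p).trans ((spec (1, p)).2.2.2.2 (hl1 p)).symm
  -- The constant map needs a value in `𝓛_I`. For empty `K` any loop will do; otherwise it is the
  -- chain of the immersion at the end of the homotopy.
  rcases isEmpty_or_nonempty K with hK | ⟨⟨p₀⟩⟩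
  · exact ⟨closeMap (fun _ : Unit => nuArc 1) continuous_const
      (fun _ => isClosedArc_nuArc one_pos) (), ⟨⟨⟨fun x => (hK.false x.2).elim,
        continuous_of_const fun x => (hK.false x.2).elim⟩, fun p => (hK.false p).elim,
        fun p => (hK.false p).elim⟩⟩⟩
  · refine ⟨closeMap _ clc cl (1, p₀), step1.trans (homotopic_of_closed clc cl _ _
      (fun p => closeMap_rep _ _ _ p) fun p => ?_)⟩
    have : ch (1, p) 1 = ch (1, p₀) 1 := by simp only [ch, e1]
    rw [this]
    exact closeMap_rep _ clc cl (1, p₀)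

end Subdivision

/-! ### Initial arcs lie in an open cell of flags -/

section PositiveArcs

/-- The increment is the integral of a derivative that is positive almost everywhere. -/
theorem ac_lt {u : ℝ → ℝ} {a b : ℝ} (hab : a < b) (hu : AbsolutelyContinuousOnInterval u a b)
    (h : ∀ᵐ t, t ∈ Ioc a b → ∃ d > 0, HasDerivAt u d t) : u a < u b := by
  have h1 : ∀ᵐ t, t ∈ Ioc a b → 0 < deriv u t := by
    filter_upwards [h] with t ht hm
    obtain ⟨d, hd, hd'⟩ := ht hm
    rwa [hd'.deriv]
  rw [← sub_pos, ← hu.integral_deriv_eq_sub,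
    intervalIntegral.integral_pos_iff_support_of_nonneg_ae' ?_ hu.intervalIntegrable_deriv]
  · refine ⟨hab, ?_⟩
    have h2 : volume (Ioc a b) ≤ volume (Function.support (deriv u) ∩ Ioc a b) := by
      refine measure_mono_ae ?_
      filter_upwards [h1] with t ht hm
      exact ⟨(ht hm).ne', hm⟩
    refine lt_of_lt_of_le ?_ h2
    simp [hab]
  · rw [uIoc_of_le hab.le]
    filter_upwards [ae_restrict_of_ae h1, ae_restrict_mem measurableSet_Ioc] with t ht hm
    exact (ht hm).le

theorem ac_coord {u : ℝ → E3} {a b : ℝ} (hu : AbsolutelyContinuousOnInterval u a b) (i : Fin 3) :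
    AbsolutelyContinuousOnInterval (fun t => u t i) a b :=
  ac_of_dist_le' (C := 1) hu fun s _ t _ => by
    rw [one_mul, dist_eq_norm, dist_eq_norm, ← PiLp.sub_apply]
    exact PiLp.norm_apply_le _ i

theorem hasDerivAt_coord {u : ℝ → E3} {u' : E3} {t : ℝ} (hu : HasDerivAt u u' t) (i : Fin 3) :
    HasDerivAt (fun t => u t i) (u' i) t :=
  (EuclideanSpace.proj (𝕜 := ℝ) i).hasFDerivAt.comp_hasDerivAt t hu

/-- A locally convex arc that starts with the standard flag immediately enters the region where
the third coordinate of the position and the first coordinate of the normal are positive. -/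
theorem positive_arc {c : H2 E3} (hc : IsLoop c) {δ : ℝ} (h0 : 0 < δ) (h1 : δ ≤ 1)
    (hx : ∀ t ∈ Icc (0 : ℝ) δ, 0 < hpos c t 0)
    (hn : ∀ t ∈ Icc (0 : ℝ) δ, 0 < hpos c t 0 * hvel c t 1 - hpos c t 1 * hvel c t 0) :
    0 < hpos c δ 2 ∧ 0 < hpos c δ 1 * hvel c δ 2 - hpos c δ 2 * hvel c δ 1 := by
  have st := hc.start
  simp only [flag, Prod.mk.injEq] at st
  have px := fun t i => hasDerivAt_coord (hasDerivAt_hpos c t) i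
  -- the slope of the tangent great circle in the chart, and the chart
  set q : ℝ → ℝ := fun t => (hpos c t 0 * hvel c t 2 - hpos c t 2 * hvel c t 0) *
    (hpos c t 0 * hvel c t 1 - hpos c t 1 * hvel c t 0)⁻¹ with hq
  set ξ : ℝ → ℝ := fun t => hpos c t 1 / hpos c t 0 with hξ
  set ζ : ℝ → ℝ := fun t => hpos c t 2 / hpos c t 0 with hζ
  have q0 : q 0 = 0 := by simp [hq, st.1, st.2, e₁, e₂]
  have ξ0 : ξ 0 = 0 := by simp [hξ, st.1, e₁]
  have ζ0 : ζ 0 = 0 := by simp [hζ, st.1, e₁]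
  have ξd : ∀ t ∈ Icc (0 : ℝ) δ, HasDerivAt ξ
      ((hpos c t 0 * hvel c t 1 - hpos c t 1 * hvel c t 0) / hpos c t 0 ^ 2) t := fun t ht =>
    ((px t 1).div (px t 0) (hx t ht).ne').congr_deriv (by ring)
  have qN : ∀ t ∈ Icc (0 : ℝ) δ, q t * (hpos c t 0 * hvel c t 1 - hpos c t 1 * hvel c t 0) =
      hpos c t 0 * hvel c t 2 - hpos c t 2 * hvel c t 0 := fun t ht =>
    inv_mul_cancel_right₀ (hn t ht).ne' _
  have ζd : ∀ t ∈ Icc (0 : ℝ) δ, HasDerivAt ζ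
      (q t * ((hpos c t 0 * hvel c t 1 - hpos c t 1 * hvel c t 0) / hpos c t 0 ^ 2)) t :=
    fun t ht => ((px t 2).div (px t 0) (hx t ht).ne').congr_deriv (by
      rw [← mul_div_assoc, qN t ht]
      ring)
  have sub : ∀ {b : ℝ}, b ∈ Ioc 0 δ → uIcc 0 b ⊆ Icc 0 δ := fun {b} hb => by
    rw [uIcc_of_le hb.1.le]; exact Icc_subset_Icc_right hb.2
  have acx := fun (b : ℝ) i => ac_coord (ac_hpos c 0 b) i
  have acv := fun (b : ℝ) i => ac_coord (ac_hvel c 0 b) i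
  have acq : ∀ b ∈ Ioc 0 δ, AbsolutelyContinuousOnInterval q 0 b := fun b hb =>
    (((acx b 0).mul (acv b 2)).sub ((acx b 2).mul (acv b 0))).mul
      (ac_inv (((acx b 0).mul (acv b 1)).sub ((acx b 1).mul (acv b 0)))
        fun t ht => (hn t (sub hb ht)).ne')
  have acξ : ∀ b ∈ Ioc 0 δ, AbsolutelyContinuousOnInterval ξ 0 b := fun b hb => by
    have := (acx b 1).mul (ac_inv (acx b 0) fun t ht => (hx t (sub hb ht)).ne')
    exact this
  have acζ : ∀ b ∈ Ioc 0 δ, AbsolutelyContinuousOnInterval ζ 0 b := fun b hb => by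
    have := (acx b 2).mul (ac_inv (acx b 0) fun t ht => (hx t (sub hb ht)).ne')
    exact this
  -- In the chart the curve is a graph `ζ` over `ξ` with slope `q`. Local convexity says that the
  -- slope increases: `q'` is the determinant times a positive factor.
  have qd : ∀ᵐ t, t ∈ Ioc 0 δ → ∃ d > 0, HasDerivAt q d t := by
    filter_upwards [hc.arc.det, ae_hasDerivAt_hvel c] with t hD hv ht
    have ht' : t ∈ Icc (0 : ℝ) δ := Ioc_subset_Icc_self ht
    have hD := hD ⟨ht'.1, ht'.2.trans h1⟩
    have vx := fun i => hasDerivAt_coord hv i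
    have n2 := (hn t ht').ne'
    refine ⟨_, ?_, (((px t 0).mul (vx 2)).sub ((px t 2).mul (vx 0))).mul
      ((((px t 0).mul (vx 1)).sub ((px t 1).mul (vx 0))).inv n2)⟩
    have : 0 < hpos c t 0 * det3 (hpos c t) (hvel c t) (hacc c t) /
        (hpos c t 0 * hvel c t 1 - hpos c t 1 * hvel c t 0) ^ 2 := by
      have := hx t ht'
      positivity
    convert this using 1
    simp only [Pi.sub_apply, Pi.mul_apply, det3_eq]
    field_simp
    ring
  have qpos : ∀ t ∈ Ioc 0 δ, 0 < q t := fun t ht => by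
    rw [← q0]
    refine ac_lt ht.1 (acq t ht) ?_
    filter_upwards [qd] with s hs hm using hs ⟨hm.1, hm.2.trans ht.2⟩
  have ξpos : ∀ t ∈ Ioc 0 δ, 0 < ξ t := fun t ht => by
    rw [← ξ0]
    refine ac_lt ht.1 (acξ t ht) (Eventually.of_forall fun s hs => ?_)
    have hs' : s ∈ Icc (0 : ℝ) δ := ⟨hs.1.le, hs.2.trans ht.2⟩
    exact ⟨_, div_pos (hn s hs') (pow_pos (hx s hs') 2), ξd s hs'⟩
  have m : δ ∈ Ioc (0 : ℝ) δ := ⟨h0, le_rfl⟩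
  have hδ : δ ∈ Icc (0 : ℝ) δ := ⟨h0.le, le_rfl⟩
  have ζpos : 0 < ζ δ := by
    rw [← ζ0]
    refine ac_lt h0 (acζ δ m) (Eventually.of_forall fun s hs => ?_)
    have hs' : s ∈ Icc (0 : ℝ) δ := ⟨hs.1.le, hs.2⟩
    exact ⟨_, mul_pos (qpos s hs) (div_pos (hn s hs') (pow_pos (hx s hs') 2)), ζd s hs'⟩
  -- The tangent line at `δ` meets the axis `ξ = 0` below the origin. Since `ζ' = q ξ'`, the
  -- derivative of `q ξ - ζ` is `q' ξ`, which is positive.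
  have Wpos : 0 < q δ * ξ δ - ζ δ := by
    have := ac_lt (u := fun t => q t * ξ t - ζ t) h0 (((acq δ m).mul (acξ δ m)).sub (acζ δ m)) (by
      filter_upwards [qd] with t ht hm
      obtain ⟨d, hd, hd'⟩ := ht hm
      have hm' : t ∈ Icc (0 : ℝ) δ := Ioc_subset_Icc_self hm
      refine ⟨d * ξ t, mul_pos hd (ξpos t hm),
        ((hd'.mul (ξd t hm')).sub (ζd t hm')).congr_deriv (by ring)⟩)
    simpa [q0, ζ0] using this
  have x0 := hx δ hδ
  have n2 := hn δ hδ
  refine ⟨by simpa [hζ, x0] using (div_pos_iff_of_pos_right x0).1 ζpos, ?_⟩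
  have : hpos c δ 1 * hvel c δ 2 - hpos c δ 2 * hvel c δ 1 =
      (hpos c δ 0 * hvel c δ 1 - hpos c δ 1 * hvel c δ 0) * (q δ * ξ δ - ζ δ) := by
    have hx0 := x0.ne'
    have e : (hpos c δ 0 * hvel c δ 1 - hpos c δ 1 * hvel c δ 0) * (q δ * ξ δ - ζ δ) =
      (hpos c δ 0 * hvel c δ 2 - hpos c δ 2 * hvel c δ 0) * ξ δ -
        (hpos c δ 0 * hvel c δ 1 - hpos c δ 1 * hvel c δ 0) * ζ δ := by
      rw [← qN δ hδ]; ring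
    rw [e]
    simp only [hξ, hζ]
    field_simp
    ring
  rw [this]
  exact mul_pos n2 Wpos

variable {K : Type*} [TopologicalSpace K] [CompactSpace K]

/-- At `t = 0` the two chart conditions of `positive_arc` read `1 > 0`; compactness of `K` keeps
them valid on a common interval. The two quantities obtained are the denominators of the matrix
`corr`. -/
theorem exists_positive_time (f : C(K, locallyConvex)) : ∃ δ : ℝ, 0 < δ ∧ δ < 1 ∧ ∀ p,
    0 < hpos (toH2 (f p).1) δ 2 ∧ 0 < hpos (toH2 (f p).1) δ 1 * hvel (toH2 (f p).1) δ 2 -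
      hpos (toH2 (f p).1) δ 2 * hvel (toH2 (f p).1) δ 1 := by
  have hc := continuous_toH2_locallyConvex f
  have cx : ∀ i, Continuous fun z : ℝ × K => hpos (toH2 (f z.2).1) z.1 i := fun i =>
    (EuclideanSpace.proj (𝕜 := ℝ) i).continuous.comp
      (Continuous.hpos (hc.comp continuous_snd) continuous_fst)
  have cv : ∀ i, Continuous fun z : ℝ × K => hvel (toH2 (f z.2).1) z.1 i := fun i =>
    (EuclideanSpace.proj (𝕜 := ℝ) i).continuous.comp
      (Continuous.hvel (hc.comp continuous_snd) continuous_fst)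
  have ev := isCompact_univ.eventually_forall_of_forall_eventually (K := (univ : Set K))
    (x₀ := (0 : ℝ)) (P := fun t p => 0 < hpos (toH2 (f p).1) t 0 ∧
      0 < hpos (toH2 (f p).1) t 0 * hvel (toH2 (f p).1) t 1 -
        hpos (toH2 (f p).1) t 1 * hvel (toH2 (f p).1) t 0) fun p _ => by
    have st := (toH2_isLoop (f p)).start
    simp only [flag, Prod.mk.injEq] at st
    refine ((cx 0).continuousAt.eventually (lt_mem_nhds (a := 0) ?_)).and
      ((((cx 0).mul (cv 1)).sub ((cx 1).mul (cv 0))).continuousAt.eventually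
        (lt_mem_nhds (a := 0) ?_))
    · simp [st.1, e₁]
    · simp [st.1, st.2, e₁, e₂]
  obtain ⟨ε, hε, H⟩ := Metric.eventually_nhds_iff.1 ev
  have hmin : 0 < min ε 1 := lt_min hε one_pos
  have key : ∀ p, ∀ t ∈ Icc (0 : ℝ) (min ε 1 / 2), _ := fun p t ht => H (y := t) (by
    rw [Real.dist_eq, sub_zero, abs_of_nonneg ht.1]
    linarith [ht.2, min_le_left ε 1]) p (mem_univ _)
  have hle := min_le_right ε 1
  refine ⟨min ε 1 / 2, by positivity, by linarith, fun p => ?_⟩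
  exact positive_arc (toH2_isLoop (f p)) (by positivity) (by linarith)
    (fun t ht => (key p t ht).1) fun t ht => (key p t ht).2

end PositiveArcs

/-! ### A linear map with prescribed effect on two flags -/

section Correction

/-- For `m = x × v` and `d = a × b`, the linear map that fixes `x` and maps `e₁` to `a` and
`e₃ × m` to `d × m`. -/
def corr (a b x v : E3) : Matrix (Fin 3) (Fin 3) ℝ :=
  let m : Fin 3 → ℝ := ![x 1 * v 2 - x 2 * v 1, x 2 * v 0 - x 0 * v 2, x 0 * v 1 - x 1 * v 0]
  let ma := m 0 * a 0 + m 1 * a 1 + m 2 * a 2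
  let mb := m 0 * b 0 + m 1 * b 1 + m 2 * b 2
  let c1 : Fin 3 → ℝ := fun i => (ma * b i - mb * a i + m 1 * a i) / m 0
  Matrix.of fun i j => ![a i, c1 i, (x i - x 0 * a i - x 1 * c1 i) / x 2] j

variable {a b x v : E3}

/-- The vector `e₃ × m` spans the intersection of the planes of the flags `(e₁, e₂)` and `(x, v)`,
and `d × m` lies in the intersection of the planes of `(a, b)` and `(x, v)`. Sending `e₁` to `a`,
`x` to itself and the former vector to the latter therefore carries the first flag to `(a, b)` and
keeps the plane of `(x, v)`. The inequalities settle the orientations, here and in `corr_flag_end`.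
-/
theorem corr_flag_start (hm : 0 < x 1 * v 2 - x 2 * v 1)
    (ha : 0 < (x 1 * v 2 - x 2 * v 1) * a 0 + (x 2 * v 0 - x 0 * v 2) * a 1 +
      (x 0 * v 1 - x 1 * v 0) * a 2) :
    SameFlag (a, b) (mapFlag (corr a b x v) stdFlag) := by
  refine ⟨1, _, (x 2 * v 0 - x 0 * v 2 - ((x 1 * v 2 - x 2 * v 1) * b 0 +
    (x 2 * v 0 - x 0 * v 2) * b 1 + (x 0 * v 1 - x 1 * v 0) * b 2)) / (x 1 * v 2 - x 2 * v 1),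
    one_pos, div_pos ha hm, ?_, ?_⟩
  · ext i
    simp [mapFlag, stdFlag, mv_apply, corr, e₁]
  · ext i
    simp only [mapFlag, stdFlag, mv_apply, corr, e₂]
    simp
    field_simp
    ring

theorem corr_flag_end (hm : 0 < x 1 * v 2 - x 2 * v 1) (hx : 0 < x 2)
    (hd : 0 < (a 1 * b 2 - a 2 * b 1) * x 0 + (a 2 * b 0 - a 0 * b 2) * x 1 +
      (a 0 * b 1 - a 1 * b 0) * x 2) :
    SameFlag (x, v) (mapFlag (corr a b x v) (x, v)) := by
  refine ⟨1, _, (v 2 - ((a 1 * b 2 - a 2 * b 1) * v 0 + (a 2 * b 0 - a 0 * b 2) * v 1 +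
      (a 0 * b 1 - a 1 * b 0) * v 2)) / x 2, one_pos, div_pos hd hx, ?_, ?_⟩
  · ext i
    simp only [mapFlag, mv_apply, corr]
    simp
    field_simp
    ring
  · ext i
    simp only [mapFlag, mv_apply, corr, PiLp.add_apply, PiLp.smul_apply, smul_eq_mul]
    simp
    fin_cases i <;> simp <;> field_simp <;> ring

/-- With `m = x × v` and `d = a × b` the determinant is `(m · a) (d · x) / (m₀ x₂)`, a quotient of
quantities assumed positive. -/
theorem corr_det (hm : 0 < x 1 * v 2 - x 2 * v 1) (hx : 0 < x 2)
    (ha : 0 < (x 1 * v 2 - x 2 * v 1) * a 0 + (x 2 * v 0 - x 0 * v 2) * a 1 +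
      (x 0 * v 1 - x 1 * v 0) * a 2)
    (hd : 0 < (a 1 * b 2 - a 2 * b 1) * x 0 + (a 2 * b 0 - a 0 * b 2) * x 1 +
      (a 0 * b 1 - a 1 * b 0) * x 2) : 0 < (corr a b x v).det := by
  have h : (corr a b x v).det = ((x 1 * v 2 - x 2 * v 1) * a 0 + (x 2 * v 0 - x 0 * v 2) * a 1 +
      (x 0 * v 1 - x 1 * v 0) * a 2) * ((a 1 * b 2 - a 2 * b 1) * x 0 +
      (a 2 * b 0 - a 0 * b 2) * x 1 + (a 0 * b 1 - a 1 * b 0) * x 2) /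
      ((x 1 * v 2 - x 2 * v 1) * x 2) := by
    simp only [corr, Matrix.det_fin_three]
    simp
    field_simp
    ring
  rw [h]
  positivity

theorem corr_std (hm : 0 < x 1 * v 2 - x 2 * v 1) (hx : 0 < x 2) : corr e₁ e₂ x v = 1 := by
  ext i j
  simp only [corr]
  have hm' := hm.ne'
  have hx' := hx.ne'
  fin_cases i <;> fin_cases j <;> simp [e₁, e₂, hm', hx']

theorem continuous_corr {T : Type*} [TopologicalSpace T] {a b x v : T → E3} (ha : Continuous a)
    (hb : Continuous b) (hx : Continuous x) (hv : Continuous v)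
    (hm0 : ∀ z, 0 < x z 1 * v z 2 - x z 2 * v z 1) (hx0 : ∀ z, 0 < x z 2) :
    Continuous fun z => corr (a z) (b z) (x z) (v z) := by
  have hm1 : ∀ z, x z 1 * v z 2 - x z 2 * v z 1 ≠ 0 := fun z => (hm0 z).ne'
  have hx1 : ∀ z, x z 2 ≠ 0 := fun z => (hx0 z).ne'
  refine continuous_matrix fun i j => ?_
  simp only [corr]
  fin_cases j <;> simp <;> fun_prop (disch := assumption)

end Correction

/-! ### Curves made of four circular arcs -/

section FourArcs

theorem norm_mv_rot (φ x : ℝ) (y : E3) : ‖mv (rot φ x) y‖ = ‖y‖ := by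
  have h1 := Real.sin_sq_add_cos_sq φ
  have h2 := Real.sin_sq_add_cos_sq x
  rw [EuclideanSpace.norm_eq, EuclideanSpace.norm_eq, Fin.sum_univ_three, Fin.sum_univ_three]
  congr 1
  simp only [mv_apply, Real.norm_eq_abs, sq_abs]
  simp [rot]
  grind

/-- A circular arc, followed by `c` in the frame at the end of the arc. -/
def prepend (φ θ : ℝ) (c : H2 E3) : H2 E3 := join (carc φ θ) (hproj (rot φ θ) c)

variable {φ θ : ℝ} {c : H2 E3}

theorem rot_det_pos (φ θ : ℝ) : 0 < (rot φ θ).det := by rw [rot_det]; exact one_pos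

theorem prepend_flags (hs : 0 < Real.sin φ) (hc : 0 < Real.cos φ) (hθ : 0 < θ) (ha : IsArc c)
    (h0 : SameFlag stdFlag (flag c 0)) :
    SameFlag (flag (carc φ θ) 1) (flag (hproj (rot φ θ) c) 0) :=
  (carc_flag_one hs hc hθ).symm.trans
    ((h0.map _).trans ((hproj_spec (rot_det_pos φ θ) ha).2.1 0 (by simp)))

theorem prepend_spec (hs : 0 < Real.sin φ) (hc : 0 < Real.cos φ) (hθ : 0 < θ) (ha : IsArc c)
    (h0 : SameFlag stdFlag (flag c 0)) {A : Matrix (Fin 3) (Fin 3) ℝ}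
    (h1 : SameFlag (mapFlag A stdFlag) (flag c 1)) :
    IsArc (prepend φ θ c) ∧ SameFlag stdFlag (flag (prepend φ θ c) 0) ∧
      SameFlag (mapFlag (rot φ θ * A) stdFlag) (flag (prepend φ θ c) 1) := by
  obtain ⟨k1, k2, -⟩ := hproj_spec (rot_det_pos φ θ) ha
  obtain ⟨j1, j2, j3, -⟩ := join_spec (carc_spec hs hc hθ).1 k1 (prepend_flags hs hc hθ ha h0)
  refine ⟨j1, (carc_flag_zero hs hc hθ).trans j2, ?_⟩
  rw [mapFlag_mul]
  exact ((h1.map _).trans (k2 1 (by simp))).trans j3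

/-- A rotation preserves norms, so the projective transformation is the rotation itself; it shifts
the angle along its own circle by `θ`. -/
theorem prepend_rep (hs : 0 < Real.sin φ) (hc : 0 < Real.cos φ) (hθ : 0 < θ) (ha : IsArc c)
    (h0 : SameFlag stdFlag (flag c 0)) {β : ℝ} (hβ : 0 < β)
    (h : Rep (hpos c) (hpos (carc φ β))) :
    Rep (hpos (prepend φ θ c)) (hpos (carc φ (θ + β))) := by
  obtain ⟨k1, -, k3⟩ := hproj_spec (rot_det_pos φ θ) ha
  obtain ⟨-, -, -, j⟩ := join_spec (carc_spec hs hc hθ).1 k1 (prepend_flags hs hc hθ ha h0)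
  obtain ⟨χ, h1, h2, h3⟩ := h
  have e : Rep (hpos (hproj (rot φ θ) c)) fun t => mv (rot φ θ) (hpos (carc φ β) t) :=
    ⟨χ, h1, h2, fun t ht => by
      rw [k3 t ht, norm_mv_rot, ha.norm t ht, inv_one, one_smul, h3 t ht]⟩
  refine (j.trans (Rep.cat (Rep.refl _) e)).trans (rep_cat_circle φ hθ hβ
    (fun t ht => carc_pos _ _ ht) (fun t ht => ?_) fun t ht => carc_pos _ _ ht)
  rw [carc_pos _ _ ht, mv_rot_cpt]

theorem continuous_prepend {T : Type*} [TopologicalSpace T] {φ θ : T → ℝ} {c : T → H2 E3}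
    (hφ : Continuous φ) (hθ : Continuous θ) (hc : Continuous c) (h1 : ∀ x, 0 < Real.sin (φ x))
    (h2 : ∀ x, 0 < Real.cos (φ x)) (h3 : ∀ x, 0 < θ x) (ha : ∀ x, IsArc (c x)) :
    Continuous fun x => prepend (φ x) (θ x) (c x) :=
  continuous_join (continuous_carc hφ hθ) (continuous_hproj
    (continuous_rot.comp (f := fun x => (φ x, θ x)) (by fun_prop)) (fun x => rot_det_pos _ _) hc ha)
    (fun x => (carc_spec (h1 x) (h2 x) (h3 x)).1) fun x => (hproj_spec (rot_det_pos _ _) (ha x)).1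

/-- Four circular arcs, with axes at complementary angles. -/
def fourArcs (ψ θ τ : ℝ) : H2 E3 :=
  prepend (Real.pi / 2 - ψ) θ (prepend ψ τ (prepend (Real.pi / 2 - ψ) θ (carc ψ τ)))

/-- The frame at the end of `fourArcs`. -/
def fourRot (ψ θ τ : ℝ) : Matrix (Fin 3) (Fin 3) ℝ :=
  rot (Real.pi / 2 - ψ) θ * (rot ψ τ * (rot (Real.pi / 2 - ψ) θ * rot ψ τ))

theorem continuous_fourRot {T : Type*} [TopologicalSpace T] {ψ θ τ : T → ℝ} (hψ : Continuous ψ)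
    (hθ : Continuous θ) (hτ : Continuous τ) : Continuous fun x => fourRot (ψ x) (θ x) (τ x) := by
  have h1 : Continuous fun x => rot (Real.pi / 2 - ψ x) (θ x) :=
    continuous_rot.comp (f := fun x => (Real.pi / 2 - ψ x, θ x)) (by fun_prop)
  have h2 : Continuous fun x => rot (ψ x) (τ x) :=
    continuous_rot.comp (f := fun x => (ψ x, τ x)) (by fun_prop)
  exact h1.matrix_mul (h2.matrix_mul (h1.matrix_mul h2))

theorem rot_pi_mul_rot_pi (ψ : ℝ) : rot ψ Real.pi * rot ψ Real.pi = 1 := by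
  rw [rot_mul, ← two_mul, rot_two_pi]

/-- Only two half turns about the same axis remain. -/
theorem fourRot_of_rot_eq_one {ψ θ : ℝ} (h : rot (Real.pi / 2 - ψ) θ = 1) :
    fourRot ψ θ Real.pi = 1 := by
  rw [fourRot, h, one_mul, one_mul, rot_pi_mul_rot_pi]

/-- For `ψ = 0` a rotation about `e₁` follows a half turn about `e₃`. The product is a half turn
about an axis orthogonal to `e₁`, whatever `θ` is, and fits twice into the word. -/
theorem fourRot_zero (θ : ℝ) : fourRot 0 θ Real.pi = 1 := by
  have h := Real.sin_sq_add_cos_sq θ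
  have e : rot (Real.pi / 2) θ * rot 0 Real.pi * (rot (Real.pi / 2) θ * rot 0 Real.pi) = 1 := by
    have e1 : rot (Real.pi / 2) θ * rot 0 Real.pi =
        !![-1, 0, 0; 0, -Real.cos θ, -Real.sin θ; 0, -Real.sin θ, Real.cos θ] := by
      ext i j
      simp only [Matrix.mul_apply, Fin.sum_univ_three]
      fin_cases i <;> fin_cases j <;> simp [rot]
    rw [e1]
    ext i j
    simp only [Matrix.mul_apply, Fin.sum_univ_three]
    fin_cases i <;> fin_cases j <;> simp <;> linarith
  rw [fourRot, sub_zero, ← mul_assoc, e]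

variable {ψ θ τ : ℝ}

theorem sin_cos_compl_pos (h0 : 0 < ψ) (h1 : ψ < Real.pi / 2) :
    0 < Real.sin ψ ∧ 0 < Real.cos ψ ∧ 0 < Real.sin (Real.pi / 2 - ψ) ∧
      0 < Real.cos (Real.pi / 2 - ψ) := by
  have hs : 0 < Real.sin ψ := Real.sin_pos_of_pos_of_lt_pi h0 (by linarith [Real.pi_pos])
  have hc : 0 < Real.cos ψ := Real.cos_pos_of_mem_Ioo ⟨by linarith [Real.pi_pos], h1⟩
  exact ⟨hs, hc, by rwa [Real.sin_pi_div_two_sub], by rwa [Real.cos_pi_div_two_sub]⟩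

theorem fourArcs_spec (h0 : 0 < ψ) (h1 : ψ < Real.pi / 2) (hθ : 0 < θ) (hτ : 0 < τ) :
    IsArc (fourArcs ψ θ τ) ∧ SameFlag stdFlag (flag (fourArcs ψ θ τ) 0) ∧
      SameFlag (mapFlag (fourRot ψ θ τ) stdFlag) (flag (fourArcs ψ θ τ) 1) := by
  obtain ⟨s1, c1, s2, c2⟩ := sin_cos_compl_pos h0 h1
  obtain ⟨a1, a2, a3⟩ := prepend_spec s2 c2 hθ (carc_spec s1 c1 hτ).1 (carc_flag_zero s1 c1 hτ)
    (carc_flag_one s1 c1 hτ)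
  obtain ⟨b1, b2, b3⟩ := prepend_spec s1 c1 hτ a1 a2 a3
  exact prepend_spec s2 c2 hθ b1 b2 b3

theorem continuous_fourArcs {T : Type*} [TopologicalSpace T] {ψ θ τ : T → ℝ} (hψ : Continuous ψ)
    (hθ : Continuous θ) (hτ : Continuous τ) (h0 : ∀ x, 0 < ψ x) (h1 : ∀ x, ψ x < Real.pi / 2)
    (hθ0 : ∀ x, 0 < θ x) (hτ0 : ∀ x, 0 < τ x) :
    Continuous fun x => fourArcs (ψ x) (θ x) (τ x) := by
  have sc := fun x => sin_cos_compl_pos (h0 x) (h1 x)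
  have hψ' : Continuous fun x => Real.pi / 2 - ψ x := by fun_prop
  have k0 := fun x => carc_spec (sc x).1 (sc x).2.1 (hτ0 x)
  have k0' := fun x => carc_flag_zero (sc x).1 (sc x).2.1 (hτ0 x)
  have k1 := fun x => prepend_spec (sc x).2.2.1 (sc x).2.2.2 (hθ0 x) (k0 x).1 (k0' x)
    (carc_flag_one (sc x).1 (sc x).2.1 (hτ0 x))
  have k2 := fun x => prepend_spec (sc x).1 (sc x).2.1 (hτ0 x) (k1 x).1 (k1 x).2.1 (k1 x).2.2
  exact continuous_prepend hψ' hθ (continuous_prepend hψ hτ (continuous_prepend hψ' hθ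
    (continuous_carc hψ hτ) (fun x => (sc x).2.2.1) (fun x => (sc x).2.2.2) hθ0 fun x => (k0 x).1)
    (fun x => (sc x).1) (fun x => (sc x).2.1) hτ0 fun x => (k1 x).1)
    (fun x => (sc x).2.2.1) (fun x => (sc x).2.2.2) hθ0 fun x => (k2 x).1

/-- The angle `π/4` is its own complement, so all four arcs lie on the circle of `ν₁`. -/
theorem fourArcs_rep (hθ : 0 < θ) (hτ : 0 < τ) {n : ℕ}
    (h : θ + (τ + (θ + τ)) = 2 * Real.pi * n) :
    Rep (hpos (fourArcs (Real.pi / 4) θ τ)) (hpos (nuArc n)) := by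
  have e : Real.pi / 2 - Real.pi / 4 = Real.pi / 4 := by ring
  have s := sin_pi_div_four_pos
  have c := cos_pi_div_four_pos
  rw [fourArcs, nuArc, e, ← h]
  obtain ⟨a1, a2, a3⟩ := prepend_spec s c hθ (carc_spec s c hτ).1 (carc_flag_zero s c hτ)
    (carc_flag_one s c hτ)
  obtain ⟨b1, b2, -⟩ := prepend_spec s c hτ a1 a2 a3
  have r1 := prepend_rep s c hθ (carc_spec s c hτ).1 (carc_flag_zero s c hτ) hτ (Rep.refl _)
  have r2 := prepend_rep s c hτ a1 a2 (by positivity) r1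
  exact prepend_rep s c hθ b1 b2 (by positivity) r2

theorem fourRot_pi_div_four {n : ℕ} (h : θ + (τ + (θ + τ)) = 2 * Real.pi * n) :
    fourRot (Real.pi / 4) θ τ = 1 := by
  have e : Real.pi / 2 - Real.pi / 4 = Real.pi / 4 := by ring
  rw [fourRot, e, rot_mul, rot_mul, rot_mul, h, rot_two_pi_mul]

end FourArcs

/-! ### Changing the initial flag of a curve -/

section Modify

/-- The curve `c` with its part on `[0, δ]` transformed by `P`. -/
def modify (δ : ℝ) (P : Matrix (Fin 3) (Fin 3) ℝ) (c : H2 E3) : H2 E3 :=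
  hgvar δ (hproj P (hcomp c (haff 0 δ))) c

variable {δ : ℝ} {P : Matrix (Fin 3) (Fin 3) ℝ} {c : H2 E3}

theorem initial_spec (h0 : 0 < δ) (h1 : δ < 1) (hc : IsArc c) : IsArc (hcomp c (haff 0 δ)) ∧
    (∀ t ∈ Icc (0 : ℝ) 1, SameFlag (flag c (δ * t)) (flag (hcomp c (haff 0 δ)) t)) ∧
    ∀ t ∈ Icc (0 : ℝ) 1, hpos (hcomp c (haff 0 δ)) t = hpos c (δ * t) := by
  obtain ⟨ev, ep⟩ := hcomp_spec c (haff_vel_pos (q := 0) h0)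
  simp only [haff_vel, haff_pos, zero_add] at ev ep
  refine ⟨isArcOn_hcomp subset_rfl (haff_vel_pos h0) (fun t ht => ?_) hc, fun t ht => ?_, ep⟩
  · rw [haff_pos, zero_add]
    exact ⟨mul_nonneg h0.le ht.1, mul_le_one₀ h1.le ht.1 ht.2⟩
  · exact SameFlag.of_smul h0 (ep t ht) (ev t ht)

/-- As `P` keeps the flag at `δ`, the transformed initial piece still fits the rest of `c`, while
its first flag is moved by `P`. -/
theorem modify_spec (h0 : 0 < δ) (h1 : δ < 1) (hc : IsArc c) (hP : 0 < P.det)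
    (hf : SameFlag (flag c δ) (mapFlag P (flag c δ))) :
    IsArc (modify δ P c) ∧ SameFlag (mapFlag P (flag c 0)) (flag (modify δ P c) 0) ∧
      flag (modify δ P c) 1 = flag c 1 ∧ (P = 1 → Rep (hpos (modify δ P c)) (hpos c)) := by
  obtain ⟨i1, i2, i3⟩ := initial_spec h0 h1 hc
  obtain ⟨k1, k2, k3⟩ := hproj_spec hP i1
  have m0 : (0 : ℝ) ∈ Icc (0 : ℝ) 1 := by simp
  have m1 : (1 : ℝ) ∈ Icc (0 : ℝ) 1 := by simp
  have mδ : δ ∈ Icc (0 : ℝ) 1 := ⟨h0.le, h1.le⟩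
  have s1 := i2 1 m1
  rw [mul_one] at s1
  obtain ⟨e1, e2⟩ := ((hf.trans (s1.map P)).trans (k2 1 m1)).symm.exact (k1.norm 1 m1)
    (hc.norm δ mδ) (k1.inner_eq_zero m1) (hc.inner_eq_zero mδ)
  obtain ⟨g1, g2, g3, χ, g4, g5, g6⟩ := hgvar_spec h0 h1.le k1
    (hc.mono (Icc_subset_Icc_left h0.le)) e1 e2
  have s0 := i2 0 m0
  rw [mul_zero] at s0
  refine ⟨g1, ((s0.map P).trans (k2 0 m0)).trans g2, g3, ?_⟩
  rintro rfl
  have hpos1 : ∀ t ∈ Icc (0 : ℝ) 1, hpos (hproj 1 (hcomp c (haff 0 δ))) t = hpos c (δ * t) :=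
    fun t ht => by
      rw [k3 t ht, mv_one, i1.norm t ht, inv_one, one_smul, i3 t ht]
  have r1 : Rep (cat (fun t => hpos (modify δ 1 c) (δ * t))
      fun t => hpos (modify δ 1 c) (δ + (1 - δ) * t)) (hpos (modify δ 1 c)) :=
    rep_cat_id h0 h1 (fun _ _ => rfl) fun _ _ => rfl
  have r2 : Rep (cat (fun t => hpos c (δ * t)) fun t => hpos c (δ + (1 - δ) * t)) (hpos c) :=
    rep_cat_id h0 h1 (fun _ _ => rfl) fun _ _ => rfl
  refine (r1.symm.trans (Rep.cat ⟨χ, g4, g5, fun t ht => ?_⟩ (Rep.of_eqOn fun t ht => ?_))).trans r2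
  · have hm : δ * t ≤ δ := mul_le_of_le_one_right h0.le ht.2
    beta_reduce
    rw [modify, g6 _ ⟨mul_nonneg h0.le ht.1, hm.trans h1.le⟩, if_pos hm,
      inv_mul_cancel_left₀ h0.ne', hpos1 _ (g5.mapsTo ht)]
  · have hm : 0 ≤ (1 - δ) * t := mul_nonneg (by linarith) ht.1
    have hm' : δ + (1 - δ) * t ≤ 1 := by nlinarith [ht.2]
    rw [modify, g6 _ ⟨by linarith, hm'⟩]
    -- The junction `t = 0` falls into the branch of the first piece, whose end is the point of `c`
    -- at `δ`.
    split_ifs with hle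
    · have ht0 : (1 - δ) * t = 0 := by linarith
      rw [ht0, add_zero, inv_mul_cancel₀ h0.ne', (bijOn_zero_one g4 g5).2]
      exact e1.symm
    · rfl

theorem continuous_modify {T : Type*} [TopologicalSpace T] {P : T → Matrix (Fin 3) (Fin 3) ℝ}
    {c : T → H2 E3} (hPc : Continuous P) (hcc : Continuous c) (h0 : 0 < δ) (h1 : δ < 1)
    (hc : ∀ x, IsArc (c x)) (hP : ∀ x, 0 < (P x).det) :
    Continuous fun x => modify δ (P x) (c x) := by
  have i := fun x => (initial_spec h0 h1 (hc x)).1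
  exact continuous_hgvar continuous_const (continuous_hproj hPc hP
    (continuous_hcomp hcc continuous_const fun _ => haff_vel_pos h0) i) hcc (fun _ => h0)
    (fun _ => h1.le) (fun x => (hproj_spec (hP x) (i x)).1) fun x => (hc x).vel δ ⟨h0.le, h1.le⟩

end Modify

/-! ### Insertion of two circles, and conclusion -/

section AddTwo

/-- The angles of the first and third arc. -/
def pathθ (η s : ℝ) : ℝ := max η (2 * Real.pi * min 1 (3 * s - 1))

/-- The angles of the axes. -/
def pathψ (η s : ℝ) : ℝ := max η (Real.pi / 4 * max (1 - 3 * s) (3 * s - 2))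

/-- The angles of the second and fourth arc. -/
def pathτ (η s : ℝ) : ℝ := Real.pi - (1 - s) * η

def pathRot (η s : ℝ) : Matrix (Fin 3) (Fin 3) ℝ := fourRot (pathψ η s) (pathθ η s) (pathτ η s)

theorem continuous_path {T : Type*} [TopologicalSpace T] {η s : T → ℝ} (hη : Continuous η)
    (hs : Continuous s) : (Continuous fun x => pathψ (η x) (s x)) ∧
      (Continuous fun x => pathθ (η x) (s x)) ∧ Continuous fun x => pathτ (η x) (s x) := by
  unfold pathψ pathθ pathτ
  exact ⟨by fun_prop, by fun_prop, by fun_prop⟩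

/-- The degenerate path. On the first third `θ = 0` while the axis angle `ψ` goes from `π/4` to `0`;
on the second `ψ = 0` while `θ` grows to `2π`; on the last `θ = 2π` while `ψ` returns to `π/4`. The
final frame never changes, but arcs of length zero and great circles are not admissible, hence the
perturbation by `η`. -/
theorem pathRot_zero {s : ℝ} : pathRot 0 s = 1 := by
  have hpi := Real.pi_pos
  have hτ : pathτ 0 s = Real.pi := by simp [pathτ]
  rw [pathRot, hτ]
  rcases le_total s (1 / 3) with h | h
  · have hθ : pathθ 0 s = 0 := max_eq_left (mul_nonpos_of_nonneg_of_nonpos (by positivity)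
      ((min_le_right _ _).trans (by linarith)))
    rw [hθ]
    exact fourRot_of_rot_eq_one (rot_zero _)
  · rcases le_total s (2 / 3) with h' | h'
    · have hψ : pathψ 0 s = 0 := max_eq_left (mul_nonpos_of_nonneg_of_nonpos (by positivity)
        (max_le (by linarith) (by linarith)))
      rw [hψ]
      exact fourRot_zero _
    · have hθ : pathθ 0 s = 2 * Real.pi := by
        rw [pathθ, min_eq_left (by linarith), mul_one, max_eq_right (by positivity)]
      rw [hθ]
      exact fourRot_of_rot_eq_one (rot_two_pi _)

variable {K : Type*} [TopologicalSpace K]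

/-- Two more circles can be inserted. -/
theorem homotopic_one_three [CompactSpace K] (f g g' : C(K, locallyConvex))
    (hg : IsNuConcat 1 f g) (hg' : IsNuConcat 3 f g') : g.Homotopic g' := by
  have hpi := Real.pi_pos
  obtain ⟨δ, δ0, δ1, hδ⟩ := exists_positive_time f
  have hl := fun p => toH2_isLoop (f p)
  have hcc := continuous_toH2_locallyConvex f
  let x : K → E3 := fun p => hpos (toH2 (f p).1) δ
  let v : K → E3 := fun p => hvel (toH2 (f p).1) δ
  have xc : Continuous x := Continuous.hpos hcc continuous_const
  have vc : Continuous v := Continuous.hvel hcc continuous_const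
  let a : ℝ × (I × K) → E3 := fun z => mv (pathRot z.1 z.2.1) e₁
  let b : ℝ × (I × K) → E3 := fun z => mv (pathRot z.1 z.2.1) e₂
  have Rc : Continuous fun z : ℝ × (I × K) => pathRot z.1 z.2.1 := by
    obtain ⟨h1, h2, h3⟩ := continuous_path (T := ℝ × (I × K)) (η := fun z => z.1)
      (s := fun z => z.2.1) (by fun_prop) (by fun_prop)
    exact continuous_fourRot h1 h2 h3
  have ac : Continuous a := (continuous_mv.comp Rc).clm_apply continuous_const
  have bc : Continuous b := (continuous_mv.comp Rc).clm_apply continuous_const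
  have ci : ∀ {u : ℝ × (I × K) → E3}, Continuous u → ∀ i, Continuous fun z => u z i :=
    fun hu i => (EuclideanSpace.proj (𝕜 := ℝ) i).continuous.comp hu
  have xc' := ci (xc.comp (continuous_snd.comp (continuous_snd (X := ℝ) (Y := I × K))))
  have vc' := ci (vc.comp (continuous_snd.comp (continuous_snd (X := ℝ) (Y := I × K))))
  have ac' := ci ac
  have bc' := ci bc
  -- For `η = 0` the final frame is the identity and the conditions are those of
  -- `exists_positive_time`. They are open, so by compactness of `I × K` one small `η` serves for
  -- all parameters.
  have ev := isCompact_univ.eventually_forall_of_forall_eventually (K := (univ : Set (I × K)))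
    (x₀ := (0 : ℝ)) (P := fun η y =>
      0 < (x y.2 1 * v y.2 2 - x y.2 2 * v y.2 1) * a (η, y) 0 +
        (x y.2 2 * v y.2 0 - x y.2 0 * v y.2 2) * a (η, y) 1 +
        (x y.2 0 * v y.2 1 - x y.2 1 * v y.2 0) * a (η, y) 2 ∧
      0 < (a (η, y) 1 * b (η, y) 2 - a (η, y) 2 * b (η, y) 1) * x y.2 0 +
        (a (η, y) 2 * b (η, y) 0 - a (η, y) 0 * b (η, y) 2) * x y.2 1 +
        (a (η, y) 0 * b (η, y) 1 - a (η, y) 1 * b (η, y) 0) * x y.2 2) fun y _ => by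
    have a0 : a (0, y) = e₁ := by simp only [a, pathRot_zero, mv_one]
    have b0 : b (0, y) = e₂ := by simp only [b, pathRot_zero, mv_one]
    refine (Continuous.continuousAt ?_ |>.eventually (lt_mem_nhds (a := 0) ?_)).and
      (Continuous.continuousAt ?_ |>.eventually (lt_mem_nhds (a := 0) ?_))
    · exact (((((xc' 1).mul (vc' 2)).sub ((xc' 2).mul (vc' 1))).mul (ac' 0)).add
        ((((xc' 2).mul (vc' 0)).sub ((xc' 0).mul (vc' 2))).mul (ac' 1))).add
        ((((xc' 0).mul (vc' 1)).sub ((xc' 1).mul (vc' 0))).mul (ac' 2))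
    · rw [a0]; simpa [e₁] using (hδ y.2).2
    · exact (((((ac' 1).mul (bc' 2)).sub ((ac' 2).mul (bc' 1))).mul (xc' 0)).add
        ((((ac' 2).mul (bc' 0)).sub ((ac' 0).mul (bc' 2))).mul (xc' 1))).add
        ((((ac' 0).mul (bc' 1)).sub ((ac' 1).mul (bc' 0))).mul (xc' 2))
    · rw [a0, b0]; simpa [e₁, e₂] using (hδ y.2).1
  obtain ⟨ε, hε, H⟩ := Metric.eventually_nhds_iff.1 ev
  -- The bound `π/4` keeps `ψ < π/2` and `τ > 0`, and leaves `ψ = π/4` at both ends of the path.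
  set η : ℝ := min (ε / 2) (Real.pi / 4) with hη
  have η0 : 0 < η := lt_min (by positivity) (by positivity)
  have η1 : η ≤ Real.pi / 4 := min_le_right _ _
  have cond := fun y => H (y := η) (by
    rw [Real.dist_eq, sub_zero, abs_of_pos η0]
    linarith [min_le_left (ε / 2) (Real.pi / 4)]) y (mem_univ _)
  -- the angles
  obtain ⟨ψc, θc, τc⟩ := continuous_path (T := I × K) (η := fun _ => η) (s := fun y => y.1)
    (by fun_prop) (by fun_prop)
  have ψ0 : ∀ s, 0 < pathψ η s := fun s => η0.trans_le (le_max_left _ _)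
  have ψ1 : ∀ s : I, pathψ η s < Real.pi / 2 := fun s => by
    refine max_lt (by linarith) ?_
    have : max (1 - 3 * (s : ℝ)) (3 * s - 2) ≤ 1 :=
      max_le (by linarith [s.2.1]) (by linarith [s.2.2])
    nlinarith
  have θ0 : ∀ s, 0 < pathθ η s := fun s => η0.trans_le (le_max_left _ _)
  have τ0 : ∀ s : I, 0 < pathτ η s := fun s => by
    have : (1 - (s : ℝ)) * η ≤ 1 * η := by
      refine mul_le_mul_of_nonneg_right ?_ η0.le
      linarith [s.2.1]
    rw [pathτ]; linarith
  -- the family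
  let P : I × K → Matrix (Fin 3) (Fin 3) ℝ := fun y => corr (a (η, y)) (b (η, y)) (x y.2) (v y.2)
  have Pc : Continuous P := continuous_corr (ac.comp (f := fun y => (η, y)) (by fun_prop))
    (bc.comp (f := fun y => (η, y)) (by fun_prop)) (xc.comp continuous_snd) (vc.comp continuous_snd)
    (fun y => (hδ y.2).2) fun y => (hδ y.2).1
  have Pd : ∀ y, 0 < (P y).det := fun y =>
    corr_det (hδ y.2).2 (hδ y.2).1 (cond y).1 (cond y).2
  have spec := fun y : I × K => modify_spec δ0 δ1 (hl y.2).arc (Pd y)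
    (corr_flag_end (hδ y.2).2 (hδ y.2).1 (cond y).2)
  have fspec := fun y : I × K => fourArcs_spec (ψ0 y.1) (ψ1 y.1) (θ0 y.1) (τ0 y.1)
  -- `corr` sends the standard flag, at which `f p` starts, to the flag at which the four arcs end.
  have hmatch : ∀ y : I × K, SameFlag (flag (fourArcs (pathψ η y.1) (pathθ η y.1) (pathτ η y.1)) 1)
      (flag (modify δ (P y) (toH2 (f y.2).1)) 0) := fun y => by
    refine (fspec y).2.2.symm.trans (SameFlag.trans ?_ (spec y).2.1)
    rw [(hl y.2).start]
    exact corr_flag_start (hδ y.2).2 (cond y).1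
  have jspec := fun y : I × K => join_spec (fspec y).1 (spec y).1 (hmatch y)
  have Pone : ∀ y : I × K, pathRot η y.1 = 1 → P y = 1 := fun y h => by
    simp only [P, a, b, h, mv_one]
    exact corr_std (hδ y.2).2 (hδ y.2).1
  -- When `ψ = π/4` and the total angle is a multiple of `2π`, the correction is trivial. This
  -- occurs at `s = 0`, with total angle `2π`, and at `s = 1`, with `6π`.
  have rep : ∀ (s : I) (p : K) (n : ℕ), pathψ η s = Real.pi / 4 →
      pathθ η s + (pathτ η s + (pathθ η s + pathτ η s)) = 2 * Real.pi * n →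
      Rep (hpos (join (fourArcs (pathψ η s) (pathθ η s) (pathτ η s))
        (modify δ (P (s, p)) (toH2 (f p).1)))) (cat (hpos (nuArc n)) (hpos (toH2 (f p).1))) := by
    intro s p n h1 h2
    refine (jspec (s, p)).2.2.2.trans (Rep.cat ?_ ?_)
    · have := fourArcs_rep (θ0 s) (τ0 s) h2
      rwa [← h1] at this
    · refine (spec (s, p)).2.2.2 (Pone (s, p) ?_)
      have := fourRot_pi_div_four h2
      rwa [← h1] at this
  refine homotopic_of_closed (c := fun y => join (fourArcs (pathψ η y.1) (pathθ η y.1)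
    (pathτ η y.1)) (modify δ (P y) (toH2 (f y.2).1))) ?_ (fun y => ?_) g g' (fun p => ?_) fun p => ?_
  · exact continuous_join (continuous_fourArcs ψc θc τc (fun y => ψ0 y.1) (fun y => ψ1 y.1)
      (fun y => θ0 y.1) fun y => τ0 y.1) (continuous_modify Pc (hcc.comp continuous_snd) δ0 δ1
      (fun y => (hl y.2).arc) Pd) (fun y => (fspec y).1) fun y => (spec y).1
  · obtain ⟨j1, j2, j3, -⟩ := jspec y
    refine ⟨j1, (fspec y).2.1.trans j2, SameFlag.trans ?_ j3⟩
    rw [(spec y).2.2.1]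
    exact (hl y.2).isClosedArc.finish
  · refine (isNuConcat_iff.1 hg p).trans (rep 0 p 1 ?_ ?_).symm
    · simp only [pathψ, Icc.coe_zero]
      norm_num
      exact η1
    · have : pathθ η ((0 : I) : ℝ) = η := by
        refine max_eq_left ((mul_nonpos_of_nonneg_of_nonpos (by positivity) ?_).trans η0.le)
        simp
      rw [this]
      simp [pathτ]
      ring
  · refine (isNuConcat_iff.1 hg' p).trans (rep 1 p 3 ?_ ?_).symm
    · simp only [pathψ, Icc.coe_one]
      norm_num
      exact η1
    · have : pathθ η ((1 : I) : ℝ) = 2 * Real.pi := by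
        rw [pathθ, Icc.coe_one, min_eq_left (by norm_num), mul_one, max_eq_right (by linarith)]
      rw [this]
      simp [pathτ]
      ring

/-- All circles but one are absorbed into the family: `homotopic_one_three` is applied to `ν_m * f`
with `n = 1 + m`. The case `n = 1` is separate because `ν_0` is constant and not an arc. -/
theorem homotopic_add_two [CompactSpace K] (f g g' : C(K, locallyConvex)) {n : ℕ} (hn : 0 < n)
    (hg : IsNuConcat n f g) (hg' : IsNuConcat (n + 2) f g') : g.Homotopic g' := by
  obtain rfl | h := (Nat.succ_le_of_lt hn).eq_or_lt
  · exact homotopic_one_three f g g' hg hg'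
  · obtain ⟨m, rfl⟩ : ∃ m, n = 1 + m := ⟨n - 1, by omega⟩
    have hm : 0 < m := by omega
    obtain ⟨f', hf'⟩ := exists_isNuConcat f hm
    rw [isNuConcat_iff] at hf' hg hg'
    have key : ∀ k : ℕ, 0 < k → ∀ p, Rep (cat (hpos (nuArc (k + m))) (hpos (toH2 (f p).1)))
        (cat (hpos (nuArc k)) (hpos (toH2 (f' p).1))) := fun k hk p =>
      ((Rep.cat (rep_nuArc_add hk hm).symm (Rep.refl _)).trans
        (rep_cat_assoc _ _ _).symm).trans (Rep.cat (Rep.refl _) (hf' p).symm)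
    refine homotopic_one_three f' g g' (isNuConcat_iff.2 fun p => (hg p).trans (key 1 one_pos p))
      (isNuConcat_iff.2 fun p => (hg' p).trans ?_)
    rw [show 1 + m + 2 = 3 + m by ring]
    exact key 3 (by norm_num) p

theorem homotopic_add_even [CompactSpace K] (f g g' : C(K, locallyConvex)) {n : ℕ} (hn : 0 < n)
    (k : ℕ) (hg : IsNuConcat n f g) (hg' : IsNuConcat (n + 2 * k) f g') : g.Homotopic g' := by
  induction k generalizing g' with
  | zero =>
    rw [isNuConcat_iff] at hg hg'
    exact homotopic_of_rep g g' fun p => (hg p).trans (hg' p).symm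
  | succ k ih =>
    obtain ⟨h, hh⟩ := exists_isNuConcat f (n := n + 2 * k) (by omega)
    exact (ih h hh).trans (homotopic_add_two f h g' (by omega) hh
      (by rwa [show n + 2 * k + 2 = n + 2 * (k + 1) by ring]))

end AddTwo

end LocallyConvex
end

theorem mainTheorem6 {K : Type*} [TopologicalSpace K] [CompactSpace K]
    (f : C(K, LocallyConvex.locallyConvex))
    (hf : (LocallyConvex.inclusion.comp f).Nullhomotopic)
    (n : ℕ) (hn : 0 < n) :
    (∃ g : C(K, LocallyConvex.locallyConvex), LocallyConvex.IsNuConcat n f g) ∧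
      ∀ g : C(K, LocallyConvex.locallyConvex),
        LocallyConvex.IsNuConcat n f g → g.Nullhomotopic := by
  refine ⟨LocallyConvex.exists_isNuConcat f hn, fun g hg => ?_⟩
  obtain ⟨M, hM⟩ := LocallyConvex.nullhomotopic_of_large f hf
  -- The number `n + 2 * M` is at least `M` and has the parity of `n`.
  obtain ⟨g', hg'⟩ := LocallyConvex.exists_isNuConcat f (n := n + 2 * M) (by omega)
  obtain ⟨z, hz⟩ := hM (n + 2 * M) (by omega) g' hg'
  exact ⟨z, (LocallyConvex.homotopic_add_even f g g' hn M hg hg').trans hz⟩
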